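/- Let $\mathbb{S}^2\subset\mathbb{R}^3$ be the unit sphere with surface measure $\sigma$, let $L^2(\mathbb{S}^2)$ be the space of real-valued square integrable functions, and let $(Y_{\ell,m},\ \ell\in\mathbb{N}_0,\ -\ell\le m\le\ell)$ be the standard (complex, orthonormal) spherical harmonics, $\Delta_{\mathbb{S}^2}Y_{\ell,m}=-\ell(\ell+1)Y_{\ell,m}$. Write $f^{\ell,m}=(f,Y_{\ell,m})_{L^2}$ and $\|f\|_{H^s}^2=\sum_{\ell,m}(1+\ell(\ell+1))^s|f^{\ell,m}|^2$. Let $W$ be an $L^2(\mathbb{S}^2)$-valued isotropic $Q$-Wiener process on $[0,T]$, with continuous paths, $QY_{\ell,m}=A_\ell Y_{\ell,m}$, where $(A_\ell)$ is a sequence of nonnegative numbers for which there are $\ell_0\in\mathbb{N}$, $\alpha>2$ and $C>0$ with $A_\ell\le C\ell^{-\alpha}$ for all $\ell>\ell_0$. Let $v_1,v_2\in L^2(\mathbb{S}^2)$ be deterministic with $v_1\in H^\beta(\mathbb{S}^2)$ and $v_2\in H^\gamma(\mathbb{S}^2)$, and let $(u_1,u_2)$ solve the stochastic wave equation in the sense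 of distributions on $\mathbb{S}^2$, that is, tested against each smooth function on $\mathbb{S}^2$, almost surely for all $t\in[0,T]$, $$u_1(t)=v_1+\int_0^t u_2(s)\,ds,\qquad u_2(t)=v_2+\int_0^t\Delta_{\mathbb{S}^2}u_1(s)\,ds+W(t),$$ where $u_1$ takes values in $L^2(\mathbb{S}^2)$ and $u_2$ in the generalized functions on $\mathbb{S}^2$. For a time grid $0=t_0<\dots<t_n=t$, $t\in[0,T]$, with steps $h=t_{j+1}-t_j$, put $\lambda_\ell=\sqrt{\ell(\ell+1)}$, $R_1^\ell(s)=\lambda_\ell^{-1}\sin(s\lambda_\ell)$ (with $R_1^0(s)=s$), $R_2^\ell(s)=\cos(s\lambda_\ell)$, and define recursively $u_i^{\ell,m}(0)=v_i^{\ell,m}$ and $$u_1^{\ell,m}(t_{j+1})=R_2^\ell(h)u_1^{\ell,m}(t_j)+R_1^\ell(h)u_2^{\ell,m}(t_j)+\int_{t_j}^{t_{j+1}}R_1^\ell(t_{j+1}-s)\,dW^{\ell,m}(s),$$ $$u_2^{\ell,m}(t_{j+1})=-\ell(\ell+1)R_1^\ell(h)u_1^{\ell,m}(t_j)+R_2^\ell(h)u_2^{\ell,m}(t_j)+\int_{t_j}^{t_{j+1}}R_2^\ell(t_{j+1}-s)\,dW^{\ell,m}(s),$$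 where $W^{\ell,m}(s)=(W(s),Y_{\ell,m})_{L^2}$. The approximation truncated at degree $\kappa\in\mathbb{N}$ is $u_i^\kappa(t)=\sum_{\ell=0}^{\kappa}\sum_{m=-\ell}^{\ell}u_i^{\ell,m}(t)Y_{\ell,m}$, $i=1,2$. Then for every $p\ge1$ there is a constant $\hat C_p$ depending only on $p,C,T,\alpha$ such that the following holds for all $\kappa>\ell_0$, all $t\in[0,T]$ and all time grids. (i) If $\beta\ge0$ and $\gamma\ge-1$, then $$\|u_1(t)-u_1^\kappa(t)\|_{L^p(\Omega;L^2(\mathbb{S}^2))}\le\hat C_p\left(\kappa^{-\alpha/2}+\kappa^{-\beta}\|v_1\|_{H^\beta}+\kappa^{-(\gamma+1)}\|v_2\|_{H^\gamma}\right).$$ (ii) If $\beta\ge1$ and $\gamma\ge0$, then $u_2$ is represented by an $L^2(\mathbb{S}^2)$-valued process (again denoted $u_2$), and $$\|u_2(t)-u_2^\kappa(t)\|_{L^p(\Omega;L^2(\mathbb{S}^2))}\le\hat C_p\left(\kappa^{-(\alpha/2-1)}+\kappa^{-(\beta-1)}\|v_1\|_{H^\beta}+\kappa^{-\gamma}\|v_2\|_{H^\gamma}\right).$$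 Moreover, for every $\delta<\min(\alpha/2,\beta,\gamma+1)$, almost surely there is a (random) $\kappa_0$ such that for all $\kappa\ge\kappa_0$, all $t\in[0,T]$ and all time grids of $[0,t]$, $$\|u_1(t)-u_1^\kappa(t)\|_{L^2(\mathbb{S}^2)}\le\kappa^{-\delta}\quad\text{under the assumptions of (i)},\qquad\|u_2(t)-u_2^\kappa(t)\|_{L^2(\mathbb{S}^2)}\le\kappa^{-(\delta-1)}\quad\text{under the assumptions of (ii)}.$$ -/

import Mathlib

open MeasureTheory ProbabilityTheory Set Filter
open scoped NNReal ENNReal Manifold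

namespace SphereWave

noncomputable section

/-! ### The sphere, its surface measure, spherical coordinates -/

/-- The unit sphere `S²` in Euclidean space `ℝ³`. -/
abbrev S2 : Type := Metric.sphere (0 : EuclideanSpace ℝ (Fin 3)) 1

/-- The point `(sin ϑ cos φ, sin ϑ sin φ, cos ϑ)` of the sphere. -/
def sphPoint (ϑ φ : ℝ) : S2 :=
  ⟨!₂[Real.sin ϑ * Real.cos φ, Real.sin ϑ * Real.sin φ, Real.cos ϑ], by
    rw [mem_sphere_zero_iff_norm, EuclideanSpace.norm_eq, Real.sqrt_eq_one]
    simp [Fin.sum_univ_three]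
    nlinarith [Real.sin_sq_add_cos_sq ϑ, Real.sin_sq_add_cos_sq φ]⟩

lemma continuous_sphPoint : Continuous fun x : ℝ × ℝ => sphPoint x.1 x.2 := by
  unfold sphPoint
  fun_prop

/-- Colatitude of a point of the sphere, in `[0, π]`. -/
def colatitude (y : S2) : ℝ := Real.arccos ((y : EuclideanSpace ℝ (Fin 3)) 2)

/-- Longitude of a point of the sphere, modulo `2π` (representative in `(-π, π]`). -/
def longitude (y : S2) : ℝ :=
  Complex.arg ⟨(y : EuclideanSpace ℝ (Fin 3)) 0, (y : EuclideanSpace ℝ (Fin 3)) 1⟩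

/-- The Lebesgue (surface) measure on the sphere, `dσ = sin ϑ dϑ dφ` on `[0, π] × [0, 2π)`. -/
def sphMeasure : Measure S2 :=
  (((volume : Measure (ℝ × ℝ)).restrict (Icc 0 Real.pi ×ˢ Ico 0 (2 * Real.pi))).withDensity
    fun x => ENNReal.ofReal (Real.sin x.1)).map fun x => sphPoint x.1 x.2

/-- The real Hilbert space `L²(S²)`. -/
abbrev L2 : Type := Lp ℝ 2 sphMeasure

/-- `L²(S²)` carries its Borel σ-algebra. -/
instance instMeasurableSpaceL2 : MeasurableSpace L2 := borel L2

instance instBorelSpaceL2 : BorelSpace L2 := ⟨rfl⟩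

/-- The pairing `∫ f φ dσ`. -/
def pairing (f : L2) (φ : S2 → ℝ) : ℝ := ∫ y, f y * φ y ∂sphMeasure

/-! ### Spherical harmonics -/

/-- Legendre polynomials (Rodrigues' formula). -/
def legendreP (ℓ : ℕ) : Polynomial ℝ :=
  Polynomial.C ((2 ^ ℓ * (ℓ.factorial : ℝ))⁻¹) *
    Polynomial.derivative^[ℓ] ((Polynomial.X ^ 2 - 1) ^ ℓ)

/-- Associated Legendre functions
`P_{ℓ,m}(μ) = (-1)^m (1 - μ²)^{m/2} (d/dμ)^m P_ℓ(μ)` for `μ ∈ [-1, 1]`. -/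
def assocLegendre (ℓ m : ℕ) (μ : ℝ) : ℝ :=
  (-1) ^ m * Real.sqrt (1 - μ ^ 2) ^ m * (Polynomial.derivative^[m] (legendreP ℓ)).eval μ

/-- Spherical harmonics of nonnegative order in angular coordinates (`0 ≤ m ≤ ℓ`). -/
def harmonicAngNat (ℓ m : ℕ) (ϑ φ : ℝ) : ℂ :=
  (Real.sqrt ((2 * ℓ + 1) / (4 * Real.pi) * ((ℓ - m).factorial / (ℓ + m).factorial : ℝ)) *
      assocLegendre ℓ m (Real.cos ϑ) : ℝ) *
    Complex.exp (Complex.I * m * φ)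

/-- Spherical harmonics in angular coordinates for `-ℓ ≤ m ≤ ℓ`;
`Y_{ℓ,m} = (-1)^m conj Y_{ℓ,-m}` for `m < 0`. -/
def harmonicAng (ℓ : ℕ) (m : ℤ) (ϑ φ : ℝ) : ℂ :=
  if 0 ≤ m then harmonicAngNat ℓ m.natAbs ϑ φ
  else (-1) ^ m.natAbs * (starRingEnd ℂ) (harmonicAngNat ℓ m.natAbs ϑ φ)

/-- Spherical harmonics as functions on the sphere. -/
def harmonicY (ℓ : ℕ) (m : ℤ) (y : S2) : ℂ := harmonicAng ℓ m (colatitude y) (longitude y)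

/-- The index range `m = -ℓ, …, ℓ`. -/
def orders (ℓ : ℕ) : Finset ℤ := Finset.Icc (-(ℓ : ℤ)) ℓ

/-- The coefficient `f^{ℓ,m} = (f, Y_{ℓ,m})_{L²}`. -/
def coeff (f : L2) (ℓ : ℕ) (m : ℤ) : ℂ :=
  ∫ y, ((f y : ℝ) : ℂ) * (starRingEnd ℂ) (harmonicY ℓ m y) ∂sphMeasure

/-! ### Sobolev spaces -/

/-- Contribution of degree `ℓ` to `‖(Id - Δ)^{s/2} f‖²`, where `(Id - Δ)^{s/2}` multiplies the
coefficients of degree `ℓ` by `(1 + ℓ(ℓ+1))^{s/2}`. -/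
def sobolevTerm (s : ℝ) (f : L2) (ℓ : ℕ) : ℝ :=
  (1 + (ℓ : ℝ) * (ℓ + 1)) ^ s * ∑ m ∈ orders ℓ, ‖coeff f ℓ m‖ ^ 2

/-- `f ∈ H^s(S²)`, for `f ∈ L²(S²)`. -/
def MemSobolev (s : ℝ) (f : L2) : Prop := Summable (sobolevTerm s f)

/-- The norm of `H^s(S²)`, meaningful when `MemSobolev s f`. -/
def sobolevNorm (s : ℝ) (f : L2) : ℝ := Real.sqrt (∑' ℓ, sobolevTerm s f ℓ)

/-! ### Laplace–Beltrami operator, test functions, generalized functions -/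

/-- Smooth real test functions on the sphere. -/
abbrev SphTestFunction : Type := ContMDiffMap (𝓡 2) 𝓘(ℝ, ℝ) S2 ℝ ((⊤ : ℕ∞) : WithTop ℕ∞)

/-- Laplace–Beltrami operator in spherical coordinates,
`(sin ϑ)⁻¹ ∂_ϑ (sin ϑ ∂_ϑ f) + (sin ϑ)⁻² ∂_φ² f` (the two poles, where the coordinates
degenerate, form a null set). -/
def sphLaplacian (f : S2 → ℝ) (y : S2) : ℝ :=
  (Real.sin (colatitude y))⁻¹ *
      deriv (fun a => Real.sin a * deriv (fun b => f (sphPoint b (longitude y))) a) (colatitude y)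
    + (Real.sin (colatitude y) ^ 2)⁻¹ *
      deriv (deriv fun b => f (sphPoint (colatitude y) b)) (longitude y)

/-- Generalized functions on the sphere: linear functionals on the test functions. -/
abbrev GenFunction : Type := SphTestFunction →ₗ[ℝ] ℝ

/-! ### Isotropic Wiener processes -/

/-- `Q Y_{ℓ,m} = A_ℓ Y_{ℓ,m}` for all `ℓ, m`, tested against arbitrary `f ∈ L²(S²)`: the
covariance operator `Q` is isotropic with angular power spectrum `(A_ℓ)`. -/
def HasAngularPowerSpectrum (Q : L2 →L[ℝ] L2) (A : ℕ → ℝ≥0) : Prop :=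
  ∀ (f : L2) (ℓ : ℕ), ∀ m ∈ orders ℓ, coeff (Q f) ℓ m = ((A ℓ : ℝ) : ℂ) * coeff f ℓ m

/-- `W` is an `L²(S²)`-valued Wiener process on `[0,T]` with covariance operator `Q`: it starts
at `0`, has almost surely continuous paths and independent increments, and `W(t) - W(s)` is
centered Gaussian with covariance `(t - s) Q` for `s ≤ t`. -/
structure IsQWiener {Ω : Type*} [MeasurableSpace Ω] (P : Measure Ω) (T : ℝ)
    (Q : L2 →L[ℝ] L2) (W : ℝ → Ω → L2) : Prop where
  aestronglyMeasurable : ∀ t ∈ Icc 0 T, AEStronglyMeasurable (W t) P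
  zero : ∀ᵐ ω ∂P, W 0 ω = 0
  continuousOn : ∀ᵐ ω ∂P, ContinuousOn (fun t => W t ω) (Icc 0 T)
  indep : HasIndepIncrements (fun t : Icc (0 : ℝ) T => W t) P
  gaussian : ∀ s t : ℝ, 0 ≤ s → s ≤ t → t ≤ T → ∀ f : L2,
    HasLaw (fun ω => inner ℝ (W t ω - W s ω) f)
      (gaussianReal 0 (Real.toNNReal ((t - s) * inner ℝ (Q f) f))) P

/-! ### The stochastic wave equation -/

/-- `(u₁, u₂)` solves, in the sense of distributions on the sphere,
`u₁(t) = v₁ + ∫₀ᵗ u₂(s) ds`, `u₂(t) = v₂ + ∫₀ᵗ Δ u₁(s) ds + W(t)` for `t ∈ [0,T]`.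
The position is `L²(S²)`-valued; the velocity, which in general is less regular than the position,
takes its values in the generalized functions. -/
structure IsSolution {Ω : Type*} [MeasurableSpace Ω] (P : Measure Ω) (T : ℝ)
    (W : ℝ → Ω → L2) (v₁ v₂ : L2) (u₁ : ℝ → Ω → L2) (u₂ : ℝ → Ω → GenFunction) : Prop where
  integrable_velocity : ∀ φ : SphTestFunction, ∀ᵐ ω ∂P,
    IntervalIntegrable (fun s => u₂ s ω φ) volume 0 T
  integrable_laplacian : ∀ φ : SphTestFunction, ∀ᵐ ω ∂P,
    IntervalIntegrable (fun s => pairing (u₁ s ω) (sphLaplacian φ)) volume 0 T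
  position : ∀ φ : SphTestFunction, ∀ᵐ ω ∂P, ∀ t ∈ Icc 0 T,
    pairing (u₁ t ω) φ = pairing v₁ φ + ∫ s in (0 : ℝ)..t, u₂ s ω φ
  velocity : ∀ φ : SphTestFunction, ∀ᵐ ω ∂P, ∀ t ∈ Icc 0 T,
    u₂ t ω φ = pairing v₂ φ + (∫ s in (0 : ℝ)..t, pairing (u₁ s ω) (sphLaplacian φ))
      + pairing (W t ω) φ

/-! ### The spectral scheme -/

/-- The frequency `(ℓ(ℓ+1))^{1/2}`. -/
def freq (ℓ : ℕ) : ℝ := Real.sqrt ((ℓ : ℝ) * (ℓ + 1))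

/-- `(ℓ(ℓ+1))^{-1/2} sin(t (ℓ(ℓ+1))^{1/2})`, read as its limit `t` for `ℓ = 0`. -/
def R1 (ℓ : ℕ) (t : ℝ) : ℝ := if ℓ = 0 then t else (freq ℓ)⁻¹ * Real.sin (t * freq ℓ)

/-- `cos(t (ℓ(ℓ+1))^{1/2})`. -/
def R2 (ℓ : ℕ) (t : ℝ) : ℝ := Real.cos (t * freq ℓ)

/-- The Wiener integral `∫_s^t f(r) da(r)` of a deterministic `C¹` function `f` along a continuous
path `a`, as a Riemann–Stieltjes integral, that is,
`f(t) a(t) - f(s) a(s) - ∫_s^t f'(r) a(r) dr`. -/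
def wienerIntegral (f : ℝ → ℝ) (a : ℝ → ℂ) (s t : ℝ) : ℂ :=
  (f t : ℂ) * a t - (f s : ℂ) * a s - ∫ r in s..t, ((deriv f r : ℝ) : ℂ) * a r

/-- `0 = τ₀ < ⋯ < τₙ = t`. -/
def IsPartition (τ : ℕ → ℝ) (n : ℕ) (t : ℝ) : Prop :=
  τ 0 = 0 ∧ (∀ j < n, τ j < τ (j + 1)) ∧ τ n = t

/-- The recursion in time for the coefficients `(u₁^{ℓ,m}, u₂^{ℓ,m})` along the grid `τ`, started
at `(x₁, x₂)`, with `a` the path of the coefficient of the noise: with `h = τ_{j+1} - τ_j`,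
`u₁ ↦ R₂(h) u₁ + R₁(h) u₂ + ∫ R₁(τ_{j+1} - r) da(r)` and
`u₂ ↦ -ℓ(ℓ+1) R₁(h) u₁ + R₂(h) u₂ + ∫ R₂(τ_{j+1} - r) da(r)`, the stochastic integrals being
over `[τ_j, τ_{j+1}]`. -/
def schemeCoeff (ℓ : ℕ) (a : ℝ → ℂ) (τ : ℕ → ℝ) (x₁ x₂ : ℂ) : ℕ → ℂ × ℂ
  | 0 => (x₁, x₂)
  | j + 1 =>
    let x := schemeCoeff ℓ a τ x₁ x₂ j
    let h := τ (j + 1) - τ j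
    ((R2 ℓ h : ℂ) * x.1 + (R1 ℓ h : ℂ) * x.2
        + wienerIntegral (fun r => R1 ℓ (τ (j + 1) - r)) a (τ j) (τ (j + 1)),
      -((ℓ : ℂ) * (ℓ + 1)) * (R1 ℓ h : ℂ) * x.1 + (R2 ℓ h : ℂ) * x.2
        + wienerIntegral (fun r => R2 ℓ (τ (j + 1) - r)) a (τ j) (τ (j + 1)))

/-- The approximate position `u₁^κ(τ_n)`, truncated at degree `κ`, for the path `w` of the noise. -/
def approxPosition (w : ℝ → L2) (v₁ v₂ : L2) (τ : ℕ → ℝ) (n κ : ℕ) (y : S2) : ℂ :=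
  ∑ ℓ ∈ Finset.range (κ + 1), ∑ m ∈ orders ℓ,
    (schemeCoeff ℓ (fun s => coeff (w s) ℓ m) τ (coeff v₁ ℓ m) (coeff v₂ ℓ m) n).1
      * harmonicY ℓ m y

/-- The approximate velocity `u₂^κ(τ_n)`, truncated at degree `κ`, for the path `w` of the noise. -/
def approxVelocity (w : ℝ → L2) (v₁ v₂ : L2) (τ : ℕ → ℝ) (n κ : ℕ) (y : S2) : ℂ :=
  ∑ ℓ ∈ Finset.range (κ + 1), ∑ m ∈ orders ℓ,
    (schemeCoeff ℓ (fun s => coeff (w s) ℓ m) τ (coeff v₁ ℓ m) (coeff v₂ ℓ m) n).2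
      * harmonicY ℓ m y

/-- `‖U - g‖_{L²(S²)}`. -/
def errorL2 (U : L2) (g : S2 → ℂ) : ℝ≥0∞ :=
  eLpNorm (fun y => ((U y : ℝ) : ℂ) - g y) 2 sphMeasure

end

end SphereWave

/-!
# Spectral approximation of the stochastic wave equation on the sphere

The proof diagonalizes everything in spherical harmonics. Tested against the real and the imaginary
part of `Y_{ℓ,m}`, the weak form of the equation says that the coefficients of `(u₁, u₂)` solve a
linear system of ordinary differential equations with frequency `λ_ℓ = (ℓ(ℓ+1))^{1/2}`, driven by
the coefficient of `W` (`ae_isModeSolution`). Variation of constants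
(`IsModeSolution.fst_eq_of_le`, `IsModeSolution.snd_eq_of_le`) is exactly one step of the scheme, so
the scheme makes no error in time (`IsModeSolution.schemeCoeff_eq`) and, by Parseval's identity, the
squared error of `u_i^κ` is the sum of the squared coefficients of degree larger than `κ`
(`errorL2_sq`).

Variation of constants from time `0` also bounds a mode of degree `ℓ ≥ 1` by
`λ_ℓ^e (|v₁^{ℓ,m}| + λ_ℓ⁻¹ (|v₂^{ℓ,m}| + N))`, with `e = 0` for the position and `e = 1` for the
velocity, where `N` is a sum of absolute values of the integrals `∫₀ᵗ cos(λ_ℓ s) db(s)` and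
`∫₀ᵗ sin(λ_ℓ s) db(s)` over the real and the imaginary part `b` of the noise (`ModeBound`,
`noiseSize`). The contributions of `v₁` and `v₂` to the tail are estimated by their Sobolev norms
(`tsum_tail_modes_le`), those of the noise as follows.

* At a fixed time the integrals are limits of Gaussian Riemann sums and have moments of the order
  `A_ℓ^{1/2}` (`IsBrownianWithVariance.eLpNorm_pathIntegral_le`). Minkowski's inequality for square
  functions and `∑_{ℓ>κ} ℓ^{-1-s} ≤ κ^{-s}/s` give the rate in `L^p(Ω)` (`eLpNorm_errorL2_le`).
* Dyadic chaining bounds the second moment of the maximal functions by a multiple of `A_ℓ T`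
  (`IsBrownianWithVariance.exists_maximal_bound`). For every exponent below `α/2 - e` the weighted
  sum of the squared maximal functions has a finite expectation, hence is finite almost surely.
  This yields the almost sure rate uniformly in time (`ae_eventually_errorL2_le`).

If `β ≥ 1` and `γ ≥ 0`, the same sums show that the maximal functions of the coefficients of `u₂`
are square summable, so that at every time these coefficients define an element of `L²(S²)`. It
represents `u₂`, because both have the position as their primitive and both are continuous in time
when tested against a smooth function (`eq_pairing_of_coeff_eq`).

That the spherical harmonics, given by explicit formulas, are smooth eigenfunctions of the
Laplace–Beltrami operator and form a Hilbert basis of `L²(S²)` rests on the associated Legendre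
equation (`legendreD_ode`) and on the Stone–Weierstrass theorem (`harmonicSpan_topologicalClosure`).
-/

namespace SphereWave

/-! ### Legendre polynomials and their derivatives -/

/-- The `m`-th derivative of the Legendre polynomial of degree `ℓ`. -/
noncomputable def legendreD (ℓ m : ℕ) : Polynomial ℝ := Polynomial.derivative^[m] (legendreP ℓ)

lemma derivative_legendreD (ℓ m : ℕ) :
    Polynomial.derivative (legendreD ℓ m) = legendreD ℓ (m + 1) := by
  simp [legendreD, Function.iterate_succ_apply']

/-- The ODE satisfied by the derivatives of `(X² - 1)^ℓ`, which Rodrigues' formula turns into the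
associated Legendre equation. -/
lemma rodrigues_ode (ℓ k : ℕ) :
    (Polynomial.X ^ 2 - 1) * Polynomial.derivative^[k + 2] ((Polynomial.X ^ 2 - 1 : Polynomial ℝ) ^ ℓ)
      + 2 * ((k : Polynomial ℝ) + 1 - (ℓ : Polynomial ℝ)) * Polynomial.X
        * Polynomial.derivative^[k + 1] ((Polynomial.X ^ 2 - 1 : Polynomial ℝ) ^ ℓ)
      + ((k : Polynomial ℝ) + 1) * ((k : Polynomial ℝ) - 2 * (ℓ : Polynomial ℝ))
        * Polynomial.derivative^[k] ((Polynomial.X ^ 2 - 1 : Polynomial ℝ) ^ ℓ) = 0 := by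
  induction k with
  | zero =>
    have h : (Polynomial.X ^ 2 - 1) * Polynomial.derivative ((Polynomial.X ^ 2 - 1 : Polynomial ℝ) ^ ℓ)
        = 2 * (ℓ : Polynomial ℝ) * Polynomial.X * (Polynomial.X ^ 2 - 1 : Polynomial ℝ) ^ ℓ := by
      rcases ℓ with _ | ℓ
      · simp
      · simp only [Polynomial.derivative_pow, Polynomial.derivative_sub, Polynomial.derivative_X,
          Polynomial.derivative_one]
        simp
        rw [show (Polynomial.C 2 : Polynomial ℝ) = 2 from rfl]
        ring
    have h2 := congrArg Polynomial.derivative h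
    simp only [Polynomial.derivative_mul, Polynomial.derivative_sub, Polynomial.derivative_X_pow,
      Polynomial.derivative_one, Polynomial.derivative_X, Polynomial.derivative_natCast,
      Polynomial.derivative_ofNat] at h2
    simp only [Function.iterate_succ_apply', Function.iterate_zero, id]
    simp at h2 ⊢
    have h3 : (Polynomial.C 2 : Polynomial ℝ) = 2 := rfl
    rw [h3] at h2
    linear_combination h2
  | succ k ih =>
    have h2 := congrArg Polynomial.derivative ih
    simp only [Polynomial.derivative_mul, Polynomial.derivative_add, Polynomial.derivative_sub,
      Polynomial.derivative_X_pow,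
      Polynomial.derivative_one, Polynomial.derivative_X, Polynomial.derivative_natCast,
      Polynomial.derivative_ofNat, ← Function.iterate_succ_apply' (f := ⇑Polynomial.derivative)] at h2
    simp at h2 ⊢
    have h3 : (Polynomial.C 2 : Polynomial ℝ) = 2 := rfl
    rw [h3] at h2
    linear_combination h2

lemma legendreD_eq (ℓ m : ℕ) : legendreD ℓ m = Polynomial.C (2 ^ ℓ * (ℓ.factorial : ℝ))⁻¹ *
      (Polynomial.derivative^[ℓ + m] ((Polynomial.X ^ 2 - 1 : Polynomial ℝ) ^ ℓ)) := by
  rw [legendreD, legendreP, Polynomial.iterate_derivative_C_mul, ← Function.iterate_add_apply,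
      add_comm m ℓ]

/-- The associated Legendre equation, for the derivatives of the Legendre polynomials. -/
lemma legendreD_ode (ℓ m : ℕ) (x : ℝ) :
    (x ^ 2 - 1) * (legendreD ℓ (m + 2)).eval x + 2 * (m + 1) * x * (legendreD ℓ (m + 1)).eval x
      + (ℓ + m + 1) * (m - ℓ) * (legendreD ℓ m).eval x = 0 := by
  have h (j : ℕ) : (legendreD ℓ j).eval x = (2 ^ ℓ * (ℓ.factorial : ℝ))⁻¹ *
      (Polynomial.derivative^[ℓ + j] ((Polynomial.X ^ 2 - 1 : Polynomial ℝ) ^ ℓ)).eval x := by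
    rw [legendreD_eq]
    simp
  have h2 := congrArg (Polynomial.eval x) (rodrigues_ode ℓ (ℓ + m))
  simp [-Function.iterate_succ] at h2
  rw [h, h, h, ← add_assoc, ← add_assoc]
  linear_combination (2 ^ ℓ * (ℓ.factorial : ℝ))⁻¹ * h2

lemma natDegree_rodrigues (ℓ : ℕ) : ((Polynomial.X ^ 2 - 1 : Polynomial ℝ) ^ ℓ).natDegree = 2 * ℓ := by
  rw [Polynomial.natDegree_pow, show (Polynomial.X ^ 2 - 1 : Polynomial ℝ) =
    Polynomial.X ^ 2 - Polynomial.C 1 by simp, Polynomial.natDegree_X_pow_sub_C, mul_comm]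

lemma coeff_rodrigues (ℓ : ℕ) : ((Polynomial.X ^ 2 - 1 : Polynomial ℝ) ^ ℓ).coeff (2 * ℓ) = 1 := by
  have h : ((Polynomial.X ^ 2 - 1 : Polynomial ℝ) ^ ℓ).Monic := by
    apply Polynomial.Monic.pow
    rw [show (Polynomial.X ^ 2 - 1 : Polynomial ℝ) = Polynomial.X ^ 2 - Polynomial.C 1 by simp]
    exact Polynomial.monic_X_pow_sub_C 1 two_ne_zero
  rw [← natDegree_rodrigues]
  exact h

lemma degree_legendreD {ℓ m : ℕ} (h : m ≤ ℓ) : (legendreD ℓ m).degree = (ℓ - m : ℕ) := by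
  rw [legendreD_eq, Polynomial.degree_C_mul (by positivity)]
  apply Polynomial.degree_eq_of_le_of_coeff_ne_zero
  · refine Polynomial.degree_le_of_natDegree_le
      ((Polynomial.natDegree_iterate_derivative _ _).trans ?_)
    rw [natDegree_rodrigues]
    omega
  · rw [Polynomial.coeff_iterate_derivative, show ℓ - m + (ℓ + m) = 2 * ℓ by omega,
      coeff_rodrigues]
    simp [Nat.descFactorial_eq_zero_iff_lt]
    omega

lemma legendreD_self (ℓ : ℕ) (x : ℝ) :
    (legendreD ℓ ℓ).eval x = (2 ^ ℓ * (ℓ.factorial : ℝ))⁻¹ * (2 * ℓ).factorial := by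
  have h := degree_legendreD (le_refl ℓ)
  simp only [tsub_self, Nat.cast_zero] at h
  rw [Polynomial.eq_C_of_degree_eq_zero h, Polynomial.eval_C, legendreD_eq, Polynomial.coeff_C_mul,
    Polynomial.coeff_iterate_derivative, zero_add, ← two_mul, coeff_rodrigues,
    Nat.descFactorial_self]
  simp

/-! ### Spherical harmonics in Cartesian form -/

/-- The horizontal coordinates of a point of the sphere, as a complex number. -/
def horiz (y : S2) : ℂ :=
  ⟨(y : EuclideanSpace ℝ (Fin 3)) 0, (y : EuclideanSpace ℝ (Fin 3)) 1⟩

/-- The vertical coordinate of a point of the sphere. -/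
def height (y : S2) : ℝ := (y : EuclideanSpace ℝ (Fin 3)) 2

/-- The solid angular factor of order `m`: `(y₀ + i y₁)^m` for `m ≥ 0`, and `(y₀ - i y₁)^{-m}` for
`m < 0`. -/
noncomputable def angular (m : ℤ) (y : S2) : ℂ :=
  if 0 ≤ m then horiz y ^ m.natAbs else (starRingEnd ℂ) (horiz y) ^ m.natAbs

/-- The real factor, sign included, that multiplies `P_ℓ^{(|m|)}(y₂) · angular m y`
in `Y_{ℓ,m}(y)`. -/
noncomputable def normConst (ℓ : ℕ) (m : ℤ) : ℝ :=
  (if 0 ≤ m then (-1) ^ m.natAbs else 1) *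
    Real.sqrt ((2 * ℓ + 1) / (4 * Real.pi) *
      ((ℓ - m.natAbs).factorial / (ℓ + m.natAbs).factorial : ℝ))

lemma height_mem (y : S2) : height y ∈ Icc (-1 : ℝ) 1 := by
  have h : ‖(y : EuclideanSpace ℝ (Fin 3))‖ = 1 := by simp
  have := PiLp.norm_apply_le (y : EuclideanSpace ℝ (Fin 3)) 2
  rw [h, Real.norm_eq_abs, abs_le] at this
  exact this

lemma normSq_horiz (y : S2) : Complex.normSq (horiz y) = 1 - height y ^ 2 := by
  have h : ‖(y : EuclideanSpace ℝ (Fin 3))‖ = 1 := by simp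
  rw [EuclideanSpace.norm_eq, Real.sqrt_eq_one] at h
  simp [Fin.sum_univ_three] at h
  simp [Complex.normSq_apply, horiz, height]
  linarith

lemma norm_horiz (y : S2) : ‖horiz y‖ = Real.sqrt (1 - height y ^ 2) := by
  rw [← normSq_horiz, Complex.normSq_eq_norm_sq, Real.sqrt_sq (norm_nonneg _)]

lemma cos_colatitude (y : S2) : Real.cos (colatitude y) = height y :=
  Real.cos_arccos (height_mem y).1 (height_mem y).2

lemma sin_colatitude (y : S2) : Real.sin (colatitude y) = Real.sqrt (1 - height y ^ 2) :=
  Real.sin_arccos _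

lemma sphPoint_colatitude_longitude (y : S2) : sphPoint (colatitude y) (longitude y) = y := by
  have h : ((Real.sin (colatitude y) * Real.cos (longitude y) : ℝ) : ℂ)
      + ((Real.sin (colatitude y) * Real.sin (longitude y) : ℝ) : ℂ) * Complex.I = horiz y := by
    have h1 := Complex.norm_mul_exp_arg_mul_I (horiz y)
    rw [Complex.exp_mul_I, norm_horiz, ← sin_colatitude] at h1
    rw [← h1]
    push_cast
    simp only [longitude, horiz]
    ring
  apply Subtype.ext
  ext i
  fin_cases i
  · have := congrArg Complex.re h
    simpa [horiz, sphPoint, -Complex.ofReal_sin, -Complex.ofReal_cos] using this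
  · have := congrArg Complex.im h
    simpa [horiz, sphPoint, -Complex.ofReal_sin, -Complex.ofReal_cos] using this
  · simpa [sphPoint, height] using cos_colatitude y

lemma height_sphPoint (ϑ φ : ℝ) : height (sphPoint ϑ φ) = Real.cos ϑ := by
  simp [height, sphPoint]

lemma horiz_sphPoint (ϑ φ : ℝ) :
    horiz (sphPoint ϑ φ) = Real.sin ϑ * Complex.exp (φ * Complex.I) := by
  rw [Complex.exp_mul_I]
  apply Complex.ext <;> simp [horiz, sphPoint, ← Complex.ofReal_sin, ← Complex.ofReal_cos]

lemma angular_sphPoint (m : ℤ) (ϑ φ : ℝ) :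
    angular m (sphPoint ϑ φ)
      = ((Real.sin ϑ ^ m.natAbs : ℝ) : ℂ) * Complex.exp (((m * φ : ℝ) : ℂ) * Complex.I) := by
  unfold angular
  split_ifs with h
  · rw [horiz_sphPoint, mul_pow, ← Complex.exp_nat_mul]
    have : ((m.natAbs : ℕ) : ℂ) = (m : ℂ) := by
      rw [Nat.cast_natAbs, abs_of_nonneg h]
    rw [this]
    push_cast
    ring_nf
  · rw [horiz_sphPoint, map_mul, ← Complex.exp_conj, mul_pow, ← Complex.exp_nat_mul]
    have : ((m.natAbs : ℕ) : ℂ) = -(m : ℂ) := by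
      rw [Nat.cast_natAbs, abs_of_neg (by omega)]
      push_cast
      ring
    rw [this]
    simp [-Complex.ofReal_sin, mul_assoc]

lemma harmonicAngNat_eq (ℓ m : ℕ) (y : S2) :
    harmonicAngNat ℓ m (colatitude y) (longitude y)
      = (((-1) ^ m * Real.sqrt ((2 * ℓ + 1) / (4 * Real.pi) *
        ((ℓ - m).factorial / (ℓ + m).factorial : ℝ)) * (legendreD ℓ m).eval (height y) : ℝ) : ℂ)
        * horiz y ^ m := by
  have h1 := Complex.norm_mul_exp_arg_mul_I (horiz y)
  rw [norm_horiz] at h1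
  rw [harmonicAngNat, assocLegendre, cos_colatitude]
  conv_rhs => rw [← h1]
  rw [mul_pow, ← Complex.exp_nat_mul]
  simp only [longitude, horiz, legendreD]
  push_cast
  ring_nf

/-- The Cartesian form of the spherical harmonics. -/
lemma harmonicY_eq (ℓ : ℕ) (m : ℤ) (y : S2) :
    harmonicY ℓ m y
      = ((normConst ℓ m * (legendreD ℓ m.natAbs).eval (height y) : ℝ) : ℂ) * angular m y := by
  unfold harmonicY harmonicAng normConst angular
  split_ifs with h
  · rw [harmonicAngNat_eq]
  · rw [harmonicAngNat_eq, map_mul, Complex.conj_ofReal, map_pow, ← mul_assoc]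
    congr 1
    push_cast
    rw [← mul_assoc, ← mul_assoc, ← mul_pow]
    simp

lemma harmonicY_neg (ℓ : ℕ) (m : ℤ) (y : S2) :
    harmonicY ℓ (-m) y = (-1) ^ m.natAbs * (starRingEnd ℂ) (harmonicY ℓ m y) := by
  rcases lt_trichotomy m 0 with h | h | h
  · rw [harmonicY, harmonicY, harmonicAng, harmonicAng, if_pos (by omega), if_neg (by omega)]
    simp [← mul_assoc, ← mul_pow]
  · subst h
    simp [harmonicY_eq, normConst, angular]
  · rw [harmonicY, harmonicY, harmonicAng, harmonicAng, if_neg (by omega), if_pos (by omega)]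
    simp

lemma continuous_horiz : Continuous horiz := by
  have : horiz = fun y : S2 => ((y : EuclideanSpace ℝ (Fin 3)) 0 : ℂ)
      + ((y : EuclideanSpace ℝ (Fin 3)) 1 : ℂ) * Complex.I := by
    funext y
    apply Complex.ext <;> simp [horiz]
  rw [this]
  fun_prop

lemma continuous_height : Continuous height := by unfold height; fun_prop

lemma continuous_angular (m : ℤ) : Continuous (angular m) := by
  unfold angular
  split_ifs
  · exact continuous_horiz.pow _
  · exact (Complex.continuous_conj.comp continuous_horiz).pow _

lemma continuous_harmonicY (ℓ : ℕ) (m : ℤ) : Continuous (harmonicY ℓ m) := by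
  rw [funext (harmonicY_eq ℓ m)]
  exact (Complex.continuous_ofReal.comp (continuous_const.mul
    ((legendreD ℓ m.natAbs).continuous.comp continuous_height))).mul (continuous_angular m)

/-! ### Spherical harmonics as smooth eigenfunctions of the Laplace–Beltrami operator -/

/-- `Re (a Y_{ℓ,m})` as a test function; `a = 1` gives the real part of the harmonic and
`a = -i` its imaginary part. -/
noncomputable def harmonicTest (ℓ : ℕ) (m : ℤ) (a : ℂ) : SphTestFunction :=
  ⟨fun y => (a * harmonicY ℓ m y).re, by
    -- the harmonic is the restriction of a polynomial in the ambient coordinates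
    let F : EuclideanSpace ℝ (Fin 3) → ℝ := fun x =>
      (a * (((normConst ℓ m * (legendreD ℓ m.natAbs).eval (x 2) : ℝ) : ℂ) *
        (((x 0 : ℝ) : ℂ) + (if 0 ≤ m then 1 else -1) * ((x 1 : ℝ) : ℂ) * Complex.I) ^ m.natAbs)).re
    have hF : ContDiff ℝ ((⊤ : ℕ∞) : WithTop ℕ∞) F := by
      have hc (i : Fin 3) : ContDiff ℝ ((⊤ : ℕ∞) : WithTop ℕ∞)
          (fun x : EuclideanSpace ℝ (Fin 3) => x i) :=
        (EuclideanSpace.proj (𝕜 := ℝ) i).contDiff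
      have hr : ContDiff ℝ ((⊤ : ℕ∞) : WithTop ℕ∞) (fun x : ℝ => (x : ℂ)) :=
        Complex.ofRealCLM.contDiff
      have hp : ContDiff ℝ ((⊤ : ℕ∞) : WithTop ℕ∞)
          (fun x : ℝ => (legendreD ℓ m.natAbs).eval x) := by
        simpa [Polynomial.aeval_def] using
          (legendreD ℓ m.natAbs).contDiff_aeval (𝕜 := ℝ) ((⊤ : ℕ∞) : WithTop ℕ∞)
      refine Complex.reCLM.contDiff.comp (contDiff_const.mul ((hr.comp (contDiff_const.mul
        (hp.comp (hc 2)))).mul (ContDiff.pow ?_ _)))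
      exact (hr.comp (hc 0)).add ((contDiff_const.mul (hr.comp (hc 1))).mul contDiff_const)
    have h : (fun y : S2 => (a * harmonicY ℓ m y).re) = F ∘ Subtype.val := by
      funext y
      simp only [F, Function.comp, harmonicY_eq, angular]
      have hz : horiz y = ((y : EuclideanSpace ℝ (Fin 3)) 0 : ℂ)
          + ((y : EuclideanSpace ℝ (Fin 3)) 1 : ℂ) * Complex.I := by
        apply Complex.ext <;> simp [horiz]
      split_ifs <;> simp [hz, height]
    rw [h]
    have := Fact.mk (@finrank_euclideanSpace_fin ℝ _ 3)
    exact hF.contMDiff.comp (contMDiff_coe_sphere (n := 2))⟩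

lemma harmonicTest_apply (ℓ : ℕ) (m : ℤ) (a : ℂ) (y : S2) :
    harmonicTest ℓ m a y = (a * harmonicY ℓ m y).re := rfl

lemma hasDerivAt_legendreD_cos (ℓ k : ℕ) (b : ℝ) :
    HasDerivAt (fun b => (legendreD ℓ k).eval (Real.cos b))
      (-(Real.sin b * (legendreD ℓ (k + 1)).eval (Real.cos b))) b := by
  have h := ((legendreD ℓ k).hasDerivAt (Real.cos b)).comp b (Real.hasDerivAt_cos b)
  rw [derivative_legendreD] at h
  exact h.congr_deriv (by ring)

/-- In spherical coordinates `P_ℓ^{(k)}(cos ϑ) sin^k ϑ` solves the polar part of the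
eigenvalue equation. -/
lemma polar_ode (ℓ k : ℕ) (b : ℝ) (hb : Real.sin b ≠ 0) :
    (Real.sin b)⁻¹ * deriv (fun a => Real.sin a *
        deriv (fun b => (legendreD ℓ k).eval (Real.cos b) * Real.sin b ^ k) a) b
      - (Real.sin b ^ 2)⁻¹ * k ^ 2 * ((legendreD ℓ k).eval (Real.cos b) * Real.sin b ^ k)
    = -(ℓ * (ℓ + 1)) * ((legendreD ℓ k).eval (Real.cos b) * Real.sin b ^ k) := by
  have h1 (a : ℝ) : Real.sin a *
        deriv (fun b => (legendreD ℓ k).eval (Real.cos b) * Real.sin b ^ k) a =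
      -((legendreD ℓ (k + 1)).eval (Real.cos a) * Real.sin a ^ (k + 2))
        + k * ((legendreD ℓ k).eval (Real.cos a) * Real.sin a ^ k * Real.cos a) := by
    have hd := (hasDerivAt_legendreD_cos ℓ k a).mul ((Real.hasDerivAt_sin a).pow k)
    rw [show deriv (fun b => (legendreD ℓ k).eval (Real.cos b) * Real.sin b ^ k) a = _ from
      hd.deriv]
    rcases k with _ | k
    · simp
      ring
    · simp
      ring
  have h2 : deriv (fun a => Real.sin a *
        deriv (fun b => (legendreD ℓ k).eval (Real.cos b) * Real.sin b ^ k) a) b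
      = Real.sin b * Real.sin b ^ k * ((legendreD ℓ (k + 2)).eval (Real.cos b) * Real.sin b ^ 2
        - 2 * (k + 1) * Real.cos b * (legendreD ℓ (k + 1)).eval (Real.cos b)
        - k * (legendreD ℓ k).eval (Real.cos b))
        + k ^ 2 * (Real.sin b)⁻¹ * Real.sin b ^ k * (Real.cos b) ^ 2
          * (legendreD ℓ k).eval (Real.cos b) := by
    rw [funext h1]
    have := (((hasDerivAt_legendreD_cos ℓ (k + 1) b).mul ((Real.hasDerivAt_sin b).pow (k + 2))).neg
      ).add ((((hasDerivAt_legendreD_cos ℓ k b).mul ((Real.hasDerivAt_sin b).pow k)).mul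
        (Real.hasDerivAt_cos b)).const_mul (k : ℝ))
    refine (this.congr_deriv ?_).deriv
    rcases k with _ | k
    · simp
      ring
    · simp
      field_simp
      ring
  rw [h2]
  have h3 := legendreD_ode ℓ k (Real.cos b)
  have h4 : Real.cos b ^ 2 = 1 - Real.sin b ^ 2 := by linarith [Real.sin_sq_add_cos_sq b]
  rw [h4] at h3 ⊢
  field_simp
  linear_combination (-(Real.sin b) ^ 2) * h3

/-- The azimuthal part of the eigenvalue equation. -/
lemma deriv_deriv_circular (a : ℂ) (m : ℤ) (x : ℝ) :
    deriv (deriv fun x : ℝ => (a * Complex.exp (((m * x : ℝ) : ℂ) * Complex.I)).re) x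
      = -(m : ℝ) ^ 2 * (a * Complex.exp (((m * x : ℝ) : ℂ) * Complex.I)).re := by
  have h (a : ℂ) (x : ℝ) : HasDerivAt
      (fun x : ℝ => (a * Complex.exp (((m * x : ℝ) : ℂ) * Complex.I)).re)
      ((a * m * Complex.I) * Complex.exp (((m * x : ℝ) : ℂ) * Complex.I)).re x := by
    have h1 : HasDerivAt (fun x : ℝ => ((m * x : ℝ) : ℂ) * Complex.I) (m * Complex.I) x := by
      have := (((hasDerivAt_id x).const_mul (m : ℝ)).ofReal_comp).mul_const Complex.I
      simpa using this
    have h2 := (h1.cexp.const_mul a)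
    have h3 := (Complex.reCLM.hasFDerivAt.comp_hasDerivAt x h2)
    refine h3.congr_deriv ?_
    simp only [Complex.reCLM_apply]
    ring_nf
  rw [funext fun x => (h a x).deriv, (h _ x).deriv]
  have : a * m * Complex.I * m * Complex.I = ((-(m : ℝ) ^ 2 : ℝ) : ℂ) * a := by
    push_cast
    linear_combination a * m ^ 2 * Complex.I_sq
  rw [this, mul_assoc, Complex.re_ofReal_mul]

/-- Away from the poles, spherical harmonics are eigenfunctions of the Laplace–Beltrami operator
written in spherical coordinates. -/
lemma sphLaplacian_harmonicTest (ℓ : ℕ) (m : ℤ) (a : ℂ) (y : S2)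
    (hy : Real.sin (colatitude y) ≠ 0) :
    sphLaplacian (harmonicTest ℓ m a) y = -(ℓ * (ℓ + 1)) * harmonicTest ℓ m a y := by
  have h (b φ : ℝ) : harmonicTest ℓ m a (sphPoint b φ) =
      normConst ℓ m * ((legendreD ℓ m.natAbs).eval (Real.cos b) * Real.sin b ^ m.natAbs)
        * (a * Complex.exp (((m * φ : ℝ) : ℂ) * Complex.I)).re := by
    rw [harmonicTest_apply, harmonicY_eq, angular_sphPoint, height_sphPoint,
      ← Complex.re_ofReal_mul]
    congr 1
    push_cast
    ring
  have hy' : harmonicTest ℓ m a y = harmonicTest ℓ m a (sphPoint (colatitude y) (longitude y)) := by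
    rw [sphPoint_colatitude_longitude]
  have hm : ((m.natAbs : ℕ) : ℝ) ^ 2 = (m : ℝ) ^ 2 := by
    rw [Nat.cast_natAbs, Int.cast_abs, sq_abs]
  have hp := polar_ode ℓ m.natAbs (colatitude y) hy
  rw [hm] at hp
  set g := (a * Complex.exp (((m * longitude y : ℝ) : ℂ) * Complex.I)).re with hg
  have e1 : (fun a' => Real.sin a' *
      deriv (fun b => harmonicTest ℓ m a (sphPoint b (longitude y))) a')
      = fun a' => (normConst ℓ m * g) * (Real.sin a' *
        deriv (fun b => (legendreD ℓ m.natAbs).eval (Real.cos b) * Real.sin b ^ m.natAbs) a') := by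
    funext a'
    have : (fun b => harmonicTest ℓ m a (sphPoint b (longitude y))) = fun b => (normConst ℓ m * g)
        * ((legendreD ℓ m.natAbs).eval (Real.cos b) * Real.sin b ^ m.natAbs) := by
      funext b
      rw [h]
      ring
    rw [this, deriv_const_mul_field]
    ring
  have e2 : deriv (deriv fun b => harmonicTest ℓ m a (sphPoint (colatitude y) b)) (longitude y)
      = normConst ℓ m * ((legendreD ℓ m.natAbs).eval (Real.cos (colatitude y))
        * Real.sin (colatitude y) ^ m.natAbs) * (-(m : ℝ) ^ 2 * g) := by
    rw [hg, ← deriv_deriv_circular]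
    rw [funext fun b => h (colatitude y) b]
    rw [show deriv (fun b : ℝ => normConst ℓ m * ((legendreD ℓ m.natAbs).eval
      (Real.cos (colatitude y)) * Real.sin (colatitude y) ^ m.natAbs)
      * (a * Complex.exp (((m * b : ℝ) : ℂ) * Complex.I)).re) = fun x => _ from
      funext fun x => deriv_const_mul_field _, deriv_const_mul_field]
  rw [sphLaplacian, e1, deriv_const_mul_field, e2, hy', h, ← hg]
  linear_combination (normConst ℓ m * g) * hp

/-! ### Integration over the sphere -/

lemma measurable_sphPoint : Measurable fun x : ℝ × ℝ => sphPoint x.1 x.2 :=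
  continuous_sphPoint.measurable

lemma measurable_sinDensity : Measurable fun x : ℝ × ℝ => ENNReal.ofReal (Real.sin x.1) := by
  fun_prop

instance instIsFiniteMeasureSphMeasure : IsFiniteMeasure sphMeasure := by
  constructor
  rw [sphMeasure, Measure.map_apply measurable_sphPoint MeasurableSet.univ, preimage_univ,
    withDensity_apply _ MeasurableSet.univ, Measure.restrict_univ]
  calc ∫⁻ x in Icc 0 Real.pi ×ˢ Ico 0 (2 * Real.pi), ENNReal.ofReal (Real.sin x.1)
      ≤ ∫⁻ x in Icc 0 Real.pi ×ˢ Ico 0 (2 * Real.pi), 1 :=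
        lintegral_mono fun x => by
          rw [← ENNReal.ofReal_one]
          exact ENNReal.ofReal_le_ofReal (Real.sin_le_one _)
    _ < ∞ := by
        rw [setLIntegral_const, one_mul, Measure.volume_eq_prod, Measure.prod_prod]
        exact ENNReal.mul_lt_top measure_Icc_lt_top measure_Ico_lt_top

/-- The poles form a null set. -/
lemma ae_sin_colatitude_ne_zero : ∀ᵐ y ∂sphMeasure, Real.sin (colatitude y) ≠ 0 := by
  have hm : MeasurableSet {y : S2 | Real.sin (colatitude y) ≠ 0} := by
    have : Measurable fun y : S2 => Real.sin (colatitude y) := by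
      rw [funext sin_colatitude]
      exact ((continuous_const.sub (continuous_height.pow 2)).sqrt).measurable
    exact this (measurableSet_singleton 0).compl
  rw [sphMeasure, ae_map_iff measurable_sphPoint.aemeasurable hm,
    ae_withDensity_iff measurable_sinDensity]
  refine Eventually.of_forall fun x hx => ?_
  have hx : 0 < Real.sin x.1 := by simpa using hx
  rw [sin_colatitude, height_sphPoint, ← Real.sin_sq, Real.sqrt_sq hx.le]
  exact hx.ne'

lemma integral_sphMeasure {F : S2 → ℂ} (hF : Continuous F) :
    ∫ y, F y ∂sphMeasure = ∫ x in Icc 0 Real.pi ×ˢ Ico 0 (2 * Real.pi),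
      ((Real.sin x.1 : ℝ) : ℂ) * F (sphPoint x.1 x.2) := by
  rw [sphMeasure, integral_map measurable_sphPoint.aemeasurable hF.aestronglyMeasurable,
    integral_withDensity_eq_integral_toReal_smul measurable_sinDensity (by simp)]
  refine setIntegral_congr_fun (measurableSet_Icc.prod measurableSet_Ico) fun x hx => ?_
  have : 0 ≤ Real.sin x.1 := Real.sin_nonneg_of_nonneg_of_le_pi hx.1.1 hx.1.2
  simp only [ENNReal.toReal_ofReal this, Complex.real_smul]

/-- Integration of functions that factorize in spherical coordinates. -/
lemma integral_sphMeasure_of_mul {F : S2 → ℂ} (hF : Continuous F) (f g : ℝ → ℂ)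
    (h : ∀ ϑ φ, F (sphPoint ϑ φ) = f ϑ * g φ) :
    ∫ y, F y ∂sphMeasure = (∫ ϑ in (0 : ℝ)..Real.pi, ((Real.sin ϑ : ℝ) : ℂ) * f ϑ)
      * ∫ φ in (0 : ℝ)..(2 * Real.pi), g φ := by
  rw [integral_sphMeasure hF, intervalIntegral.integral_of_le Real.pi_pos.le,
    intervalIntegral.integral_of_le Real.two_pi_pos.le, ← integral_Icc_eq_integral_Ioc,
    ← integral_Ico_eq_integral_Ioc, ← setIntegral_prod_mul, ← Measure.volume_eq_prod]
  refine setIntegral_congr_fun (measurableSet_Icc.prod measurableSet_Ico) fun x _ => ?_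
  simp only [h]
  ring

/-! ### Orthonormality of the spherical harmonics -/

/-- `∫_{-1}^1 (1 - x²)^m P_ℓ^{(m)} P_k^{(m)} dx`, in the variable `x = cos ϑ`. -/
noncomputable def polarIntegral (ℓ k m : ℕ) : ℝ :=
  ∫ ϑ in (0 : ℝ)..Real.pi, Real.sin ϑ ^ (2 * m + 1)
    * ((legendreD ℓ m).eval (Real.cos ϑ) * (legendreD k m).eval (Real.cos ϑ))

lemma continuous_legendreD_cos (ℓ m : ℕ) :
    Continuous fun ϑ => (legendreD ℓ m).eval (Real.cos ϑ) :=
  (legendreD ℓ m).continuous.comp Real.continuous_cos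

/-- Integration by parts against the associated Legendre equation in Sturm–Liouville form. -/
lemma polarIntegral_succ (ℓ k m : ℕ) :
    polarIntegral ℓ k (m + 1) = (ℓ - m) * (ℓ + m + 1) * polarIntegral ℓ k m := by
  have hd (b : ℝ) : HasDerivAt (fun b => Real.sin b ^ (2 * m + 2) *
      (legendreD ℓ (m + 1)).eval (Real.cos b) * (legendreD k m).eval (Real.cos b))
      ((ℓ - m) * (ℓ + m + 1) * (Real.sin b ^ (2 * m + 1)
        * ((legendreD ℓ m).eval (Real.cos b) * (legendreD k m).eval (Real.cos b)))
        - Real.sin b ^ (2 * (m + 1) + 1)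
        * ((legendreD ℓ (m + 1)).eval (Real.cos b) * (legendreD k (m + 1)).eval (Real.cos b))) b := by
    refine ((((Real.hasDerivAt_sin b).pow (2 * m + 2)).mul
      (hasDerivAt_legendreD_cos ℓ (m + 1) b)).mul (hasDerivAt_legendreD_cos k m b)).congr_deriv ?_
    have h3 := legendreD_ode ℓ m (Real.cos b)
    have h4 : Real.cos b ^ 2 = 1 - Real.sin b ^ 2 := by linarith [Real.sin_sq_add_cos_sq b]
    rw [h4] at h3
    simp
    linear_combination (Real.sin b ^ (2 * m + 1) * (legendreD k m).eval (Real.cos b)) * h3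
  have hc (j : ℕ) : Continuous fun b => Real.sin b ^ (2 * j + 1)
        * ((legendreD ℓ j).eval (Real.cos b) * (legendreD k j).eval (Real.cos b)) :=
    (Real.continuous_sin.pow _).mul ((continuous_legendreD_cos ℓ j).mul (continuous_legendreD_cos k j))
  have hi (j : ℕ) := (hc j).intervalIntegrable (μ := volume) 0 Real.pi
  have h := intervalIntegral.integral_eq_sub_of_hasDerivAt (a := 0) (b := Real.pi)
    (fun b _ => hd b) (((hi m).const_mul _).sub (hi (m + 1)))
  rw [intervalIntegral.integral_sub ((hi m).const_mul _) (hi (m + 1)),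
    intervalIntegral.integral_const_mul] at h
  simp at h
  unfold polarIntegral
  linarith

lemma polarIntegral_comm (ℓ k m : ℕ) : polarIntegral ℓ k m = polarIntegral k ℓ m := by
  simp only [polarIntegral, mul_comm]

/-- The recursion of `polarIntegral_succ` has a factor that depends on the first degree only, whereas
the integral is symmetric in the two degrees. -/
lemma polarIntegral_of_ne {ℓ k : ℕ} (h : ℓ ≠ k) (m : ℕ) : polarIntegral ℓ k m = 0 := by
  have h1 := polarIntegral_succ ℓ k m
  have h2 := polarIntegral_succ k ℓ m
  rw [polarIntegral_comm k ℓ, polarIntegral_comm k ℓ] at h2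
  have h3 : ((ℓ : ℝ) - k) * (ℓ + k + 1) * polarIntegral ℓ k m = 0 := by linear_combination h2 - h1
  rcases mul_eq_zero.mp h3 with h4 | h4
  · exfalso
    rcases mul_eq_zero.mp h4 with h5 | h5
    · exact h (by exact_mod_cast sub_eq_zero.mp h5)
    · exact absurd h5 (by positivity)
  · exact h4

/-- The Wallis product, which occurs in `∫₀^π sin^{2n+1}`, in terms of factorials. -/
lemma prod_wallis (n : ℕ) : (∏ i ∈ Finset.range n, (2 * (i : ℝ) + 2) / (2 * i + 3))
    * (2 * n).factorial * (2 * n + 1) = (2 ^ n * (n.factorial : ℝ)) ^ 2 := by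
  induction n with
  | zero => simp
  | succ n ih =>
    rw [Finset.prod_range_succ, show 2 * (n + 1) = 2 * n + 1 + 1 by ring, Nat.factorial_succ,
      Nat.factorial_succ, Nat.factorial_succ]
    push_cast
    have : (2 * (n : ℝ) + 3) ≠ 0 := by positivity
    generalize ∏ i ∈ Finset.range n, (2 * (i : ℝ) + 2) / (2 * i + 3) = p at *
    have h2 : p * ((2 * n + 2) / (2 * n + 3)) * ((2 * (n : ℝ) + 1 + 1) *
        ((2 * n + 1) * (2 * n).factorial)) * (2 * (n + 1) + 1)
        = (2 * n + 2) ^ 2 * (p * (2 * n).factorial * (2 * n + 1)) := by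
      field_simp
      ring
    rw [h2, ih]
    ring

/-- The normalization of the associated Legendre functions, by descending recursion from the order
`m = ℓ`, at which the derivative of the Legendre polynomial is constant. -/
lemma polarIntegral_self {ℓ m : ℕ} (h : m ≤ ℓ) :
    polarIntegral ℓ ℓ m * ((2 * ℓ + 1) * (ℓ - m).factorial) = 2 * (ℓ + m).factorial := by
  obtain ⟨k, rfl⟩ := Nat.exists_eq_add_of_le h
  rw [Nat.add_sub_cancel_left]
  induction k generalizing m with
  | zero =>
    simp only [add_zero, polarIntegral, legendreD_self, intervalIntegral.integral_mul_const,
      integral_sin_pow_odd, Nat.factorial_zero]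
    have := prod_wallis m
    rw [← two_mul]
    generalize ∏ i ∈ Finset.range m, (2 * (i : ℝ) + 2) / (2 * i + 3) = p at *
    have h2 : (2 ^ m * (m.factorial : ℝ)) ≠ 0 := by positivity
    generalize 2 ^ m * (m.factorial : ℝ) = q at *
    field_simp
    push_cast
    linear_combination this
  | succ k ih =>
    have h1 := ih (m := m + 1) (by omega)
    rw [show m + 1 + k = m + (k + 1) by ring, polarIntegral_succ,
      show m + (k + 1) + (m + 1) = m + (k + 1) + m + 1 by ring, Nat.factorial_succ] at h1
    rw [Nat.factorial_succ]
    push_cast at h1 ⊢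
    have h2 : ((m : ℝ) + (k + 1) + m + 1) ≠ 0 := by positivity
    apply mul_left_cancel₀ h2
    linear_combination h1

lemma integral_exp_int (k : ℤ) :
    ∫ φ in (0 : ℝ)..(2 * Real.pi), Complex.exp (((k * φ : ℝ) : ℂ) * Complex.I)
      = if k = 0 then ((2 * Real.pi : ℝ) : ℂ) else 0 := by
  split_ifs with h
  · simp [h]
  · have h0 : (k : ℂ) * Complex.I ≠ 0 := by simp [h]
    have := integral_exp_mul_complex (a := 0) (b := 2 * Real.pi) h0
    rw [show (fun φ : ℝ => Complex.exp (((k * φ : ℝ) : ℂ) * Complex.I)) =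
      fun φ : ℝ => Complex.exp ((k : ℂ) * Complex.I * φ) by
        funext φ; push_cast; ring_nf, this]
    have h1 : Complex.exp ((k : ℂ) * Complex.I * ((2 * Real.pi : ℝ) : ℂ)) = 1 := by
      rw [Complex.exp_eq_one_iff]
      exact ⟨k, by push_cast; ring⟩
    rw [h1]
    simp

lemma harmonicY_sphPoint (ℓ : ℕ) (m : ℤ) (ϑ φ : ℝ) :
    harmonicY ℓ m (sphPoint ϑ φ) = ((normConst ℓ m * ((legendreD ℓ m.natAbs).eval (Real.cos ϑ)
      * Real.sin ϑ ^ m.natAbs) : ℝ) : ℂ) * Complex.exp (((m * φ : ℝ) : ℂ) * Complex.I) := by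
  rw [harmonicY_eq, angular_sphPoint, height_sphPoint]
  push_cast
  ring

lemma normConst_sq (ℓ : ℕ) (m : ℤ) : normConst ℓ m ^ 2 = (2 * ℓ + 1) / (4 * Real.pi) *
      ((ℓ - m.natAbs).factorial / (ℓ + m.natAbs).factorial : ℝ) := by
  rw [normConst, mul_pow, Real.sq_sqrt (by positivity)]
  split_ifs <;> simp [← pow_mul, mul_comm _ 2]

lemma natAbs_le_of_mem_orders {ℓ : ℕ} {m : ℤ} (h : m ∈ orders ℓ) : m.natAbs ≤ ℓ := by
  rw [orders, Finset.mem_Icc] at h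
  omega

/-- Orthonormality of the spherical harmonics. -/
lemma integral_conj_harmonicY_mul (ℓ k : ℕ) (m j : ℤ) (hm : m ∈ orders ℓ) :
    ∫ y, (starRingEnd ℂ) (harmonicY ℓ m y) * harmonicY k j y ∂sphMeasure
      = if ℓ = k ∧ m = j then 1 else 0 := by
  rw [integral_sphMeasure_of_mul (F := fun y =>
      (starRingEnd ℂ) (harmonicY ℓ m y) * harmonicY k j y)
    ((Complex.continuous_conj.comp (continuous_harmonicY ℓ m)).mul (continuous_harmonicY k j))
    (fun ϑ => ((normConst ℓ m * normConst k j * ((legendreD ℓ m.natAbs).eval (Real.cos ϑ)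
      * Real.sin ϑ ^ m.natAbs * ((legendreD k j.natAbs).eval (Real.cos ϑ)
      * Real.sin ϑ ^ j.natAbs)) : ℝ) : ℂ))
    (fun φ => Complex.exp ((((j - m : ℤ) * φ : ℝ) : ℂ) * Complex.I)), integral_exp_int]
  · by_cases hjm : j - m = 0
    · obtain rfl : j = m := by omega
      rw [if_pos hjm]
      have e : ∫ ϑ in (0 : ℝ)..Real.pi, ((Real.sin ϑ : ℝ) : ℂ) *
          ((normConst ℓ j * normConst k j * ((legendreD ℓ j.natAbs).eval (Real.cos ϑ)
            * Real.sin ϑ ^ j.natAbs * ((legendreD k j.natAbs).eval (Real.cos ϑ)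
            * Real.sin ϑ ^ j.natAbs)) : ℝ) : ℂ)
          = ((normConst ℓ j * normConst k j * polarIntegral ℓ k j.natAbs : ℝ) : ℂ) := by
        rw [polarIntegral, ← intervalIntegral.integral_const_mul, ← intervalIntegral.integral_ofReal]
        congr 1
        funext ϑ
        push_cast
        ring
      rw [e]
      by_cases hlk : ℓ = k
      · subst hlk
        have h1 := polarIntegral_self (natAbs_le_of_mem_orders hm)
        have h2 := normConst_sq ℓ j
        rw [if_pos ⟨rfl, rfl⟩, ← pow_two, h2, ← Complex.ofReal_mul, ← Complex.ofReal_one]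
        congr 1
        have : Real.pi ≠ 0 := Real.pi_ne_zero
        field_simp
        linear_combination (2 : ℝ) * h1
      · simp [polarIntegral_of_ne hlk, hlk]
    · have : m ≠ j := by omega
      simp [hjm, this]
  · intro ϑ φ
    rw [harmonicY_sphPoint, harmonicY_sphPoint, map_mul, Complex.conj_ofReal, ← Complex.exp_conj,
      map_mul, Complex.conj_ofReal, Complex.conj_I]
    rw [show ((((j - m : ℤ) * φ : ℝ) : ℂ) * Complex.I) = ((m * φ : ℝ) : ℂ) * -Complex.I
      + ((j * φ : ℝ) : ℂ) * Complex.I by push_cast; ring, Complex.exp_add]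
    push_cast
    ring

/-- The eigenvalue equation holds off the poles, which suffices for pairings. -/
lemma pairing_sphLaplacian (f : L2) (ℓ : ℕ) (m : ℤ) (a : ℂ) :
    pairing f (sphLaplacian (harmonicTest ℓ m a))
      = -(ℓ * (ℓ + 1)) * pairing f (harmonicTest ℓ m a) := by
  rw [pairing, pairing, ← integral_const_mul]
  refine integral_congr_ae ?_
  filter_upwards [ae_sin_colatitude_ne_zero] with y hy
  rw [sphLaplacian_harmonicTest _ _ _ _ hy]
  ring

/-! ### Completeness of the spherical harmonics -/

/-- Indices `(ℓ, m)` with `-ℓ ≤ m ≤ ℓ`. -/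
abbrev HarmonicIndex : Type := Σ ℓ : ℕ, {m : ℤ // m ∈ orders ℓ}

/-- Spherical harmonics as continuous functions. -/
noncomputable def harmonicC (i : HarmonicIndex) : C(S2, ℂ) :=
  ⟨harmonicY i.1 i.2, continuous_harmonicY _ _⟩

/-- The function `q(y₂) · angular m y`. -/
noncomputable def solid (m : ℤ) (q : Polynomial ℝ) : C(S2, ℂ) :=
  ⟨fun y => ((q.eval (height y) : ℝ) : ℂ) * angular m y,
    (Complex.continuous_ofReal.comp (q.continuous.comp continuous_height)).mul
      (continuous_angular m)⟩

/-- The linear span of the spherical harmonics. -/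
noncomputable def harmonicSpan : Submodule ℂ C(S2, ℂ) := Submodule.span ℂ (range harmonicC)

lemma normConst_ne_zero (ℓ : ℕ) (m : ℤ) : normConst ℓ m ≠ 0 := by
  intro h
  have h1 := normConst_sq ℓ m
  rw [h] at h1
  have : 0 < (2 * ℓ + 1) / (4 * Real.pi) *
      ((ℓ - m.natAbs).factorial / (ℓ + m.natAbs).factorial : ℝ) := by
    have := Real.pi_pos
    positivity
  linarith

lemma harmonicC_eq (i : HarmonicIndex) :
    harmonicC i = (normConst i.1 i.2 : ℂ) • solid i.2 (legendreD i.1 (i.2 : ℤ).natAbs) := by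
  ext y
  simp [harmonicC, solid, harmonicY_eq, mul_assoc]

/-- Since `P_ℓ^{(k)}` has degree `ℓ - k`, these polynomials span all polynomials for fixed `k`. -/
lemma solid_mem_harmonicSpan (m : ℤ) (q : Polynomial ℝ) : solid m q ∈ harmonicSpan := by
  let S : Polynomial.Sequence ℝ := ⟨fun i => legendreD (m.natAbs + i) m.natAbs, fun i => by
    rw [degree_legendreD (Nat.le_add_right _ _), Nat.add_sub_cancel_left]⟩
  have hS := S.span fun i => by
    rw [isUnit_iff_ne_zero, Polynomial.leadingCoeff_ne_zero]
    exact S.ne_zero i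
  have hq : q ∈ Submodule.span ℝ (range S) := by rw [hS]; trivial
  induction hq using Submodule.span_induction with
  | mem p hp =>
    obtain ⟨i, rfl⟩ := hp
    have hm : m ∈ orders (m.natAbs + i) := by
      rw [orders, Finset.mem_Icc]
      omega
    have h := harmonicC_eq ⟨m.natAbs + i, m, hm⟩
    have h2 : solid m (S i) = (normConst (m.natAbs + i) m : ℂ)⁻¹ • harmonicC ⟨m.natAbs + i, m, hm⟩ := by
      rw [h, smul_smul, inv_mul_cancel₀ (by exact_mod_cast normConst_ne_zero _ _), one_smul]
    exact h2 ▸ Submodule.smul_mem _ _ (Submodule.subset_span ⟨_, rfl⟩)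
  | zero =>
    have : solid m 0 = 0 := by ext y; simp [solid]
    rw [this]
    exact zero_mem _
  | add p q _ _ hp hq =>
    have : solid m (p + q) = solid m p + solid m q := by ext y; simp [solid, add_mul]
    rw [this]
    exact add_mem hp hq
  | smul a p _ hp =>
    have : solid m (a • p) = (a : ℂ) • solid m p := by ext y; simp [solid, mul_assoc]
    rw [this]
    exact Submodule.smul_mem _ _ hp

lemma conj_horiz_mul_horiz (y : S2) :
    (starRingEnd ℂ) (horiz y) * horiz y = ((1 - height y ^ 2 : ℝ) : ℂ) := by
  rw [← normSq_horiz, Complex.normSq_eq_conj_mul_self]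

lemma horiz_mul_angular (m : ℤ) (y : S2) : horiz y * angular m y =
    if 0 ≤ m then angular (m + 1) y else ((1 - height y ^ 2 : ℝ) : ℂ) * angular (m + 1) y := by
  unfold angular
  split_ifs with h1 h2 h2
  · rw [show (m + 1).natAbs = m.natAbs + 1 by omega]; ring
  · omega
  · obtain rfl : m = -1 := by omega
    rw [← conj_horiz_mul_horiz]
    simp [mul_comm]
  · rw [show m.natAbs = (m + 1).natAbs + 1 by omega, ← conj_horiz_mul_horiz]; ring

lemma conj_horiz_mul_angular (m : ℤ) (y : S2) : (starRingEnd ℂ) (horiz y) * angular m y =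
    if m ≤ 0 then angular (m - 1) y else ((1 - height y ^ 2 : ℝ) : ℂ) * angular (m - 1) y := by
  rcases lt_trichotomy m 0 with h | rfl | h
  · rw [angular, angular, if_pos h.le, if_neg (by omega), if_neg (by omega),
      show (m - 1).natAbs = m.natAbs + 1 by omega]
    ring
  · simp [angular]
  · rw [angular, angular, if_neg h.not_ge, if_pos (by omega), if_pos (by omega),
      show m.natAbs = (m - 1).natAbs + 1 by omega, ← conj_horiz_mul_horiz]
    ring

/-- Multipliers of the span of the spherical harmonics. -/
noncomputable def harmonicMultipliers : Subalgebra ℂ C(S2, ℂ) where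
  carrier := {f | ∀ g ∈ harmonicSpan, f * g ∈ harmonicSpan}
  mul_mem' := fun {a b} ha hb g hg => by rw [mul_assoc]; exact ha _ (hb _ hg)
  add_mem' := fun {a b} ha hb g hg => by rw [add_mul]; exact add_mem (ha _ hg) (hb _ hg)
  algebraMap_mem' := fun r g hg => by
    rw [← Algebra.smul_def]
    exact Submodule.smul_mem _ _ hg

lemma mem_harmonicMultipliers_of_solid {f : C(S2, ℂ)}
    (h : ∀ m q, f * solid m q ∈ harmonicSpan) : f ∈ harmonicMultipliers := by
  intro g hg
  induction hg using Submodule.span_induction with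
  | mem p hp =>
    obtain ⟨i, rfl⟩ := hp
    rw [harmonicC_eq, mul_smul_comm]
    exact Submodule.smul_mem _ _ (h _ _)
  | zero => rw [mul_zero]; exact zero_mem _
  | add p q _ _ hp hq => rw [mul_add]; exact add_mem hp hq
  | smul a p _ hp => rw [mul_smul_comm]; exact Submodule.smul_mem _ _ hp

/-- The horizontal coordinates as a continuous function. -/
noncomputable def horizC : C(S2, ℂ) := ⟨horiz, continuous_horiz⟩

/-- The vertical coordinate as a continuous function. -/
noncomputable def heightC : C(S2, ℂ) :=
  ⟨fun y => (height y : ℂ), Complex.continuous_ofReal.comp continuous_height⟩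

lemma horizC_mem : horizC ∈ harmonicMultipliers := by
  refine mem_harmonicMultipliers_of_solid fun m q => ?_
  by_cases h : 0 ≤ m
  · have : horizC * solid m q = solid (m + 1) q := by
      ext y
      have := horiz_mul_angular m y
      rw [if_pos h] at this
      simp only [horizC, solid, ContinuousMap.mul_apply, ContinuousMap.coe_mk, ← this]
      ring
    rw [this]
    exact solid_mem_harmonicSpan _ _
  · have : horizC * solid m q = solid (m + 1) ((1 - Polynomial.X ^ 2) * q) := by
      ext y
      have := horiz_mul_angular m y
      rw [if_neg h] at this
      simp only [horizC, solid, ContinuousMap.mul_apply, ContinuousMap.coe_mk]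
      rw [mul_left_comm, this]
      simp
      ring
    rw [this]
    exact solid_mem_harmonicSpan _ _

lemma star_horizC_mem : star horizC ∈ harmonicMultipliers := by
  refine mem_harmonicMultipliers_of_solid fun m q => ?_
  by_cases h : m ≤ 0
  · have : star horizC * solid m q = solid (m - 1) q := by
      ext y
      have := conj_horiz_mul_angular m y
      rw [if_pos h] at this
      simp only [horizC, solid, ContinuousMap.mul_apply, ContinuousMap.coe_mk, ← this,
        ContinuousMap.star_apply]
      simp
      ring
    rw [this]
    exact solid_mem_harmonicSpan _ _
  · have : star horizC * solid m q = solid (m - 1) ((1 - Polynomial.X ^ 2) * q) := by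
      ext y
      have := conj_horiz_mul_angular m y
      rw [if_neg h] at this
      simp only [horizC, solid, ContinuousMap.mul_apply, ContinuousMap.coe_mk,
        ContinuousMap.star_apply, ← starRingEnd_apply]
      rw [mul_left_comm, this]
      simp
      ring
    rw [this]
    exact solid_mem_harmonicSpan _ _

lemma heightC_mem : heightC ∈ harmonicMultipliers := by
  refine mem_harmonicMultipliers_of_solid fun m q => ?_
  have : heightC * solid m q = solid m (Polynomial.X * q) := by
    ext y
    simp [heightC, solid, mul_assoc]
  rw [this]
  exact solid_mem_harmonicSpan _ _

lemma star_heightC : star heightC = heightC := by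
  ext y
  simp [heightC]

/-- By Stone–Weierstrass, the span of the spherical harmonics is uniformly dense: it contains
the algebra generated by the coordinates. -/
lemma harmonicSpan_topologicalClosure : harmonicSpan.topologicalClosure = ⊤ := by
  let A : StarSubalgebra ℂ C(S2, ℂ) := StarAlgebra.adjoin ℂ {horizC, heightC}
  have hA : A.topologicalClosure = ⊤ := by
    apply ContinuousMap.starSubalgebra_topologicalClosure_eq_top_of_separatesPoints
    intro x y hxy
    by_contra hcon
    push Not at hcon
    have h1 : horiz x = horiz y :=
      hcon _ ⟨horizC, StarAlgebra.subset_adjoin ℂ _ (by simp), rfl⟩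
    have h2 : (height x : ℂ) = height y :=
      hcon _ ⟨heightC, StarAlgebra.subset_adjoin ℂ _ (by simp), rfl⟩
    apply hxy
    apply Subtype.ext
    ext i
    fin_cases i
    · exact congrArg Complex.re h1
    · exact congrArg Complex.im h1
    · exact Complex.ofReal_injective h2
  have hsub : ∀ f ∈ A, f ∈ harmonicSpan := by
    intro f hf
    have h1 : A.toSubalgebra ≤ harmonicMultipliers := by
      rw [StarAlgebra.adjoin_toSubalgebra]
      refine Algebra.adjoin_le ?_
      rintro g (hg | hg)
      · rcases hg with rfl | rfl
        · exact horizC_mem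
        · exact heightC_mem
      · rw [Set.mem_star] at hg
        rcases hg with hg | hg
        · rw [← star_star g, hg]
          exact star_horizC_mem
        · rw [← star_star g, hg, star_heightC]
          exact heightC_mem
    have h2 : solid 0 1 = 1 := by
      ext y
      simp [solid, angular]
    have h3 := h1 hf _ (solid_mem_harmonicSpan 0 1)
    rwa [h2, mul_one] at h3
  rw [eq_top_iff]
  intro f _
  have hf : f ∈ A.topologicalClosure := by rw [hA]; trivial
  exact closure_mono (fun g hg => hsub g hg) hf

/-- Spherical harmonics as elements of the complex space `L²(S²)`. -/
noncomputable def harmonicLp (i : HarmonicIndex) : Lp ℂ 2 sphMeasure :=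
  ContinuousMap.toLp 2 sphMeasure ℂ (harmonicC i)

lemma coeFn_harmonicLp (i : HarmonicIndex) :
    harmonicLp i =ᵐ[sphMeasure] harmonicY i.1 i.2 :=
  ContinuousMap.coeFn_toLp sphMeasure (harmonicC i)

lemma inner_harmonicLp (i : HarmonicIndex) (F : Lp ℂ 2 sphMeasure) :
    inner ℂ (harmonicLp i) F
      = ∫ y, F y * (starRingEnd ℂ) (harmonicY i.1 i.2 y) ∂sphMeasure := by
  rw [L2.inner_def]
  refine integral_congr_ae ?_
  filter_upwards [coeFn_harmonicLp i] with y hy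
  rw [hy, RCLike.inner_apply]

lemma orthonormal_harmonicLp : Orthonormal ℂ harmonicLp := by
  classical
  rw [orthonormal_iff_ite]
  rintro ⟨ℓ, m, hm⟩ ⟨k, j, hj⟩
  rw [inner_harmonicLp]
  have : ∫ y, harmonicLp ⟨k, j, hj⟩ y * (starRingEnd ℂ) (harmonicY ℓ m y) ∂sphMeasure
      = ∫ y, (starRingEnd ℂ) (harmonicY ℓ m y) * harmonicY k j y ∂sphMeasure := by
    refine integral_congr_ae ?_
    filter_upwards [coeFn_harmonicLp ⟨k, j, hj⟩] with y hy
    rw [hy, mul_comm]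
  rw [this, integral_conj_harmonicY_mul ℓ k m j hm]
  congr 1
  rw [eq_iff_iff]
  constructor
  · rintro ⟨rfl, rfl⟩
    rfl
  · intro h
    cases h
    exact ⟨rfl, rfl⟩

lemma span_harmonicLp :
    ⊤ ≤ (Submodule.span ℂ (range harmonicLp)).topologicalClosure := by
  have hd : Dense (harmonicSpan : Set C(S2, ℂ)) :=
    Submodule.dense_iff_topologicalClosure_eq_top.mpr harmonicSpan_topologicalClosure
  have h1 : Dense ((ContinuousMap.toLp 2 sphMeasure ℂ : C(S2, ℂ) → Lp ℂ 2 sphMeasure) ''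
      (harmonicSpan : Set C(S2, ℂ))) :=
    (ContinuousMap.toLp_denseRange ℂ sphMeasure ℂ (by simp)).dense_image
      (ContinuousLinearMap.continuous _) hd
  have h2 : (ContinuousMap.toLp 2 sphMeasure ℂ : C(S2, ℂ) → Lp ℂ 2 sphMeasure) ''
      (harmonicSpan : Set C(S2, ℂ)) ⊆ Submodule.span ℂ (range harmonicLp) := by
    rintro _ ⟨f, hf, rfl⟩
    have h3 := Submodule.mem_map_of_mem
      (f := (ContinuousMap.toLp 2 sphMeasure ℂ : C(S2, ℂ) →L[ℂ] Lp ℂ 2 sphMeasure).toLinearMap) hf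
    rw [harmonicSpan, Submodule.map_span, ← range_comp] at h3
    exact h3
  rw [Submodule.dense_iff_topologicalClosure_eq_top.mp (h1.mono h2)]

/-- The spherical harmonics form a Hilbert basis of the complex space `L²(S²)`. -/
noncomputable def harmonicBasis : HilbertBasis HarmonicIndex ℂ (Lp ℂ 2 sphMeasure) :=
  HilbertBasis.mk orthonormal_harmonicLp span_harmonicLp

lemma coe_harmonicBasis (i : HarmonicIndex) : harmonicBasis i = harmonicLp i := by
  rw [harmonicBasis, HilbertBasis.coe_mk]

/-! ### Expansion of real functions in spherical harmonics -/

/-- A real function, regarded as an element of the complex space `L²(S²)`. -/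
noncomputable def complexify (f : L2) : Lp ℂ 2 sphMeasure := Complex.ofRealCLM.compLp f

lemma coeFn_complexify (f : L2) : complexify f =ᵐ[sphMeasure] fun y => ((f y : ℝ) : ℂ) :=
  ContinuousLinearMap.coeFn_compLp _ f

lemma coeff_eq_inner (f : L2) (i : HarmonicIndex) :
    coeff f i.1 i.2 = inner ℂ (harmonicBasis i) (complexify f) := by
  rw [coe_harmonicBasis, inner_harmonicLp, coeff]
  refine integral_congr_ae ?_
  filter_upwards [coeFn_complexify f] with y hy
  rw [hy]

/-- Parseval's identity. -/
lemma enorm_sq_eq_tsum (F : Lp ℂ 2 sphMeasure) :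
    ‖F‖ₑ ^ 2 = ∑' i, ‖inner ℂ (harmonicBasis i) F‖ₑ ^ 2 := by
  have h2 : HasSum (fun i => ‖inner ℂ (harmonicBasis i) F‖ ^ 2) (‖F‖ ^ 2) := by
    have h3 := Complex.reCLM.hasSum (harmonicBasis.hasSum_inner_mul_inner F F)
    have e : Complex.reCLM (inner ℂ F F) = ‖F‖ ^ 2 := by
      rw [inner_self_eq_norm_sq_to_K]
      simp [← Complex.ofReal_pow]
    rw [e] at h3
    convert h3 using 2 with i
    rw [← inner_conj_symm F, ← Complex.normSq_eq_conj_mul_self, Complex.reCLM_apply,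
      Complex.ofReal_re, Complex.normSq_eq_norm_sq]
  have h3 := ENNReal.ofReal_tsum_of_nonneg (fun i => sq_nonneg _) h2.summable
  rw [h2.tsum_eq, ENNReal.ofReal_pow (norm_nonneg _), ofReal_norm] at h3
  rw [h3]
  congr 1
  funext i
  rw [ENNReal.ofReal_pow (norm_nonneg _), ofReal_norm]

lemma tsum_harmonicIndex (c : ℕ → ℤ → ℝ≥0∞) :
    ∑' i : HarmonicIndex, c i.1 i.2 = ∑' ℓ, ∑ m ∈ orders ℓ, c ℓ m := by
  rw [ENNReal.tsum_sigma']
  congr 1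
  funext ℓ
  exact (orders ℓ).tsum_subtype (c ℓ)

lemma tsum_enorm_coeff_sq (f : L2) :
    ∑' ℓ, ∑ m ∈ orders ℓ, ‖coeff f ℓ m‖ₑ ^ 2 = ‖complexify f‖ₑ ^ 2 := by
  rw [enorm_sq_eq_tsum, ← tsum_harmonicIndex]
  simp_rw [coeff_eq_inner]

/-- The error of the truncated expansion is the tail of the series of squared coefficients. -/
lemma errorL2_sq (U : L2) (κ : ℕ) (g : S2 → ℂ)
    (hg : ∀ y, g y = ∑ ℓ ∈ Finset.range (κ + 1), ∑ m ∈ orders ℓ, coeff U ℓ m * harmonicY ℓ m y) :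
    errorL2 U g ^ 2 = ∑' ℓ, if κ < ℓ then ∑ m ∈ orders ℓ, ‖coeff U ℓ m‖ₑ ^ 2 else 0 := by
  classical
  let s : Finset HarmonicIndex :=
    (Finset.range (κ + 1)).sigma fun ℓ => (orders ℓ).attach
  let F : Lp ℂ 2 sphMeasure := complexify U
    - ∑ i ∈ s, inner ℂ (harmonicBasis i) (complexify U) • harmonicBasis i
  have h1 : errorL2 U g = ‖F‖ₑ := by
    rw [errorL2, Lp.enorm_def]
    refine eLpNorm_congr_ae ?_
    have h2 : ∀ᵐ y ∂sphMeasure, ∀ i : HarmonicIndex, harmonicBasis i y = harmonicY i.1 i.2 y := by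
      rw [ae_all_iff]
      intro i
      rw [coe_harmonicBasis]
      exact coeFn_harmonicLp i
    have h3 : ∀ᵐ y ∂sphMeasure, ∀ i : HarmonicIndex,
        (inner ℂ (harmonicBasis i) (complexify U) • harmonicBasis i : Lp ℂ 2 sphMeasure) y
          = inner ℂ (harmonicBasis i) (complexify U) * harmonicBasis i y := by
      rw [ae_all_iff]
      intro i
      exact Lp.coeFn_smul _ _
    filter_upwards [h2, h3, coeFn_complexify U, Lp.coeFn_sub (complexify U)
      (∑ i ∈ s, inner ℂ (harmonicBasis i) (complexify U) • harmonicBasis i),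
      Lp.coeFn_finsetSum s
        (fun i => inner ℂ (harmonicBasis i) (complexify U) • harmonicBasis i)]
      with y hy hy' hU hs hsum
    rw [hs, Pi.sub_apply, hU, hsum, hg]
    congr 1
    simp only [s, Finset.sum_apply, hy', hy, Finset.sum_sigma]
    refine Finset.sum_congr rfl fun ℓ _ => ?_
    rw [← Finset.sum_attach]
    refine Finset.sum_congr rfl fun m _ => ?_
    rw [← coeff_eq_inner U ⟨ℓ, m⟩]
  rw [h1, enorm_sq_eq_tsum]
  have h4 (i : HarmonicIndex) : inner ℂ (harmonicBasis i) F
      = if κ < i.1 then coeff U i.1 i.2 else 0 := by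
    have horth := orthonormal_iff_ite.mp harmonicBasis.orthonormal
    simp only [F, inner_sub_right, inner_sum, inner_smul_right, horth]
    rw [← coeff_eq_inner]
    simp only [mul_ite, mul_one, mul_zero, Finset.sum_ite_eq]
    rw [← coeff_eq_inner]
    have : i ∈ s ↔ i.1 ≤ κ := by
      simp [s, Finset.mem_sigma]
    by_cases h : κ < i.1
    · rw [if_pos h, if_neg (by rw [this]; omega), sub_zero]
    · rw [if_neg h, if_pos (by rw [this]; omega), sub_self]
  simp_rw [h4]
  rw [tsum_harmonicIndex (fun ℓ m => ‖if κ < ℓ then coeff U ℓ m else 0‖ₑ ^ 2)]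
  congr 1
  funext ℓ
  split_ifs <;> simp

/-- A continuous function on the sphere as an element of `L²(S²)`. -/
noncomputable def testLp (φ : S2 → ℝ) (hφ : Continuous φ) : L2 :=
  ContinuousMap.toLp 2 sphMeasure ℝ ⟨φ, hφ⟩

lemma coeFn_testLp (φ : S2 → ℝ) (hφ : Continuous φ) : testLp φ hφ =ᵐ[sphMeasure] φ :=
  ContinuousMap.coeFn_toLp sphMeasure _

lemma pairing_eq_inner (U : L2) (φ : S2 → ℝ) (hφ : Continuous φ) :
    pairing U φ = inner ℝ U (testLp φ hφ) := by
  rw [pairing, L2.inner_def]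
  refine integral_congr_ae ?_
  filter_upwards [coeFn_testLp φ hφ] with y hy
  simp [hy, mul_comm]

/-- Parseval's identity for the pairing with a continuous real function. -/
lemma hasSum_pairing (U : L2) (φ : S2 → ℝ) (hφ : Continuous φ) :
    HasSum (fun i : HarmonicIndex => coeff U i.1 i.2
      * (starRingEnd ℂ) (coeff (testLp φ hφ) i.1 i.2)) (pairing U φ : ℂ) := by
  have h := harmonicBasis.hasSum_inner_mul_inner (complexify (testLp φ hφ)) (complexify U)
  have e : inner ℂ (complexify (testLp φ hφ)) (complexify U) = (pairing U φ : ℂ) := by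
    rw [L2.inner_def, pairing, ← integral_complex_ofReal]
    refine integral_congr_ae ?_
    filter_upwards [coeFn_complexify (testLp φ hφ), coeFn_complexify U, coeFn_testLp φ hφ]
      with y h1 h2 h3
    rw [h1, h2, h3]
    simp
  rw [e] at h
  refine h.congr_fun fun i => ?_
  rw [coeff_eq_inner, coeff_eq_inner, inner_conj_symm, mul_comm]

lemma coeff_eq_pairing (f : L2) (ℓ : ℕ) (m : ℤ) :
    coeff f ℓ m = (pairing f (harmonicTest ℓ m 1) : ℂ)
      - pairing f (harmonicTest ℓ m (-Complex.I)) * Complex.I := by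
  have hi (a : ℂ) : Integrable (fun y => f y * harmonicTest ℓ m a y) sphMeasure := by
    have hc : Continuous (harmonicTest ℓ m a) := (harmonicTest ℓ m a).contMDiff.continuous
    have := L2.integrable_inner (𝕜 := ℝ) f (testLp _ hc)
    refine this.congr ?_
    filter_upwards [coeFn_testLp _ hc] with y hy
    simp [hy, mul_comm]
  rw [coeff, pairing, pairing, ← integral_complex_ofReal, ← integral_complex_ofReal,
    ← integral_mul_const, ← integral_sub ((hi 1).ofReal) ((hi _).ofReal.mul_const _)]
  congr 1
  funext y
  apply Complex.ext <;> simp [harmonicTest_apply]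

/-- Square summable coefficients with the symmetry of real functions are the coefficients of an
element of the real space `L²(S²)`. -/
lemma exists_coeff_eq (c : ℕ → ℤ → ℂ) (hc : ∑' ℓ, ∑ m ∈ orders ℓ, ‖c ℓ m‖ₑ ^ 2 ≠ ∞)
    (hsymm : ∀ ℓ, ∀ m ∈ orders ℓ, c ℓ (-m) = (-1) ^ m.natAbs * (starRingEnd ℂ) (c ℓ m)) :
    ∃ U : L2, ∀ ℓ, ∀ m ∈ orders ℓ, coeff U ℓ m = c ℓ m := by
  rw [← tsum_harmonicIndex (fun ℓ m => ‖c ℓ m‖ₑ ^ 2)] at hc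
  have hmem : Memℓp (fun i : HarmonicIndex => c i.1 i.2) 2 := by
    apply memℓp_gen
    have := ENNReal.summable_toReal hc
    simpa using this
  let F : Lp ℂ 2 sphMeasure := harmonicBasis.repr.symm ⟨_, hmem⟩
  have hF (i : HarmonicIndex) : ∫ y, F y * (starRingEnd ℂ) (harmonicY i.1 i.2 y) ∂sphMeasure
      = c i.1 i.2 := by
    rw [← inner_harmonicLp, ← coe_harmonicBasis, ← HilbertBasis.repr_apply_apply]
    simp [F]
  refine ⟨Complex.reCLM.compLp F, fun ℓ m hm => ?_⟩
  have hm' : -m ∈ orders ℓ := by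
    rw [orders, Finset.mem_Icc] at hm ⊢
    omega
  have hint (m : ℤ) : Integrable (fun y => F y * (starRingEnd ℂ) (harmonicY ℓ m y)) sphMeasure := by
    have hb : MemLp (harmonicY ℓ m) 2 sphMeasure := by
      refine MemLp.of_bound (continuous_harmonicY ℓ m).aestronglyMeasurable
        ‖(⟨_, continuous_harmonicY ℓ m⟩ : C(S2, ℂ))‖ (Eventually.of_forall fun y => ?_)
      exact ContinuousMap.norm_coe_le_norm (⟨_, continuous_harmonicY ℓ m⟩ : C(S2, ℂ)) y
    have := L2.integrable_inner (𝕜 := ℂ) hb.toLp F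
    refine this.congr ?_
    filter_upwards [hb.coeFn_toLp] with y hy
    rw [hy, RCLike.inner_apply]
  -- the coefficient of the real part is an average over the orders `m` and `-m`
  have h1 : coeff (Complex.reCLM.compLp F) ℓ m
      = ∫ y, (1 / 2 : ℂ) * (F y * (starRingEnd ℂ) (harmonicY ℓ m y)
        + (-1) ^ m.natAbs * (starRingEnd ℂ) (F y * (starRingEnd ℂ) (harmonicY ℓ (-m) y)))
          ∂sphMeasure := by
    rw [coeff]
    refine integral_congr_ae ?_
    filter_upwards [ContinuousLinearMap.coeFn_compLp Complex.reCLM F] with y hy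
    rw [hy, Complex.reCLM_apply, Complex.re_eq_add_conj, harmonicY_neg]
    have hs : ((-1 : ℂ) ^ m.natAbs) * (-1) ^ m.natAbs = 1 := by simp [← mul_pow]
    simp only [map_mul, map_pow, map_neg, map_one, Complex.conj_conj]
    linear_combination (-(1 / 2 : ℂ) * (starRingEnd ℂ) (F y) * (starRingEnd ℂ) (harmonicY ℓ m y)) * hs
  rw [h1, integral_const_mul, integral_add (hint m), integral_const_mul, integral_conj,
    hF ⟨ℓ, m, hm⟩, hF ⟨ℓ, -m, hm'⟩, hsymm ℓ m hm]
  · simp [← mul_assoc, ← mul_pow]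
    ring
  · have h2 := Complex.conjCLE.toContinuousLinearMap.integrable_comp (hint (-m))
    exact h2.const_mul _

section

/-! ### Wiener integrals along real paths -/

/-- `∫_s^t g da` for a `C¹` function `g` with derivative `g'` and a continuous real path `a`,
defined through integration by parts. -/
noncomputable def pathIntegral (g g' : ℝ → ℝ) (a : ℝ → ℝ) (s t : ℝ) : ℝ :=
  g t * a t - g s * a s - ∫ r in s..t, g' r * a r

/-- The points of the uniform grid with `n` steps on `[s, t]`, constant from the index `n` on. -/
noncomputable def uniformGrid (s t : ℝ) (n i : ℕ) : ℝ := s + (t - s) * ((min i n : ℕ) / n)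

lemma uniformGrid_mono {s t : ℝ} (hst : s ≤ t) (n : ℕ) : Monotone (uniformGrid s t n) := by
  intro i j hij
  have h1 : ((min i n : ℕ) : ℝ) ≤ (min j n : ℕ) := by
    exact_mod_cast min_le_min_right n hij
  have h2 : 0 ≤ t - s := sub_nonneg.mpr hst
  unfold uniformGrid
  gcongr

lemma uniformGrid_zero (s t : ℝ) (n : ℕ) : uniformGrid s t n 0 = s := by simp [uniformGrid]

lemma uniformGrid_self (s t : ℝ) {n : ℕ} (hn : n ≠ 0) : uniformGrid s t n n = t := by
  have : (n : ℝ) ≠ 0 := by exact_mod_cast hn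
  simp [uniformGrid, this]

lemma uniformGrid_mem {s t : ℝ} (hst : s ≤ t) {n : ℕ} (hn : n ≠ 0) (i : ℕ) :
    uniformGrid s t n i ∈ Icc s t := by
  constructor
  · exact (uniformGrid_zero s t n).symm.trans_le (uniformGrid_mono hst n (Nat.zero_le i))
  · have : uniformGrid s t n i = uniformGrid s t n (min i n) := by simp [uniformGrid]
    rw [this]
    exact (uniformGrid_mono hst n (min_le_right i n)).trans_eq (uniformGrid_self s t hn)

lemma uniformGrid_succ_sub {s t : ℝ} {n i : ℕ} (hi : i < n) :
    uniformGrid s t n (i + 1) - uniformGrid s t n i = (t - s) / n := by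
  rw [uniformGrid, uniformGrid, min_eq_left hi.le, min_eq_left (Nat.succ_le_of_lt hi)]
  push_cast
  ring

/-- The Riemann–Stieltjes sum of `g` against `a` on the uniform grid. -/
noncomputable def riemannSum (g a : ℝ → ℝ) (s t : ℝ) (n : ℕ) : ℝ :=
  ∑ i ∈ Finset.range n, g (uniformGrid s t n i)
    * (a (uniformGrid s t n (i + 1)) - a (uniformGrid s t n i))

/-- Riemann–Stieltjes sums converge along continuous paths: by partial summation the error is the
integral of `g'` against the oscillation of the path. -/
lemma tendsto_riemannSum {g g' a : ℝ → ℝ} (hg : ∀ r, HasDerivAt g (g' r) r)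
    (hg' : Continuous g') {s t : ℝ} (hst : s ≤ t) (ha : ContinuousOn a (Icc s t)) :
    Tendsto (fun n => riemannSum g a s t (n + 1)) atTop (nhds (pathIntegral g g' a s t)) := by
  obtain ⟨B, hB⟩ := isCompact_Icc.exists_bound_of_continuousOn (s := Icc s t) hg'.continuousOn
  have hB0 : 0 ≤ B := (norm_nonneg _).trans (hB s (left_mem_Icc.mpr hst))
  have hu := isCompact_Icc.uniformContinuousOn_of_continuous ha
  rw [Metric.uniformContinuousOn_iff] at hu
  rw [Metric.tendsto_atTop]
  intro ε hε
  obtain ⟨δ, hδ, hδ'⟩ := hu (ε / (B * (t - s) + 1)) (by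
    have := sub_nonneg.mpr hst
    positivity)
  obtain ⟨N, hN⟩ := exists_nat_gt ((t - s) / δ)
  refine ⟨N, fun n hn => ?_⟩
  set p := uniformGrid s t (n + 1) with hp
  have hpm (i : ℕ) : p i ∈ Icc s t := uniformGrid_mem hst (Nat.succ_ne_zero n) i
  have hpmono : Monotone p := uniformGrid_mono hst _
  have hp0 : p 0 = s := uniformGrid_zero _ _ _
  have hpn : p (n + 1) = t := uniformGrid_self _ _ (Nat.succ_ne_zero n)
  have hstep : (t - s) / ((n + 1 : ℕ) : ℝ) < δ := by
    rw [div_lt_iff₀ (by positivity)]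
    rw [div_lt_iff₀ hδ] at hN
    have : (N : ℝ) ≤ ((n + 1 : ℕ) : ℝ) := by exact_mod_cast hn.trans (Nat.le_succ n)
    nlinarith
  have hsub (i : ℕ) : uIcc (p i) (p (i + 1)) ⊆ Icc s t := by
    rw [uIcc_of_le (hpmono (Nat.le_succ i))]
    exact Icc_subset_Icc (hpm i).1 (hpm (i + 1)).2
  have hint (i : ℕ) : IntervalIntegrable (fun r => g' r * a r) volume (p i) (p (i + 1)) :=
    (hg'.continuousOn.mul (ha.mono (hsub i))).intervalIntegrable
  have h1 : ∫ r in s..t, g' r * a r = ∑ i ∈ Finset.range (n + 1), ∫ r in p i..p (i + 1), g' r * a r := by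
    rw [intervalIntegral.sum_integral_adjacent_intervals (fun i _ => hint i), hp0, hpn]
  have h2 : g t * a t - g s * a s
      = ∑ i ∈ Finset.range (n + 1), (g (p (i + 1)) * a (p (i + 1)) - g (p i) * a (p i)) := by
    rw [Finset.sum_range_sub (fun i => g (p i) * a (p i)), hp0, hpn]
  have h3 : riemannSum g a s t (n + 1) - pathIntegral g g' a s t
      = ∑ i ∈ Finset.range (n + 1), ∫ r in p i..p (i + 1), g' r * (a r - a (p (i + 1))) := by
    rw [pathIntegral, h1, h2, riemannSum, ← Finset.sum_sub_distrib, ← Finset.sum_sub_distrib]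
    refine Finset.sum_congr rfl fun i _ => ?_
    have h4 : ∫ r in p i..p (i + 1), g' r * (a r - a (p (i + 1)))
        = (∫ r in p i..p (i + 1), g' r * a r) - (g (p (i + 1)) - g (p i)) * a (p (i + 1)) := by
      rw [← intervalIntegral.integral_eq_sub_of_hasDerivAt (fun r _ => hg r)
        (hg'.intervalIntegrable _ _), ← intervalIntegral.integral_mul_const,
        ← intervalIntegral.integral_sub (hint i) ((hg'.intervalIntegrable _ _).mul_const _)]
      simp only [mul_sub]
    rw [h4, ← hp]
    ring
  rw [Real.dist_eq, h3]
  calc |∑ i ∈ Finset.range (n + 1), ∫ r in p i..p (i + 1), g' r * (a r - a (p (i + 1)))|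
      ≤ ∑ i ∈ Finset.range (n + 1), |∫ r in p i..p (i + 1), g' r * (a r - a (p (i + 1)))| :=
        Finset.abs_sum_le_sum_abs _ _
    _ ≤ ∑ i ∈ Finset.range (n + 1), B * (ε / (B * (t - s) + 1)) * (p (i + 1) - p i) := by
        refine Finset.sum_le_sum fun i hi => ?_
        have h5 := uniformGrid_succ_sub (s := s) (t := t) (Finset.mem_range.mp hi)
        rw [← hp] at h5
        have h6 := intervalIntegral.norm_integral_le_of_norm_le_const
          (a := p i) (b := p (i + 1)) (f := fun r => g' r * (a r - a (p (i + 1))))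
          (C := B * (ε / (B * (t - s) + 1))) (fun r hr => by
            have hr' : r ∈ Icc (p i) (p (i + 1)) := by
              rw [uIoc_of_le (hpmono (Nat.le_succ i))] at hr
              exact Ioc_subset_Icc_self hr
            have hrm : r ∈ Icc s t := Icc_subset_Icc (hpm i).1 (hpm (i + 1)).2 hr'
            rw [norm_mul]
            refine mul_le_mul (hB r hrm) ?_ (norm_nonneg _) hB0
            have := hδ' r hrm (p (i + 1)) (hpm _) (by
              rw [Real.dist_eq, abs_sub_comm, abs_of_nonneg (by linarith [hr'.2])]
              linarith [hr'.1])
            rw [Real.dist_eq] at this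
            exact this.le)
        rwa [abs_of_nonneg (sub_nonneg.mpr (hpmono (Nat.le_succ i)))] at h6
    _ = B * (t - s) * (ε / (B * (t - s) + 1)) := by
        rw [← Finset.mul_sum, Finset.sum_range_sub, hp0, hpn]
        ring
    _ < ε := by
        have := mul_nonneg hB0 (sub_nonneg.mpr hst)
        rw [mul_div_assoc', div_lt_iff₀ (by positivity)]
        nlinarith

lemma pathIntegral_sub {g g' a : ℝ → ℝ} (hg' : Continuous g') {s t : ℝ} (hs : 0 ≤ s) (hst : s ≤ t)
    (ha : ContinuousOn a (Icc 0 t)) :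
    pathIntegral g g' a 0 t - pathIntegral g g' a 0 s = pathIntegral g g' a s t := by
  have hi (x y : ℝ) (hx : x ∈ Icc 0 t) (hy : y ∈ Icc 0 t) :
      IntervalIntegrable (fun r => g' r * a r) volume x y :=
    (hg'.continuousOn.mul (ha.mono (uIcc_subset_Icc hx hy))).intervalIntegrable
  have h := intervalIntegral.integral_add_adjacent_intervals
    (hi 0 s (left_mem_Icc.mpr (hs.trans hst)) ⟨hs, hst⟩)
    (hi s t ⟨hs, hst⟩ (right_mem_Icc.mpr (hs.trans hst)))
  unfold pathIntegral
  linarith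

lemma continuousOn_pathIntegral {g g' a : ℝ → ℝ} (hg : ∀ r, HasDerivAt g (g' r) r)
    (hg' : Continuous g') {T : ℝ} (ha : ContinuousOn a (Icc 0 T)) :
    ContinuousOn (fun t => pathIntegral g g' a 0 t) (Icc 0 T) := by
  have hgc : Continuous g := continuous_iff_continuousAt.mpr fun r => (hg r).continuousAt
  refine ((hgc.continuousOn.mul ha).sub continuousOn_const).sub ?_
  rcases le_or_gt 0 T with hT | hT
  · have := intervalIntegral.continuousOn_primitive_interval (μ := volume) (a := 0) (b := T)
      (f := fun r => g' r * a r) (by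
        rw [uIcc_of_le hT]
        exact (hg'.continuousOn.mul ha).integrableOn_compact isCompact_Icc)
    rwa [uIcc_of_le hT] at this
  · rw [Icc_eq_empty hT.not_ge]
    exact continuousOn_empty _

/-! ### Gaussian bounds for Wiener integrals -/

/-- A real Brownian motion on `[0, T]` with variance `v` per unit of time. -/
structure IsBrownianWithVariance {Ω : Type*} [MeasurableSpace Ω] (P : Measure Ω) (T : ℝ) (v : ℝ≥0)
    (b : ℝ → Ω → ℝ) : Prop where
  aemeasurable : ∀ t ∈ Icc 0 T, AEMeasurable (b t) P
  zero : ∀ᵐ ω ∂P, b 0 ω = 0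
  continuousOn : ∀ᵐ ω ∂P, ContinuousOn (fun t => b t ω) (Icc 0 T)
  indep : HasIndepIncrements (fun t : Icc (0 : ℝ) T => b t) P
  gaussian : ∀ s t : ℝ, 0 ≤ s → s ≤ t → t ≤ T →
    HasLaw (fun ω => b t ω - b s ω) (gaussianReal 0 (Real.toNNReal (t - s) * v)) P

variable {Ω : Type*} [MeasurableSpace Ω] {P : Measure Ω} {T : ℝ} {v : ℝ≥0} {b : ℝ → Ω → ℝ}

/-- The `Lᵖ` norm of a standard normal variable. -/
noncomputable def gaussianMoment (p : ℝ≥0∞) : ℝ≥0∞ := eLpNorm id p (gaussianReal 0 1)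

lemma gaussianMoment_ne_top {p : ℝ≥0∞} (hp : p ≠ ∞) : gaussianMoment p ≠ ∞ :=
  (memLp_id_gaussianReal' p hp).2.ne

lemma eLpNorm_of_hasLaw_gaussian {X : Ω → ℝ} {w : ℝ≥0} (hX : HasLaw X (gaussianReal 0 w) P)
    (p : ℝ≥0∞) : eLpNorm X p P = ENNReal.ofReal (Real.sqrt w) * gaussianMoment p := by
  have h1 : eLpNorm X p P = eLpNorm id p (gaussianReal 0 w) := by
    rw [← hX.map_eq, eLpNorm_map_measure aestronglyMeasurable_id hX.aemeasurable]
    rfl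
  have h2 : (gaussianReal 0 1).map (Real.sqrt w * ·) = gaussianReal 0 w := by
    rw [gaussianReal_map_const_mul, mul_zero, mul_one]
    congr 1
    ext
    exact Real.sq_sqrt w.2
  rw [h1, ← h2, eLpNorm_map_measure aestronglyMeasurable_id (by fun_prop)]
  have h3 : (id ∘ fun x : ℝ => Real.sqrt w * x) = Real.sqrt w • (id : ℝ → ℝ) := by
    funext x
    simp
  rw [h3, eLpNorm_const_smul, Real.enorm_eq_ofReal (Real.sqrt_nonneg _), gaussianMoment]

lemma hasLaw_sum_gaussian [IsProbabilityMeasure P] {X : ℕ → Ω → ℝ} (hi : iIndepFun X P)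
    {w : ℕ → ℝ≥0} (hX : ∀ i, HasLaw (X i) (gaussianReal 0 (w i)) P) (n : ℕ) :
    HasLaw (∑ i ∈ Finset.range n, X i) (gaussianReal 0 (∑ i ∈ Finset.range n, w i)) P := by
  induction n with
  | zero =>
    simp only [Finset.range_zero, Finset.sum_empty, gaussianReal_zero_var]
    exact hasLaw_dirac_of_ae_eq (ae_of_all _ fun _ => rfl)
  | succ n ih =>
    rw [Finset.sum_range_succ, Finset.sum_range_succ]
    refine ⟨ih.aemeasurable.add (hX n).aemeasurable, ?_⟩
    have := gaussianReal_add_gaussianReal_of_indepFun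
      (hi.indepFun_sum_range_succ₀ (fun i => (hX i).aemeasurable) n) ih.map_eq (hX n).map_eq
    rwa [add_zero] at this

namespace IsBrownianWithVariance

lemma aemeasurable_riemannSum (hb : IsBrownianWithVariance P T v b) (g : ℝ → ℝ) {s t : ℝ}
    (hs : 0 ≤ s) (hst : s ≤ t) (ht : t ≤ T) (n : ℕ) :
    AEMeasurable (fun ω => riemannSum g (fun r => b r ω) s t (n + 1)) P := by
  unfold riemannSum
  have hm (i : ℕ) : AEMeasurable (b (uniformGrid s t (n + 1) i)) P := by
    have := uniformGrid_mem hst (Nat.succ_ne_zero n) i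
    exact hb.aemeasurable _ ⟨hs.trans this.1, this.2.trans ht⟩
  exact Finset.aemeasurable_fun_sum _ fun i _ => ((hm (i + 1)).sub (hm i)).const_mul _

lemma eLpNorm_riemannSum_le [IsProbabilityMeasure P] (hb : IsBrownianWithVariance P T v b)
    {g : ℝ → ℝ} {G : ℝ≥0} (hG : ∀ r, |g r| ≤ G) {s t : ℝ}
    (hs : 0 ≤ s) (hst : s ≤ t) (ht : t ≤ T) (n : ℕ) (p : ℝ≥0∞) :
    eLpNorm (fun ω => riemannSum g (fun r => b r ω) s t (n + 1)) p P
      ≤ ENNReal.ofReal (G * Real.sqrt (v * (t - s))) * gaussianMoment p := by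
  set q := uniformGrid s t (n + 1) with hq
  have hqm (i : ℕ) : q i ∈ Icc 0 T := by
    have := uniformGrid_mem hst (Nat.succ_ne_zero n) i
    exact ⟨hs.trans this.1, this.2.trans ht⟩
  have hqmono : Monotone q := uniformGrid_mono hst _
  have hind := hb.indep.nat (t := fun i => (⟨q i, hqm i⟩ : Icc (0 : ℝ) T)) hqmono
  have hind2 := hind.comp (fun i x => g (q i) * x) (fun i => by fun_prop)
  have hlaw (i : ℕ) := gaussianReal_const_mul
    (hb.gaussian (q i) (q (i + 1)) (hqm i).1 (hqmono (Nat.le_succ i)) (hqm (i + 1)).2) (g (q i))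
  simp only [mul_zero] at hlaw
  have hsum := hasLaw_sum_gaussian hind2 hlaw (n + 1)
  have e : (fun ω => riemannSum g (fun r => b r ω) s t (n + 1)) = ∑ i ∈ Finset.range (n + 1),
      ((fun x => g (q i) * x) ∘ fun ω => b (q (i + 1)) ω - b (q i) ω) := by
    funext ω
    simp [riemannSum, hq]
  rw [e, eLpNorm_of_hasLaw_gaussian hsum]
  gcongr
  rw [← Real.sqrt_sq G.coe_nonneg, ← Real.sqrt_mul (sq_nonneg _)]
  apply Real.sqrt_le_sqrt
  push_cast
  calc ∑ i ∈ Finset.range (n + 1), g (q i) ^ 2 * (((q (i + 1) - q i).toNNReal : ℝ) * v)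
      ≤ ∑ i ∈ Finset.range (n + 1), (G : ℝ) ^ 2 * ((q (i + 1) - q i) * v) := by
        refine Finset.sum_le_sum fun i _ => ?_
        have h0 : 0 ≤ q (i + 1) - q i := sub_nonneg.mpr (hqmono (Nat.le_succ i))
        rw [Real.coe_toNNReal _ h0]
        have h1 : g (q i) ^ 2 ≤ (G : ℝ) ^ 2 := by
          rw [← sq_abs]
          gcongr
          exact hG _
        gcongr
    _ = (G : ℝ) ^ 2 * (v * (t - s)) := by
        rw [← Finset.mul_sum, ← Finset.sum_mul, Finset.sum_range_sub, hq,
          uniformGrid_zero, uniformGrid_self _ _ (Nat.succ_ne_zero n)]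
        ring

variable {g g' : ℝ → ℝ}

lemma ae_tendsto_riemannSum (hb : IsBrownianWithVariance P T v b) (hg : ∀ r, HasDerivAt g (g' r) r)
    (hg' : Continuous g') {s t : ℝ} (hs : 0 ≤ s) (hst : s ≤ t) (ht : t ≤ T) :
    ∀ᵐ ω ∂P, Tendsto (fun n => riemannSum g (fun r => b r ω) s t (n + 1)) atTop
      (nhds (pathIntegral g g' (fun r => b r ω) s t)) := by
  filter_upwards [hb.continuousOn] with ω hω
  exact tendsto_riemannSum hg hg' hst (hω.mono (Icc_subset_Icc hs ht))

lemma aemeasurable_pathIntegral (hb : IsBrownianWithVariance P T v b)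
    (hg : ∀ r, HasDerivAt g (g' r) r) (hg' : Continuous g') {s t : ℝ} (hs : 0 ≤ s) (hst : s ≤ t)
    (ht : t ≤ T) : AEMeasurable (fun ω => pathIntegral g g' (fun r => b r ω) s t) P :=
  aemeasurable_of_tendsto_metrizable_ae' (fun n => hb.aemeasurable_riemannSum g hs hst ht n)
    (hb.ae_tendsto_riemannSum hg hg' hs hst ht)

/-- Moment bound for Wiener integrals: Riemann sums are Gaussian with controlled variance, and
Fatou's lemma transfers the bound to the limit. -/
lemma eLpNorm_pathIntegral_le [IsProbabilityMeasure P] (hb : IsBrownianWithVariance P T v b)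
    (hg : ∀ r, HasDerivAt g (g' r) r) (hg' : Continuous g') {G : ℝ≥0} (hG : ∀ r, |g r| ≤ G)
    {s t : ℝ} (hs : 0 ≤ s) (hst : s ≤ t) (ht : t ≤ T) (p : ℝ≥0∞) :
    eLpNorm (fun ω => pathIntegral g g' (fun r => b r ω) s t) p P
      ≤ ENNReal.ofReal (G * Real.sqrt (v * (t - s))) * gaussianMoment p := by
  refine (Lp.eLpNorm_lim_le_liminf_eLpNorm
    (fun n => (hb.aemeasurable_riemannSum g hs hst ht n).aestronglyMeasurable) _
    (hb.ae_tendsto_riemannSum hg hg' hs hst ht)).trans ?_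
  refine (liminf_le_liminf (Eventually.of_forall fun n =>
    hb.eLpNorm_riemannSum_le hG hs hst ht n p)).trans ?_
  rw [liminf_const]

end IsBrownianWithVariance

end

section

/-! ### A maximal inequality by dyadic chaining -/

/-- A dyadic point is reached from `0` by at most one increment of each level. -/
lemma abs_le_of_dyadic {x : ℝ → ℝ} {T d : ℝ} (h0 : x 0 = 0) (hd : 0 ≤ d)
    (hinc : ∀ j k : ℕ, k < 2 ^ j →
      |x (T * (((k + 1 : ℕ) : ℝ) / 2 ^ j)) - x (T * ((k : ℝ) / 2 ^ j))| ≤ (9 / 10) ^ j * d)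
    (n k : ℕ) (hk : k ≤ 2 ^ n) :
    |x (T * ((k : ℝ) / 2 ^ n))| ≤ (∑ j ∈ Finset.range (n + 1), (9 / 10 : ℝ) ^ j) * d := by
  induction n generalizing k with
  | zero =>
    simp only [pow_zero] at hk
    interval_cases k
    · simpa [h0] using hd
    · have := hinc 0 0 (by simp)
      simpa [h0] using this
  | succ n ih =>
    rw [Finset.sum_range_succ, add_mul]
    have hhalf (q : ℕ) : T * (((2 * q : ℕ) : ℝ) / 2 ^ (n + 1)) = T * ((q : ℝ) / 2 ^ n) := by
      push_cast
      rw [pow_succ]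
      field_simp
    rcases Nat.even_or_odd' k with ⟨q, rfl | rfl⟩
    · rw [hhalf]
      have := ih q (by rw [pow_succ] at hk; omega)
      have h2 : 0 ≤ (9 / 10 : ℝ) ^ (n + 1) * d := by positivity
      linarith
    · have h1 := ih q (by rw [pow_succ] at hk; omega)
      have h2 := hinc (n + 1) (2 * q) (by omega)
      rw [hhalf] at h2
      have h3 := abs_add_le (x (T * ((q : ℝ) / 2 ^ n)))
        (x (T * (((2 * q + 1 : ℕ) : ℝ) / 2 ^ (n + 1))) - x (T * ((q : ℝ) / 2 ^ n)))
      rw [add_sub_cancel] at h3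
      linarith

/-- Pathwise chaining: geometric control of the dyadic increments controls the whole path. -/
lemma abs_le_of_dyadic_increments {x : ℝ → ℝ} {T d : ℝ} (hx : ContinuousOn x (Icc 0 T))
    (h0 : x 0 = 0) (hd : 0 ≤ d)
    (hinc : ∀ j k : ℕ, k < 2 ^ j →
      |x (T * (((k + 1 : ℕ) : ℝ) / 2 ^ j)) - x (T * ((k : ℝ) / 2 ^ j))| ≤ (9 / 10) ^ j * d)
    {t : ℝ} (ht : t ∈ Icc 0 T) : |x t| ≤ 10 * d := by
  have hT : 0 ≤ T := ht.1.trans ht.2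
  have hdy (n k : ℕ) (hk : k ≤ 2 ^ n) : |x (T * ((k : ℝ) / 2 ^ n))| ≤ 10 * d := by
    refine (abs_le_of_dyadic h0 hd hinc n k hk).trans ?_
    gcongr
    have : (0 : ℝ) ≤ (9 / 10) ^ (n + 1) := by positivity
    rw [geom_sum_eq (by norm_num), div_le_iff_of_neg (by norm_num)]
    linarith
  rcases hT.eq_or_lt with rfl | hT
  · have : t = 0 := le_antisymm ht.2 ht.1
    rw [this, h0, abs_zero]
    positivity
  · have hfl (n : ℕ) : ⌊t / T * 2 ^ n⌋₊ ≤ 2 ^ n := by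
      have h1 : t / T ≤ 1 := (div_le_one hT).mpr ht.2
      have h2 : t / T * 2 ^ n ≤ ((2 ^ n : ℕ) : ℝ) := by
        push_cast
        have : (0 : ℝ) < 2 ^ n := by positivity
        nlinarith
      exact Nat.floor_le_of_le h2
    have hlim : Tendsto (fun n : ℕ => T * ((⌊t / T * 2 ^ n⌋₊ : ℝ) / 2 ^ n)) atTop (nhds t) := by
      have h1 := (tendsto_nat_floor_mul_div_atTop (div_nonneg ht.1 hT.le)).comp
        (tendsto_pow_atTop_atTop_of_one_lt (one_lt_two (α := ℝ)))
      have h2 := h1.const_mul T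
      rwa [mul_div_cancel₀ _ hT.ne'] at h2
    have hmem (n : ℕ) : T * ((⌊t / T * 2 ^ n⌋₊ : ℝ) / 2 ^ n) ∈ Icc 0 T := by
      refine ⟨by positivity, ?_⟩
      have h1 : ((⌊t / T * 2 ^ n⌋₊ : ℕ) : ℝ) ≤ ((2 ^ n : ℕ) : ℝ) := by exact_mod_cast hfl n
      push_cast at h1
      have h2 : (⌊t / T * 2 ^ n⌋₊ : ℝ) / 2 ^ n ≤ 1 := (div_le_one (by positivity)).mpr h1
      nlinarith
    have hlim2 := (hx t ht).tendsto.comp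
      (tendsto_nhdsWithin_iff.mpr ⟨hlim, Eventually.of_forall hmem⟩)
    exact le_of_tendsto hlim2.abs (Eventually.of_forall fun n => hdy n _ (hfl n))

variable {Ω : Type*} [MeasurableSpace Ω] {P : Measure Ω}

/-- Maximal inequality for continuous processes whose increments have fourth moments of the order
of the squared time step. -/
lemma exists_maximal_bound {T : ℝ} (hT : 0 ≤ T) {X : ℝ → Ω → ℝ}
    (hm : ∀ t ∈ Icc 0 T, AEMeasurable (X t) P) (h0 : ∀ᵐ ω ∂P, X 0 ω = 0)
    (hc : ∀ᵐ ω ∂P, ContinuousOn (fun t => X t ω) (Icc 0 T)) {κ : ℝ≥0∞}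
    (hX : ∀ s t : ℝ, 0 ≤ s → s ≤ t → t ≤ T →
      ∫⁻ ω, ‖X t ω - X s ω‖ₑ ^ 4 ∂P ≤ κ * ENNReal.ofReal ((t - s) ^ 2)) :
    ∃ Z : Ω → ℝ≥0∞, AEMeasurable Z P ∧ (∀ᵐ ω ∂P, ∀ t ∈ Icc 0 T, ‖X t ω‖ₑ ^ 4 ≤ Z ω) ∧
      ∫⁻ ω, Z ω ∂P ≤ ENNReal.ofReal 50000 * (κ * ENNReal.ofReal (T ^ 2)) := by
  have hmem (j k : ℕ) (hk : k ≤ 2 ^ j) : T * ((k : ℝ) / 2 ^ j) ∈ Icc 0 T := by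
    refine ⟨by positivity, ?_⟩
    have h1 : ((k : ℕ) : ℝ) ≤ ((2 ^ j : ℕ) : ℝ) := by exact_mod_cast hk
    push_cast at h1
    have h2 : (k : ℝ) / 2 ^ j ≤ 1 := (div_le_one (by positivity)).mpr h1
    nlinarith
  let Δ : ℕ → ℕ → Ω → ℝ := fun j k ω =>
    X (T * (((k + 1 : ℕ) : ℝ) / 2 ^ j)) ω - X (T * ((k : ℝ) / 2 ^ j)) ω
  have hΔm (j k : ℕ) (hk : k < 2 ^ j) : AEMeasurable (fun ω => ‖Δ j k ω‖ₑ ^ 4) P :=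
    (((hm _ (hmem j (k + 1) hk)).sub (hm _ (hmem j k hk.le))).enorm).pow_const _
  -- the weights turn summability of `D j` into the decay `(9 / 10) ^ j` of the increments; since
  -- `(10 / 9) ^ 4 < 2`, they are beaten by the gain `2 ^ j * (2 ^ j)⁻¹ ^ 2` of the fourth moments
  let D : ℕ → Ω → ℝ≥0∞ := fun j ω =>
    ENNReal.ofReal ((10 / 9) ^ (4 * j)) * ∑ k ∈ Finset.range (2 ^ j), ‖Δ j k ω‖ₑ ^ 4
  have hDm (j : ℕ) : AEMeasurable (D j) P :=
    (Finset.aemeasurable_fun_sum _ fun k hk => hΔm j k (Finset.mem_range.mp hk)).const_mul _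
  refine ⟨fun ω => ENNReal.ofReal 10000 * ∑' j, D j ω,
    (AEMeasurable.tsum hDm).const_mul _, ?_, ?_⟩
  · filter_upwards [h0, hc] with ω hω0 hωc t ht
    by_cases htop : ∑' j, D j ω = ∞
    · rw [htop, ENNReal.mul_top (by simp)]
      exact le_top
    · set e := (∑' j, D j ω).toReal with he
      have he0 : 0 ≤ e := ENNReal.toReal_nonneg
      have hd : (e ^ (1 / 4 : ℝ)) ^ 4 = e := by
        rw [← Real.rpow_natCast, ← Real.rpow_mul he0]
        norm_num
      have := abs_le_of_dyadic_increments hωc hω0 (d := e ^ (1 / 4 : ℝ)) (by positivity)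
        (fun j k hk => by
          have h1 : ENNReal.ofReal ((10 / 9) ^ (4 * j)) * ‖Δ j k ω‖ₑ ^ 4 ≤ ENNReal.ofReal e := by
            rw [he, ENNReal.ofReal_toReal htop]
            refine le_trans ?_ (ENNReal.le_tsum j)
            simp only [D]
            gcongr
            exact Finset.single_le_sum (f := fun k => ‖Δ j k ω‖ₑ ^ 4) (fun _ _ => zero_le)
              (Finset.mem_range.mpr hk)
          rw [Real.enorm_eq_ofReal_abs, ← ENNReal.ofReal_pow (abs_nonneg _),
            ← ENNReal.ofReal_mul (by positivity), ENNReal.ofReal_le_ofReal_iff he0] at h1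
          have h2 : |Δ j k ω| ^ 4 ≤ ((9 / 10) ^ j * e ^ (1 / 4 : ℝ)) ^ 4 := by
            rw [mul_pow, hd, ← pow_mul, mul_comm j 4]
            have h3 : ((9 / 10 : ℝ) ^ (4 * j)) * (10 / 9) ^ (4 * j) = 1 := by
              rw [← mul_pow]
              norm_num
            calc |Δ j k ω| ^ 4
                = (9 / 10 : ℝ) ^ (4 * j) * ((10 / 9) ^ (4 * j) * |Δ j k ω| ^ 4) := by
                  rw [← mul_assoc, h3, one_mul]
              _ ≤ _ := by gcongr
          exact le_of_pow_le_pow_left₀ (by norm_num) (by positivity) h2) ht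
      have h4 : |X t ω| ^ 4 ≤ 10000 * e := by
        calc |X t ω| ^ 4 ≤ (10 * e ^ (1 / 4 : ℝ)) ^ 4 := by gcongr
          _ = 10000 * e := by rw [mul_pow, hd]; norm_num
      rw [Real.enorm_eq_ofReal_abs, ← ENNReal.ofReal_pow (abs_nonneg _),
        ← ENNReal.ofReal_toReal htop, ← ENNReal.ofReal_mul (by norm_num)]
      exact ENNReal.ofReal_le_ofReal h4
  · rw [lintegral_const_mul'' _ (AEMeasurable.tsum hDm), lintegral_tsum hDm]
    have hj (j : ℕ) : ∫⁻ ω, D j ω ∂P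
        ≤ ENNReal.ofReal ((5000 / 6561) ^ j) * (κ * ENNReal.ofReal (T ^ 2)) := by
      rw [lintegral_const_mul'' _ (Finset.aemeasurable_fun_sum _ fun k hk =>
        hΔm j k (Finset.mem_range.mp hk)), lintegral_finsetSum' _ fun k hk =>
          hΔm j k (Finset.mem_range.mp hk)]
      calc ENNReal.ofReal ((10 / 9) ^ (4 * j)) * ∑ k ∈ Finset.range (2 ^ j),
            ∫⁻ ω, ‖Δ j k ω‖ₑ ^ 4 ∂P
          ≤ ENNReal.ofReal ((10 / 9) ^ (4 * j)) * ∑ k ∈ Finset.range (2 ^ j),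
            κ * ENNReal.ofReal ((T / 2 ^ j) ^ 2) := by
            gcongr with k hk
            have hk := Finset.mem_range.mp hk
            have h1 := hX _ _ (hmem j k hk.le).1 (by gcongr; simp) (hmem j (k + 1) hk).2
            refine h1.trans_eq ?_
            congr 3
            push_cast
            ring
        _ = ENNReal.ofReal ((5000 / 6561) ^ j) * (κ * ENNReal.ofReal (T ^ 2)) := by
            rw [Finset.sum_const, Finset.card_range, nsmul_eq_mul,
              show ((2 ^ j : ℕ) : ℝ≥0∞) = ENNReal.ofReal (2 ^ j) by
                rw [ENNReal.ofReal_pow (by norm_num)]; simp]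
            have e1 : ((T / 2 ^ j) ^ 2 : ℝ) = (1 / 4) ^ j * T ^ 2 := by
              rw [div_pow, ← pow_mul, mul_comm j 2, pow_mul, one_div, inv_pow]
              norm_num
              ring
            have e2 : ((5000 / 6561) ^ j : ℝ) = (10 / 9) ^ (4 * j) * 2 ^ j * (1 / 4) ^ j := by
              rw [pow_mul, ← mul_pow, ← mul_pow]
              norm_num
            rw [e1, e2, ENNReal.ofReal_mul (by positivity), ENNReal.ofReal_mul (by positivity),
              ENNReal.ofReal_mul (by positivity)]
            ring
    calc ENNReal.ofReal 10000 * ∑' j, ∫⁻ ω, D j ω ∂P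
        ≤ ENNReal.ofReal 10000 * ∑' j, ENNReal.ofReal ((5000 / 6561) ^ j)
            * (κ * ENNReal.ofReal (T ^ 2)) := by
          gcongr with j
          exact hj j
      _ = ENNReal.ofReal 10000 * (ENNReal.ofReal (6561 / 1561) * (κ * ENNReal.ofReal (T ^ 2))) := by
          rw [ENNReal.tsum_mul_right, ← ENNReal.ofReal_tsum_of_nonneg (fun j => by positivity)
            (summable_geometric_of_lt_one (by norm_num) (by norm_num)),
            tsum_geometric_of_lt_one (by norm_num) (by norm_num)]
          norm_num
      _ ≤ ENNReal.ofReal 50000 * (κ * ENNReal.ofReal (T ^ 2)) := by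
          rw [← mul_assoc, ← ENNReal.ofReal_mul (by norm_num)]
          gcongr
          norm_num

/-- The constant of the second-moment maximal inequality for Wiener integrals. -/
noncomputable def maximalConst : ℝ≥0∞ :=
  ENNReal.ofReal 50000 ^ (1 / 2 : ℝ) * gaussianMoment 4 ^ 2

lemma maximalConst_ne_top : maximalConst ≠ ∞ :=
  ENNReal.mul_ne_top (ENNReal.rpow_ne_top_of_nonneg (by norm_num) ENNReal.ofReal_ne_top)
    (ENNReal.pow_ne_top (gaussianMoment_ne_top (by norm_num)))

/-- Maximal inequality for Wiener integrals, from the fourth-moment bound by the Cauchy–Schwarz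
inequality. -/
lemma IsBrownianWithVariance.exists_maximal_bound [IsProbabilityMeasure P] {T : ℝ} (hT : 0 ≤ T)
    {v : ℝ≥0} {b : ℝ → Ω → ℝ} (hb : IsBrownianWithVariance P T v b) {g g' : ℝ → ℝ}
    (hg : ∀ r, HasDerivAt g (g' r) r) (hg' : Continuous g') (hG : ∀ r, |g r| ≤ 1) :
    ∃ Z : Ω → ℝ≥0∞, AEMeasurable Z P ∧
      (∀ᵐ ω ∂P, ∀ t ∈ Icc 0 T, ‖pathIntegral g g' (fun r => b r ω) 0 t‖ₑ ^ 2 ≤ Z ω) ∧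
      ∫⁻ ω, Z ω ∂P ≤ maximalConst * ENNReal.ofReal (v * T) := by
  obtain ⟨Z, hZm, hZ, hZi⟩ := SphereWave.exists_maximal_bound (P := P) hT
    (X := fun t ω => pathIntegral g g' (fun r => b r ω) 0 t)
    (κ := ENNReal.ofReal v ^ 2 * gaussianMoment 4 ^ 4)
    (fun t ht => hb.aemeasurable_pathIntegral hg hg' le_rfl ht.1 ht.2)
    (ae_of_all _ fun ω => by simp [pathIntegral])
    (by filter_upwards [hb.continuousOn] with ω hω using continuousOn_pathIntegral hg hg' hω)
    (fun s t hs hst ht => by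
      have h1 := hb.eLpNorm_pathIntegral_le hg hg' (G := 1) (by simpa using hG) hs hst ht 4
      have h2 : ∫⁻ ω, ‖pathIntegral g g' (fun r => b r ω) 0 t
          - pathIntegral g g' (fun r => b r ω) 0 s‖ₑ ^ 4 ∂P
          = ∫⁻ ω, ‖pathIntegral g g' (fun r => b r ω) s t‖ₑ ^ 4 ∂P := by
        refine lintegral_congr_ae ?_
        filter_upwards [hb.continuousOn] with ω hω
        rw [pathIntegral_sub hg' hs hst (hω.mono (Icc_subset_Icc le_rfl ht))]
      rw [h2]
      have h3 : ∫⁻ ω, ‖pathIntegral g g' (fun r => b r ω) s t‖ₑ ^ 4 ∂P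
          = eLpNorm (fun ω => pathIntegral g g' (fun r => b r ω) s t) 4 P ^ 4 := by
        have := eLpNorm_nnreal_pow_eq_lintegral
          (f := fun ω => pathIntegral g g' (fun r => b r ω) s t) (μ := P) (p := 4) (by norm_num)
        norm_num at this
        exact_mod_cast this.symm
      rw [h3]
      calc eLpNorm (fun ω => pathIntegral g g' (fun r => b r ω) s t) 4 P ^ 4
          ≤ (ENNReal.ofReal ((1 : ℝ≥0) * Real.sqrt (v * (t - s))) * gaussianMoment 4) ^ 4 := by
            gcongr
        _ = ENNReal.ofReal v ^ 2 * gaussianMoment 4 ^ 4 * ENNReal.ofReal ((t - s) ^ 2) := by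
            have h0 : 0 ≤ t - s := sub_nonneg.mpr hst
            rw [mul_pow, ← ENNReal.ofReal_pow (by positivity), ← ENNReal.ofReal_pow (by positivity),
              NNReal.coe_one, one_mul, show (4 : ℕ) = 2 * 2 by norm_num, pow_mul (Real.sqrt _),
              Real.sq_sqrt (by positivity), mul_pow, ENNReal.ofReal_mul (by positivity)]
            ring)
  refine ⟨fun ω => Z ω ^ (1 / 2 : ℝ), hZm.pow_const _, ?_, ?_⟩
  · filter_upwards [hZ] with ω hω t ht
    have := ENNReal.rpow_le_rpow (hω t ht) (z := (1 / 2 : ℝ)) (by norm_num)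
    refine le_trans (le_of_eq ?_) this
    rw [← ENNReal.rpow_natCast, ← ENNReal.rpow_natCast, ← ENNReal.rpow_mul]
    norm_num
  · have h1 : ∫⁻ ω, Z ω ^ (1 / 2 : ℝ) ∂P ≤ (∫⁻ ω, Z ω ∂P) ^ (1 / 2 : ℝ) := by
      have := ENNReal.lintegral_mul_le_Lp_mul_Lq P (p := 2) (q := 2) (by
        rw [Real.holderConjugate_iff]; norm_num) (hZm.pow_const (1 / 2 : ℝ))
        (aemeasurable_const (b := (1 : ℝ≥0∞)))
      have e (ω : Ω) : (Z ω ^ (1 / 2 : ℝ)) ^ (2 : ℝ) = Z ω := by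
        rw [← ENNReal.rpow_mul]
        norm_num
      simp only [e] at this
      simpa using this
    refine h1.trans ((ENNReal.rpow_le_rpow hZi (by norm_num)).trans_eq ?_)
    have e : ENNReal.ofReal v ^ 2 * gaussianMoment 4 ^ 4 * ENNReal.ofReal (T ^ 2)
        = (gaussianMoment 4 ^ 2 * ENNReal.ofReal (v * T)) ^ (2 : ℝ) := by
      rw [ENNReal.ofReal_mul v.coe_nonneg, ENNReal.ofReal_pow hT,
        show (2 : ℝ) = ((2 : ℕ) : ℝ) by norm_num, ENNReal.rpow_natCast]
      ring
    rw [e, ENNReal.mul_rpow_of_nonneg _ _ (by norm_num), ← ENNReal.rpow_mul, maximalConst]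
    norm_num
    ring

/-! ### Coefficients of the noise -/

lemma IsQWiener.isBrownian {T : ℝ} {Q : L2 →L[ℝ] L2} {W : ℝ → Ω → L2} (hW : IsQWiener P T Q W)
    (f : L2) {v : ℝ≥0} (hv : inner ℝ (Q f) f = v) :
    IsBrownianWithVariance P T v (fun t ω => inner ℝ (W t ω) f) where
  aemeasurable t ht :=
    ((hW.aestronglyMeasurable t ht).inner aestronglyMeasurable_const).aemeasurable
  zero := by
    filter_upwards [hW.zero] with ω hω
    rw [hω, inner_zero_left]
  continuousOn := by
    filter_upwards [hW.continuousOn] with ω hω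
    exact hω.inner continuousOn_const
  indep := by
    intro n t ht
    have := (hW.indep n t ht).comp (fun _ x => inner ℝ x f)
      (fun _ => (by fun_prop : Continuous fun x : L2 => inner ℝ x f).measurable)
    refine this.congr fun i => ae_of_all _ fun ω => ?_
    simp [inner_sub_left]
  gaussian s t hs hst ht := by
    have := hW.gaussian s t hs hst ht f
    rw [hv, Real.toNNReal_mul (sub_nonneg.mpr hst), Real.toNNReal_coe] at this
    simpa only [inner_sub_left] using this

end

/-! ### Variation of constants for a single mode -/

lemma freq_sq (ℓ : ℕ) : freq ℓ ^ 2 = ℓ * (ℓ + 1) := Real.sq_sqrt (by positivity)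

lemma freq_pos {ℓ : ℕ} (h : ℓ ≠ 0) : 0 < freq ℓ := by
  have : 0 < ℓ := Nat.pos_of_ne_zero h
  unfold freq
  positivity

lemma hasDerivAt_R1 (ℓ : ℕ) (t : ℝ) : HasDerivAt (R1 ℓ) (R2 ℓ t) t := by
  by_cases h : ℓ = 0
  · subst h
    have : R1 0 = fun t => t := by funext t; simp [R1]
    rw [this]
    simpa [R2, freq] using hasDerivAt_id' t
  · have : R1 ℓ = fun t => (freq ℓ)⁻¹ * Real.sin (t * freq ℓ) := by funext t; simp [R1, h]
    rw [this]
    have h1 := (((hasDerivAt_id t).mul_const (freq ℓ)).sin).const_mul (freq ℓ)⁻¹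
    refine h1.congr_deriv ?_
    have := (freq_pos h).ne'
    simp only [R2, id]
    field_simp

lemma R1_of_ne_zero {ℓ : ℕ} (h : ℓ ≠ 0) (t : ℝ) : R1 ℓ t = (freq ℓ)⁻¹ * Real.sin (t * freq ℓ) := by
  simp [R1, h]

lemma hasDerivAt_R2 (ℓ : ℕ) (t : ℝ) : HasDerivAt (R2 ℓ) (-(ℓ * (ℓ + 1)) * R1 ℓ t) t := by
  have h1 := ((hasDerivAt_id t).mul_const (freq ℓ)).cos
  refine h1.congr_deriv ?_
  by_cases h : ℓ = 0
  · subst h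
    simp [freq]
  · rw [R1_of_ne_zero h, ← freq_sq]
    have := (freq_pos h).ne'
    simp only [id]
    field_simp

lemma R1_zero (ℓ : ℕ) : R1 ℓ 0 = 0 := by simp [R1]

lemma R2_zero (ℓ : ℕ) : R2 ℓ 0 = 1 := by simp [R2]

lemma continuous_R1 (ℓ : ℕ) : Continuous (R1 ℓ) :=
  continuous_iff_continuousAt.mpr fun t => (hasDerivAt_R1 ℓ t).continuousAt

lemma continuous_R2 (ℓ : ℕ) : Continuous (R2 ℓ) :=
  continuous_iff_continuousAt.mpr fun t => (hasDerivAt_R2 ℓ t).continuousAt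

/-- The pair `(x₁, x₂)` solves the mode equation `dx₁ = x₂ dt`, `dx₂ = -ℓ(ℓ+1) x₁ dt + da` on
`[0, T]` in integrated form, with initial values `c₁`, `c₂` and a continuous forcing path `a`. -/
structure IsModeSolution (ℓ : ℕ) (T : ℝ) (a : ℝ → ℂ) (c₁ c₂ : ℂ) (x₁ x₂ : ℝ → ℂ) : Prop where
  forcing_zero : a 0 = 0
  continuousOn_forcing : ContinuousOn a (Icc 0 T)
  integrable_fst : IntervalIntegrable x₁ volume 0 T
  integrable_snd : IntervalIntegrable x₂ volume 0 T
  fst_eq : ∀ t ∈ Icc 0 T, x₁ t = c₁ + ∫ s in (0 : ℝ)..t, x₂ s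
  snd_eq : ∀ t ∈ Icc 0 T, x₂ t = c₂ + (∫ s in (0 : ℝ)..t, -((ℓ : ℂ) * (ℓ + 1)) * x₁ s) + a t

lemma continuousOn_primitive_Icc {f : ℝ → ℂ} {T : ℝ} (hf : IntervalIntegrable f volume 0 T) :
    ContinuousOn (fun t => ∫ s in (0 : ℝ)..t, f s) (Icc 0 T) := by
  rcases le_or_gt 0 T with hT | hT
  · have := intervalIntegral.continuousOn_primitive_interval (μ := volume) (a := 0) (b := T)
      (f := f) (by
        rw [uIcc_of_le hT, integrableOn_Icc_iff_integrableOn_Ioc]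
        exact (intervalIntegrable_iff_integrableOn_Ioc_of_le hT).mp hf)
    rwa [uIcc_of_le hT] at this
  · rw [Icc_eq_empty hT.not_ge]
    exact continuousOn_empty _

lemma hasDerivAt_primitive_of_continuousOn {f : ℝ → ℂ} {T t : ℝ} (hf : ContinuousOn f (Icc 0 T))
    (ht : t ∈ Ioo 0 T) : HasDerivAt (fun t => ∫ s in (0 : ℝ)..t, f s) (f t) t := by
  have hsub : uIcc 0 t ⊆ Icc 0 T := by
    rw [uIcc_of_le ht.1.le]
    exact Icc_subset_Icc le_rfl ht.2.le
  refine intervalIntegral.integral_hasDerivAt_right (hf.mono hsub).intervalIntegrable ?_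
    (hf.continuousAt (Icc_mem_nhds ht.1 ht.2))
  exact (hf.mono Ioo_subset_Icc_self).stronglyMeasurableAtFilter isOpen_Ioo t ht

namespace IsModeSolution

variable {ℓ : ℕ} {T : ℝ} {a : ℝ → ℂ} {c₁ c₂ : ℂ} {x₁ x₂ : ℝ → ℂ}

lemma continuousOn_fst (h : IsModeSolution ℓ T a c₁ c₂ x₁ x₂) : ContinuousOn x₁ (Icc 0 T) :=
  (continuousOn_const.add (continuousOn_primitive_Icc h.integrable_snd)).congr h.fst_eq

lemma continuousOn_snd (h : IsModeSolution ℓ T a c₁ c₂ x₁ x₂) : ContinuousOn x₂ (Icc 0 T) :=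
  ((continuousOn_const.add (continuousOn_primitive_Icc (h.integrable_fst.const_mul _))).add
    h.continuousOn_forcing).congr h.snd_eq

lemma fst_zero (h : IsModeSolution ℓ T a c₁ c₂ x₁ x₂) (hT : 0 ≤ T) : x₁ 0 = c₁ := by
  rw [h.fst_eq 0 (left_mem_Icc.mpr hT)]
  simp

lemma snd_zero (h : IsModeSolution ℓ T a c₁ c₂ x₁ x₂) (hT : 0 ≤ T) : x₂ 0 = c₂ := by
  rw [h.snd_eq 0 (left_mem_Icc.mpr hT), h.forcing_zero]
  simp

lemma hasDerivAt_fst (h : IsModeSolution ℓ T a c₁ c₂ x₁ x₂) {t : ℝ} (ht : t ∈ Ioo 0 T) :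
    HasDerivAt x₁ (x₂ t) t := by
  have h1 := (hasDerivAt_primitive_of_continuousOn h.continuousOn_snd ht).const_add c₁
  refine h1.congr_of_eventuallyEq ?_
  filter_upwards [Ioo_mem_nhds ht.1 ht.2] with s hs using h.fst_eq s (Ioo_subset_Icc_self hs)

/-- Only the difference of the second component and the forcing is differentiable in time. -/
lemma hasDerivAt_snd_sub (h : IsModeSolution ℓ T a c₁ c₂ x₁ x₂) {t : ℝ} (ht : t ∈ Ioo 0 T) :
    HasDerivAt (fun s => x₂ s - a s) (-((ℓ : ℂ) * (ℓ + 1)) * x₁ t) t := by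
  have h1 := (hasDerivAt_primitive_of_continuousOn
    (f := fun s => -((ℓ : ℂ) * (ℓ + 1)) * x₁ s) (continuousOn_const.mul h.continuousOn_fst)
    ht).const_add c₂
  refine h1.congr_of_eventuallyEq ?_
  filter_upwards [Ioo_mem_nhds ht.1 ht.2] with s hs
  rw [h.snd_eq s (Ioo_subset_Icc_self hs)]
  ring

lemma hasDerivAt_R1_sub (ℓ : ℕ) (t s : ℝ) :
    HasDerivAt (fun s => ((R1 ℓ (t - s) : ℝ) : ℂ)) (-(R2 ℓ (t - s) : ℝ) : ℂ) s := by
  have := ((hasDerivAt_R1 ℓ (t - s)).comp_const_sub t s).ofReal_comp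
  simpa using this

lemma hasDerivAt_R2_sub (ℓ : ℕ) (t s : ℝ) :
    HasDerivAt (fun s => ((R2 ℓ (t - s) : ℝ) : ℂ)) ((ℓ : ℂ) * (ℓ + 1) * (R1 ℓ (t - s) : ℝ)) s := by
  have := ((hasDerivAt_R2 ℓ (t - s)).comp_const_sub t s).ofReal_comp
  simpa using this

lemma continuous_R1_sub (ℓ : ℕ) (t : ℝ) : Continuous fun s => ((R1 ℓ (t - s) : ℝ) : ℂ) :=
  Complex.continuous_ofReal.comp ((continuous_R1 ℓ).comp (continuous_const.sub continuous_id))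

lemma continuous_R2_sub (ℓ : ℕ) (t : ℝ) : Continuous fun s => ((R2 ℓ (t - s) : ℝ) : ℂ) :=
  Complex.continuous_ofReal.comp ((continuous_R2 ℓ).comp (continuous_const.sub continuous_id))

/-- Variation of constants for the first component. -/
lemma fst_eq_of_le (h : IsModeSolution ℓ T a c₁ c₂ x₁ x₂) {r t : ℝ} (hr : 0 ≤ r) (hrt : r ≤ t)
    (ht : t ≤ T) : x₁ t = (R2 ℓ (t - r) : ℂ) * x₁ r + (R1 ℓ (t - r) : ℂ) * x₂ r
      + wienerIntegral (fun s => R1 ℓ (t - s)) a r t := by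
  have hsub : Icc r t ⊆ Icc 0 T := Icc_subset_Icc hr ht
  have hac := h.continuousOn_forcing.mono hsub
  have hint : IntervalIntegrable (fun s => ((R2 ℓ (t - s) : ℝ) : ℂ) * a s) volume r t := by
    apply ContinuousOn.intervalIntegrable
    rw [uIcc_of_le hrt]
    exact (continuous_R2_sub ℓ t).continuousOn.mul hac
  have key := intervalIntegral.integral_eq_sub_of_hasDerivAt_of_le hrt
    (f := fun s => ((R2 ℓ (t - s) : ℝ) : ℂ) * x₁ s + ((R1 ℓ (t - s) : ℝ) : ℂ) * (x₂ s - a s))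
    (f' := fun s => ((R2 ℓ (t - s) : ℝ) : ℂ) * a s)
    (((continuous_R2_sub ℓ t).continuousOn.mul (h.continuousOn_fst.mono hsub)).add
      ((continuous_R1_sub ℓ t).continuousOn.mul ((h.continuousOn_snd.mono hsub).sub hac)))
    (fun s hs => by
      have hs' : s ∈ Ioo 0 T := ⟨hr.trans_lt hs.1, hs.2.trans_le ht⟩
      refine (((hasDerivAt_R2_sub ℓ t s).mul (h.hasDerivAt_fst hs')).add
        ((hasDerivAt_R1_sub ℓ t s).mul (h.hasDerivAt_snd_sub hs'))).congr_deriv ?_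
      ring) hint
  have hd : (fun s => ((deriv (fun s => R1 ℓ (t - s)) s : ℝ) : ℂ) * a s)
      = fun s => -(((R2 ℓ (t - s) : ℝ) : ℂ) * a s) := by
    funext s
    rw [((hasDerivAt_R1 ℓ (t - s)).comp_const_sub t s).deriv]
    push_cast
    ring
  rw [wienerIntegral, hd, intervalIntegral.integral_neg, key]
  simp only [sub_self, R1_zero, R2_zero]
  push_cast
  ring

/-- Variation of constants for the second component. -/
lemma snd_eq_of_le (h : IsModeSolution ℓ T a c₁ c₂ x₁ x₂) {r t : ℝ} (hr : 0 ≤ r) (hrt : r ≤ t)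
    (ht : t ≤ T) : x₂ t = -((ℓ : ℂ) * (ℓ + 1)) * (R1 ℓ (t - r) : ℂ) * x₁ r
      + (R2 ℓ (t - r) : ℂ) * x₂ r + wienerIntegral (fun s => R2 ℓ (t - s)) a r t := by
  have hsub : Icc r t ⊆ Icc 0 T := Icc_subset_Icc hr ht
  have hac := h.continuousOn_forcing.mono hsub
  have hint : IntervalIntegrable
      (fun s => -((ℓ : ℂ) * (ℓ + 1) * (R1 ℓ (t - s) : ℝ) * a s)) volume r t := by
    apply ContinuousOn.intervalIntegrable
    rw [uIcc_of_le hrt]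
    exact ((continuousOn_const.mul (continuous_R1_sub ℓ t).continuousOn).mul hac).neg
  have key := intervalIntegral.integral_eq_sub_of_hasDerivAt_of_le hrt
    (f := fun s => -((ℓ : ℂ) * (ℓ + 1)) * ((R1 ℓ (t - s) : ℝ) : ℂ) * x₁ s
      + ((R2 ℓ (t - s) : ℝ) : ℂ) * (x₂ s - a s))
    (f' := fun s => -((ℓ : ℂ) * (ℓ + 1) * (R1 ℓ (t - s) : ℝ) * a s))
    (((continuousOn_const.mul (continuous_R1_sub ℓ t).continuousOn).mul
      (h.continuousOn_fst.mono hsub)).add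
      ((continuous_R2_sub ℓ t).continuousOn.mul ((h.continuousOn_snd.mono hsub).sub hac)))
    (fun s hs => by
      have hs' : s ∈ Ioo 0 T := ⟨hr.trans_lt hs.1, hs.2.trans_le ht⟩
      refine ((((hasDerivAt_R1_sub ℓ t s).const_mul (-((ℓ : ℂ) * (ℓ + 1)))).mul
        (h.hasDerivAt_fst hs')).add
        ((hasDerivAt_R2_sub ℓ t s).mul (h.hasDerivAt_snd_sub hs'))).congr_deriv ?_
      ring) hint
  have hd : (fun s => ((deriv (fun s => R2 ℓ (t - s)) s : ℝ) : ℂ) * a s)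
      = fun s => -(-((ℓ : ℂ) * (ℓ + 1) * (R1 ℓ (t - s) : ℝ) * a s)) := by
    funext s
    rw [((hasDerivAt_R2 ℓ (t - s)).comp_const_sub t s).deriv]
    push_cast
    ring
  rw [wienerIntegral, hd, intervalIntegral.integral_neg, key]
  simp only [sub_self, R1_zero, R2_zero]
  push_cast
  ring

/-- The time recursion is exact on the grid. -/
lemma schemeCoeff_eq (h : IsModeSolution ℓ T a c₁ c₂ x₁ x₂) {t : ℝ} (ht : t ∈ Icc 0 T) {n : ℕ}
    {τ : ℕ → ℝ} (hτ : IsPartition τ n t) {j : ℕ} (hj : j ≤ n) :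
    schemeCoeff ℓ a τ c₁ c₂ j = (x₁ (τ j), x₂ (τ j)) := by
  obtain ⟨hτ0, hτs, hτn⟩ := hτ
  have hnonneg : ∀ j ≤ n, 0 ≤ τ j := by
    intro j
    induction j with
    | zero => intro _; exact hτ0.ge
    | succ j ih => intro hj; exact (ih (Nat.le_of_succ_le hj)).trans (hτs j hj).le
  have hle : ∀ k, ∀ j, j + k = n → τ j ≤ t := by
    intro k
    induction k with
    | zero =>
      intro j hj
      rw [← hτn, ← hj, add_zero]
    | succ k ih => intro j hj; exact (hτs j (by omega)).le.trans (ih (j + 1) (by omega))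
  induction j with
  | zero => rw [schemeCoeff, hτ0, h.fst_zero (ht.1.trans ht.2), h.snd_zero (ht.1.trans ht.2)]
  | succ j ih =>
    have h0 := hnonneg j (Nat.le_of_succ_le hj)
    have h1 := (hτs j hj).le
    have h2 := (hle (n - (j + 1)) (j + 1) (by omega)).trans ht.2
    simp only [schemeCoeff, ih (Nat.le_of_succ_le hj)]
    rw [h.fst_eq_of_le h0 h1 h2, h.snd_eq_of_le h0 h1 h2]

end IsModeSolution

/-! ### Size of a single mode -/

/-- `∫_0^t cos(λ_ℓ s) db(s)`. -/
noncomputable def cosIntegral (ℓ : ℕ) (b : ℝ → ℝ) (t : ℝ) : ℝ :=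
  pathIntegral (fun r => Real.cos (r * freq ℓ)) (fun r => -Real.sin (r * freq ℓ) * freq ℓ) b 0 t

/-- `∫_0^t sin(λ_ℓ s) db(s)`. -/
noncomputable def sinIntegral (ℓ : ℕ) (b : ℝ → ℝ) (t : ℝ) : ℝ :=
  pathIntegral (fun r => Real.sin (r * freq ℓ)) (fun r => Real.cos (r * freq ℓ) * freq ℓ) b 0 t

/-- The size of the stochastic forcing of a mode, for the real and imaginary parts `b₁`, `b₂` of
the noise path. By the addition theorems it controls the stochastic convolutions with `cos` and
`sin` simultaneously. -/
noncomputable def forcingSize (ℓ : ℕ) (b₁ b₂ : ℝ → ℝ) (t : ℝ) : ℝ :=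
  |cosIntegral ℓ b₁ t| + |cosIntegral ℓ b₂ t| + |sinIntegral ℓ b₁ t| + |sinIntegral ℓ b₂ t|

lemma hasDerivAt_cos_freq (ℓ : ℕ) (r : ℝ) : HasDerivAt (fun r => Real.cos (r * freq ℓ))
    (-Real.sin (r * freq ℓ) * freq ℓ) r := by
  simpa using ((hasDerivAt_id r).mul_const (freq ℓ)).cos

lemma hasDerivAt_sin_freq (ℓ : ℕ) (r : ℝ) : HasDerivAt (fun r => Real.sin (r * freq ℓ))
    (Real.cos (r * freq ℓ) * freq ℓ) r := by
  simpa using ((hasDerivAt_id r).mul_const (freq ℓ)).sin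

lemma intervalIntegrable_ofReal {f : ℝ → ℝ} {s t : ℝ} (h : IntervalIntegrable f volume s t) :
    IntervalIntegrable (fun r => ((f r : ℝ) : ℂ)) volume s t :=
  ⟨h.1.ofReal, h.2.ofReal⟩

/-- A function in the span of `cos(λ_ℓ r)` and `sin(λ_ℓ r)` has a Wiener integral controlled by
`forcingSize`. -/
lemma norm_wienerIntegral_le (ℓ : ℕ) {a : ℝ → ℂ} {b₁ b₂ : ℝ → ℝ} {t : ℝ} (ht : 0 ≤ t)
    (ha : ∀ r, a r = b₁ r - b₂ r * Complex.I) (hb₁ : ContinuousOn b₁ (Icc 0 t))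
    (hb₂ : ContinuousOn b₂ (Icc 0 t)) {f : ℝ → ℝ} {A B M : ℝ} (hA : |A| ≤ M) (hB : |B| ≤ M)
    (hf : ∀ r, f r = A * Real.cos (r * freq ℓ) + B * Real.sin (r * freq ℓ)) :
    ‖wienerIntegral f a 0 t‖ ≤ M * forcingSize ℓ b₁ b₂ t := by
  have hfd (r : ℝ) : deriv f r = A * (-Real.sin (r * freq ℓ) * freq ℓ)
      + B * (Real.cos (r * freq ℓ) * freq ℓ) := by
    rw [funext hf]
    exact (((hasDerivAt_cos_freq ℓ r).const_mul A).add
      ((hasDerivAt_sin_freq ℓ r).const_mul B)).deriv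
  have hi {g b : ℝ → ℝ} (hg : Continuous g) (hb : ContinuousOn b (Icc 0 t)) :
      IntervalIntegrable (fun r => g r * b r) volume 0 t := by
    apply ContinuousOn.intervalIntegrable
    rw [uIcc_of_le ht]
    exact hg.continuousOn.mul hb
  have hcs : Continuous fun r => -Real.sin (r * freq ℓ) * freq ℓ := by fun_prop
  have hcc : Continuous fun r => Real.cos (r * freq ℓ) * freq ℓ := by fun_prop
  have hI : ∫ r in (0 : ℝ)..t, ((deriv f r : ℝ) : ℂ) * a r
      = (A * ((∫ r in (0 : ℝ)..t, (-Real.sin (r * freq ℓ) * freq ℓ) * b₁ r : ℝ) : ℂ)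
        + B * ((∫ r in (0 : ℝ)..t, (Real.cos (r * freq ℓ) * freq ℓ) * b₁ r : ℝ) : ℂ))
        - (A * ((∫ r in (0 : ℝ)..t, (-Real.sin (r * freq ℓ) * freq ℓ) * b₂ r : ℝ) : ℂ)
        + B * ((∫ r in (0 : ℝ)..t, (Real.cos (r * freq ℓ) * freq ℓ) * b₂ r : ℝ) : ℂ)) * Complex.I := by
    have e (r : ℝ) : ((deriv f r : ℝ) : ℂ) * a r
        = ((A * ((-Real.sin (r * freq ℓ) * freq ℓ) * b₁ r)
          + B * ((Real.cos (r * freq ℓ) * freq ℓ) * b₁ r) : ℝ) : ℂ)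
          - ((A * ((-Real.sin (r * freq ℓ) * freq ℓ) * b₂ r)
          + B * ((Real.cos (r * freq ℓ) * freq ℓ) * b₂ r) : ℝ) : ℂ) * Complex.I := by
      rw [hfd, ha]
      push_cast
      ring
    have i1 := ((hi hcs hb₁).const_mul A).add ((hi hcc hb₁).const_mul B)
    have i2 := ((hi hcs hb₂).const_mul A).add ((hi hcc hb₂).const_mul B)
    simp_rw [e]
    rw [intervalIntegral.integral_sub (intervalIntegrable_ofReal i1)
        ((intervalIntegrable_ofReal i2).mul_const _),
      intervalIntegral.integral_mul_const, intervalIntegral.integral_ofReal,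
      intervalIntegral.integral_ofReal,
      intervalIntegral.integral_add ((hi hcs hb₁).const_mul A) ((hi hcc hb₁).const_mul B),
      intervalIntegral.integral_add ((hi hcs hb₂).const_mul A) ((hi hcc hb₂).const_mul B)]
    simp only [intervalIntegral.integral_const_mul]
    push_cast
    ring
  have key : wienerIntegral f a 0 t = ((A * cosIntegral ℓ b₁ t + B * sinIntegral ℓ b₁ t : ℝ) : ℂ)
      - ((A * cosIntegral ℓ b₂ t + B * sinIntegral ℓ b₂ t : ℝ) : ℂ) * Complex.I := by
    rw [wienerIntegral, hI, hf, hf, ha, ha, cosIntegral, sinIntegral, cosIntegral, sinIntegral]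
    simp only [pathIntegral]
    push_cast
    ring
  rw [key]
  refine (norm_sub_le _ _).trans ?_
  rw [norm_mul, Complex.norm_I, mul_one, Complex.norm_real, Complex.norm_real, Real.norm_eq_abs,
    Real.norm_eq_abs, forcingSize]
  have h1 (x y : ℝ) : |A * x + B * y| ≤ M * |x| + M * |y| := by
    refine (abs_add_le _ _).trans ?_
    rw [abs_mul, abs_mul]
    gcongr
  have := h1 (cosIntegral ℓ b₁ t) (sinIntegral ℓ b₁ t)
  have := h1 (cosIntegral ℓ b₂ t) (sinIntegral ℓ b₂ t)
  linarith

lemma abs_R1_le {ℓ : ℕ} (h : ℓ ≠ 0) (t : ℝ) : |R1 ℓ t| ≤ (freq ℓ)⁻¹ := by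
  rw [R1_of_ne_zero h, abs_mul, abs_of_pos (inv_pos.mpr (freq_pos h))]
  exact mul_le_of_le_one_right (inv_pos.mpr (freq_pos h)).le (Real.abs_sin_le_one _)

lemma abs_R2_le (ℓ : ℕ) (t : ℝ) : |R2 ℓ t| ≤ 1 := Real.abs_cos_le_one _

namespace IsModeSolution

variable {ℓ : ℕ} {T : ℝ} {a : ℝ → ℂ} {c₁ c₂ : ℂ} {x₁ x₂ : ℝ → ℂ} {b₁ b₂ : ℝ → ℝ}

lemma norm_fst_le (h : IsModeSolution ℓ T a c₁ c₂ x₁ x₂) (hℓ : ℓ ≠ 0)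
    (ha : ∀ r, a r = b₁ r - b₂ r * Complex.I) (hb₁ : ContinuousOn b₁ (Icc 0 T))
    (hb₂ : ContinuousOn b₂ (Icc 0 T)) {t : ℝ} (ht : t ∈ Icc 0 T) :
    ‖x₁ t‖ ≤ ‖c₁‖ + (freq ℓ)⁻¹ * (‖c₂‖ + forcingSize ℓ b₁ b₂ t) := by
  have hsub : Icc 0 t ⊆ Icc 0 T := Icc_subset_Icc le_rfl ht.2
  have hT : 0 ≤ T := ht.1.trans ht.2
  have hpos := inv_pos.mpr (freq_pos hℓ)
  have h1 := norm_wienerIntegral_le ℓ (f := fun r => R1 ℓ (t - r)) (M := (freq ℓ)⁻¹)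
    (A := (freq ℓ)⁻¹ * Real.sin (t * freq ℓ)) (B := -((freq ℓ)⁻¹ * Real.cos (t * freq ℓ)))
    ht.1 ha (hb₁.mono hsub) (hb₂.mono hsub)
    (by rw [abs_mul, abs_of_pos hpos]
        exact mul_le_of_le_one_right hpos.le (Real.abs_sin_le_one _))
    (by rw [abs_neg, abs_mul, abs_of_pos hpos]
        exact mul_le_of_le_one_right hpos.le (Real.abs_cos_le_one _))
    (fun r => by rw [R1_of_ne_zero hℓ, sub_mul, Real.sin_sub]; ring)
  rw [h.fst_eq_of_le le_rfl ht.1 ht.2, h.fst_zero hT, h.snd_zero hT, sub_zero]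
  refine (norm_add₃_le).trans ?_
  rw [norm_mul, norm_mul, Complex.norm_real, Complex.norm_real, Real.norm_eq_abs, Real.norm_eq_abs]
  have h2 : |R2 ℓ t| * ‖c₁‖ ≤ 1 * ‖c₁‖ := by gcongr; exact abs_R2_le ℓ t
  have h3 : |R1 ℓ t| * ‖c₂‖ ≤ (freq ℓ)⁻¹ * ‖c₂‖ := by gcongr; exact abs_R1_le hℓ t
  linarith

lemma norm_snd_le (h : IsModeSolution ℓ T a c₁ c₂ x₁ x₂) (hℓ : ℓ ≠ 0)
    (ha : ∀ r, a r = b₁ r - b₂ r * Complex.I) (hb₁ : ContinuousOn b₁ (Icc 0 T))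
    (hb₂ : ContinuousOn b₂ (Icc 0 T)) {t : ℝ} (ht : t ∈ Icc 0 T) :
    ‖x₂ t‖ ≤ freq ℓ * (‖c₁‖ + (freq ℓ)⁻¹ * (‖c₂‖ + forcingSize ℓ b₁ b₂ t)) := by
  have hsub : Icc 0 t ⊆ Icc 0 T := Icc_subset_Icc le_rfl ht.2
  have hT : 0 ≤ T := ht.1.trans ht.2
  have hpos := freq_pos hℓ
  have h1 := norm_wienerIntegral_le ℓ (f := fun r => R2 ℓ (t - r)) (M := 1)
    (A := Real.cos (t * freq ℓ)) (B := Real.sin (t * freq ℓ))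
    ht.1 ha (hb₁.mono hsub) (hb₂.mono hsub) (Real.abs_cos_le_one _) (Real.abs_sin_le_one _)
    (fun r => by rw [R2, sub_mul, Real.cos_sub])
  rw [h.snd_eq_of_le le_rfl ht.1 ht.2, h.fst_zero hT, h.snd_zero hT, sub_zero]
  refine (norm_add₃_le).trans ?_
  have e : -((ℓ : ℂ) * (ℓ + 1)) * (R1 ℓ t : ℂ) = ((-(freq ℓ ^ 2 * R1 ℓ t) : ℝ) : ℂ) := by
    rw [freq_sq]
    push_cast
    ring
  rw [e, norm_mul, norm_mul, Complex.norm_real, Complex.norm_real, Real.norm_eq_abs,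
    Real.norm_eq_abs, abs_neg, abs_mul, abs_of_pos (by positivity : 0 < freq ℓ ^ 2)]
  have h2 : |R2 ℓ t| * ‖c₂‖ ≤ 1 * ‖c₂‖ := by gcongr; exact abs_R2_le ℓ t
  have h3 : freq ℓ ^ 2 * |R1 ℓ t| * ‖c₁‖ ≤ freq ℓ * ‖c₁‖ := by
    gcongr
    calc freq ℓ ^ 2 * |R1 ℓ t| ≤ freq ℓ ^ 2 * (freq ℓ)⁻¹ := by gcongr; exact abs_R1_le hℓ t
      _ = freq ℓ := by field_simp
  have h4 : freq ℓ * (‖c₁‖ + (freq ℓ)⁻¹ * (‖c₂‖ + forcingSize ℓ b₁ b₂ t))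
      = freq ℓ * ‖c₁‖ + (‖c₂‖ + forcingSize ℓ b₁ b₂ t) := by
    field_simp
  linarith

end IsModeSolution

section

variable {Ω : Type*} [MeasurableSpace Ω] {P : Measure Ω} {T : ℝ}

/-! ### Modes of the noise and of the solution -/

lemma continuous_harmonicTest (ℓ : ℕ) (m : ℤ) (a : ℂ) : Continuous (harmonicTest ℓ m a) :=
  (harmonicTest ℓ m a).contMDiff.continuous

/-- `Re (a Y_{ℓ,m})` as an element of `L²(S²)`. -/
noncomputable def harmonicL2 (ℓ : ℕ) (m : ℤ) (a : ℂ) : L2 :=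
  testLp (harmonicTest ℓ m a) (continuous_harmonicTest ℓ m a)

lemma pairing_harmonicTest (f : L2) (ℓ : ℕ) (m : ℤ) (a : ℂ) :
    pairing f (harmonicTest ℓ m a) = inner ℝ f (harmonicL2 ℓ m a) :=
  pairing_eq_inner _ _ _

lemma norm_harmonicL2_le {ℓ : ℕ} {m : ℤ} (hm : m ∈ orders ℓ) {a : ℂ} (ha : ‖a‖ = 1) :
    ‖harmonicL2 ℓ m a‖ ^ 2 ≤ 1 := by
  have h1 := integral_conj_harmonicY_mul ℓ ℓ m m hm
  rw [if_pos ⟨rfl, rfl⟩] at h1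
  have h2 : ∫ y, ‖harmonicY ℓ m y‖ ^ 2 ∂sphMeasure = 1 := by
    have e (y : S2) : (starRingEnd ℂ) (harmonicY ℓ m y) * harmonicY ℓ m y
        = ((‖harmonicY ℓ m y‖ ^ 2 : ℝ) : ℂ) := by
      rw [← Complex.normSq_eq_conj_mul_self, Complex.normSq_eq_norm_sq]
    simp_rw [e] at h1
    rw [integral_complex_ofReal] at h1
    exact_mod_cast h1
  have h3 : ‖harmonicL2 ℓ m a‖ ^ 2 = ∫ y, (harmonicTest ℓ m a y) ^ 2 ∂sphMeasure := by
    rw [← real_inner_self_eq_norm_sq, ← pairing_harmonicTest, pairing]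
    refine integral_congr_ae ?_
    filter_upwards [coeFn_testLp _ (continuous_harmonicTest ℓ m a)] with y hy
    rw [harmonicL2, hy, sq]
  have hint {g : S2 → ℝ} (hg : Continuous g) : Integrable g sphMeasure := by
    refine Integrable.of_bound hg.aestronglyMeasurable ‖(⟨g, hg⟩ : C(S2, ℝ))‖
      (ae_of_all _ fun y => ContinuousMap.norm_coe_le_norm (⟨g, hg⟩ : C(S2, ℝ)) y)
  refine h3.trans_le (le_trans ?_ h2.le)
  refine integral_mono (hint ((continuous_harmonicTest ℓ m a).pow 2))
    (hint ((continuous_harmonicY ℓ m).norm.pow 2)) fun y => ?_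
  simp only [harmonicTest_apply]
  have h4 := Complex.abs_re_le_norm (a * harmonicY ℓ m y)
  rw [norm_mul, ha, one_mul] at h4
  rw [← sq_abs]
  gcongr

/-- The variance of the noise in the direction of the real or the imaginary part of a harmonic: for
`f` such a part, `(Q f, f)` is the corresponding part of the coefficient of `Q f`. -/
lemma HasAngularPowerSpectrum.inner_harmonicL2 {Q : L2 →L[ℝ] L2} {A : ℕ → ℝ≥0}
    (hQ : HasAngularPowerSpectrum Q A) {ℓ : ℕ} {m : ℤ} (hm : m ∈ orders ℓ) {a : ℂ}
    (ha : a = 1 ∨ a = -Complex.I) :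
    inner ℝ (Q (harmonicL2 ℓ m a)) (harmonicL2 ℓ m a)
      = ((A ℓ * ‖harmonicL2 ℓ m a‖₊ ^ 2 : ℝ≥0) : ℝ) := by
  have h := hQ (harmonicL2 ℓ m a) ℓ m hm
  rw [coeff_eq_pairing, coeff_eq_pairing] at h
  push_cast
  rw [← real_inner_self_eq_norm_sq, ← pairing_harmonicTest, ← pairing_harmonicTest]
  rcases ha with rfl | rfl
  · have := congrArg Complex.re h
    simpa using this
  · have := congrArg Complex.im h
    simpa using this

lemma IsQWiener.isBrownian_pairing {Q : L2 →L[ℝ] L2} {W : ℝ → Ω → L2} (hW : IsQWiener P T Q W)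
    {A : ℕ → ℝ≥0} (hQ : HasAngularPowerSpectrum Q A) {ℓ : ℕ} {m : ℤ} (hm : m ∈ orders ℓ) {a : ℂ}
    (ha : a = 1 ∨ a = -Complex.I) :
    IsBrownianWithVariance P T (A ℓ * ‖harmonicL2 ℓ m a‖₊ ^ 2)
      (fun t ω => pairing (W t ω) (harmonicTest ℓ m a)) := by
  simp_rw [pairing_harmonicTest]
  exact hW.isBrownian _ (hQ.inner_harmonicL2 hm ha)

lemma variance_le (A : ℕ → ℝ≥0) {ℓ : ℕ} {m : ℤ} (hm : m ∈ orders ℓ) {a : ℂ}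
    (ha : a = 1 ∨ a = -Complex.I) : A ℓ * ‖harmonicL2 ℓ m a‖₊ ^ 2 ≤ A ℓ := by
  refine mul_le_of_le_one_right zero_le ?_
  have h1 : ‖a‖ = 1 := by rcases ha with rfl | rfl <;> simp
  exact_mod_cast norm_harmonicL2_le hm h1

/-- The size of the stochastic forcing of the mode `(ℓ, m)`. -/
noncomputable def noiseSize (W : ℝ → Ω → L2) (ℓ : ℕ) (m : ℤ) (t : ℝ) (ω : Ω) : ℝ :=
  forcingSize ℓ (fun r => pairing (W r ω) (harmonicTest ℓ m 1))
    (fun r => pairing (W r ω) (harmonicTest ℓ m (-Complex.I))) t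

lemma continuous_cos_freq_deriv (ℓ : ℕ) : Continuous fun r => -Real.sin (r * freq ℓ) * freq ℓ := by
  fun_prop

lemma continuous_sin_freq_deriv (ℓ : ℕ) : Continuous fun r => Real.cos (r * freq ℓ) * freq ℓ := by
  fun_prop

section Noise

variable {Q : L2 →L[ℝ] L2} {W : ℝ → Ω → L2} {A : ℕ → ℝ≥0}

lemma aemeasurable_noiseSize (hW : IsQWiener P T Q W) (hQ : HasAngularPowerSpectrum Q A) {ℓ : ℕ}
    {m : ℤ} (hm : m ∈ orders ℓ) {t : ℝ} (ht : t ∈ Icc 0 T) :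
    AEMeasurable (noiseSize W ℓ m t) P := by
  have hb1 := hW.isBrownian_pairing hQ hm (Or.inl rfl)
  have hb2 := hW.isBrownian_pairing hQ hm (Or.inr rfl)
  have hc {v : ℝ≥0} {b : ℝ → Ω → ℝ} (hb : IsBrownianWithVariance P T v b) :=
    measurable_norm.comp_aemeasurable (hb.aemeasurable_pathIntegral (hasDerivAt_cos_freq ℓ)
      (continuous_cos_freq_deriv ℓ) le_rfl ht.1 ht.2)
  have hs {v : ℝ≥0} {b : ℝ → Ω → ℝ} (hb : IsBrownianWithVariance P T v b) :=
    measurable_norm.comp_aemeasurable (hb.aemeasurable_pathIntegral (hasDerivAt_sin_freq ℓ)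
      (continuous_sin_freq_deriv ℓ) le_rfl ht.1 ht.2)
  exact (((hc hb1).add (hc hb2)).add (hs hb1)).add (hs hb2)

lemma eLpNorm_noiseSize_le [IsProbabilityMeasure P] (hW : IsQWiener P T Q W)
    (hQ : HasAngularPowerSpectrum Q A) {ℓ : ℕ} {m : ℤ} (hm : m ∈ orders ℓ) {t : ℝ}
    (ht : t ∈ Icc 0 T) {p : ℝ≥0∞} (hp : 1 ≤ p) :
    eLpNorm (noiseSize W ℓ m t) p P
      ≤ 4 * (ENNReal.ofReal (Real.sqrt (A ℓ * T)) * gaussianMoment p) := by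
  have hb1 := hW.isBrownian_pairing hQ hm (Or.inl rfl)
  have hb2 := hW.isBrownian_pairing hQ hm (Or.inr rfl)
  have hbound {v : ℝ≥0} {b : ℝ → Ω → ℝ} (hb : IsBrownianWithVariance P T v b) (hv : v ≤ A ℓ)
      {g g' : ℝ → ℝ} (hg : ∀ r, HasDerivAt g (g' r) r) (hg' : Continuous g')
      (hG : ∀ r, |g r| ≤ 1) :
      eLpNorm (fun ω => |pathIntegral g g' (fun r => b r ω) 0 t|) p P
        ≤ ENNReal.ofReal (Real.sqrt (A ℓ * T)) * gaussianMoment p := by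
    have h1 := hb.eLpNorm_pathIntegral_le hg hg' (G := 1) (by simpa using hG) le_rfl ht.1 ht.2 p
    rw [← eLpNorm_norm] at h1
    refine h1.trans ?_
    rw [NNReal.coe_one, one_mul, sub_zero]
    gcongr
    · exact ht.1
    · exact ht.2
  have hmeas {v : ℝ≥0} {b : ℝ → Ω → ℝ} (hb : IsBrownianWithVariance P T v b)
      {g g' : ℝ → ℝ} (hg : ∀ r, HasDerivAt g (g' r) r) (hg' : Continuous g') :
      AEStronglyMeasurable (fun ω => |pathIntegral g g' (fun r => b r ω) 0 t|) P :=
    (measurable_norm.comp_aemeasurable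
      (hb.aemeasurable_pathIntegral hg hg' le_rfl ht.1 ht.2)).aestronglyMeasurable
  have v1 := variance_le A hm (Or.inl (rfl : (1 : ℂ) = 1))
  have v2 := variance_le A hm (Or.inr (rfl : -Complex.I = -Complex.I))
  have mc1 := hmeas hb1 (hasDerivAt_cos_freq ℓ) (continuous_cos_freq_deriv ℓ)
  have mc2 := hmeas hb2 (hasDerivAt_cos_freq ℓ) (continuous_cos_freq_deriv ℓ)
  have ms1 := hmeas hb1 (hasDerivAt_sin_freq ℓ) (continuous_sin_freq_deriv ℓ)
  have ms2 := hmeas hb2 (hasDerivAt_sin_freq ℓ) (continuous_sin_freq_deriv ℓ)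
  have ec1 := hbound hb1 v1 (hasDerivAt_cos_freq ℓ) (continuous_cos_freq_deriv ℓ)
    fun r => Real.abs_cos_le_one _
  have ec2 := hbound hb2 v2 (hasDerivAt_cos_freq ℓ) (continuous_cos_freq_deriv ℓ)
    fun r => Real.abs_cos_le_one _
  have es1 := hbound hb1 v1 (hasDerivAt_sin_freq ℓ) (continuous_sin_freq_deriv ℓ)
    fun r => Real.abs_sin_le_one _
  have es2 := hbound hb2 v2 (hasDerivAt_sin_freq ℓ) (continuous_sin_freq_deriv ℓ)
    fun r => Real.abs_sin_le_one _
  calc eLpNorm (noiseSize W ℓ m t) p P ≤ _ := eLpNorm_add_le ((mc1.add mc2).add ms1) ms2 hp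
    _ ≤ _ := add_le_add_left (eLpNorm_add_le (mc1.add mc2) ms1 hp) _
    _ ≤ _ := add_le_add_left (add_le_add_left (eLpNorm_add_le mc1 mc2 hp) _) _
    _ ≤ _ := add_le_add (add_le_add (add_le_add ec1 ec2) es1) es2
    _ = _ := by ring

/-- The forcing of a mode has a square integrable bound uniform in time. -/
lemma exists_noiseSize_bound [IsProbabilityMeasure P] (hT : 0 ≤ T) (hW : IsQWiener P T Q W)
    (hQ : HasAngularPowerSpectrum Q A) {ℓ : ℕ} {m : ℤ} (hm : m ∈ orders ℓ) :
    ∃ Z : Ω → ℝ≥0∞, AEMeasurable Z P ∧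
      (∀ᵐ ω ∂P, ∀ t ∈ Icc 0 T, ‖noiseSize W ℓ m t ω‖ₑ ^ 2 ≤ Z ω) ∧
      ∫⁻ ω, Z ω ∂P ≤ 16 * (maximalConst * ENNReal.ofReal (A ℓ * T)) := by
  have v1 := variance_le A hm (Or.inl (rfl : (1 : ℂ) = 1))
  have v2 := variance_le A hm (Or.inr (rfl : -Complex.I = -Complex.I))
  have hb1 := hW.isBrownian_pairing hQ hm (Or.inl rfl)
  have hb2 := hW.isBrownian_pairing hQ hm (Or.inr rfl)
  obtain ⟨Z1, m1, s1, i1⟩ := hb1.exists_maximal_bound hT (hasDerivAt_cos_freq ℓ)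
    (continuous_cos_freq_deriv ℓ) fun r => Real.abs_cos_le_one _
  obtain ⟨Z2, m2, s2, i2⟩ := hb2.exists_maximal_bound hT (hasDerivAt_cos_freq ℓ)
    (continuous_cos_freq_deriv ℓ) fun r => Real.abs_cos_le_one _
  obtain ⟨Z3, m3, s3, i3⟩ := hb1.exists_maximal_bound hT (hasDerivAt_sin_freq ℓ)
    (continuous_sin_freq_deriv ℓ) fun r => Real.abs_sin_le_one _
  obtain ⟨Z4, m4, s4, i4⟩ := hb2.exists_maximal_bound hT (hasDerivAt_sin_freq ℓ)
    (continuous_sin_freq_deriv ℓ) fun r => Real.abs_sin_le_one _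
  refine ⟨fun ω => 4 * (Z1 ω + Z2 ω + Z3 ω + Z4 ω), (((m1.add m2).add m3).add m4).const_mul _, ?_, ?_⟩
  · filter_upwards [s1, s2, s3, s4] with ω h1 h2 h3 h4 t ht
    -- the square of a sum of four terms is at most four times the sum of the squares
    have h5 (x y z w : ℝ) : ‖|x| + |y| + |z| + |w|‖ₑ ^ 2
        ≤ 4 * (‖x‖ₑ ^ 2 + ‖y‖ₑ ^ 2 + ‖z‖ₑ ^ 2 + ‖w‖ₑ ^ 2) := by
      rw [Real.enorm_eq_ofReal (by positivity), Real.enorm_eq_ofReal_abs, Real.enorm_eq_ofReal_abs,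
        Real.enorm_eq_ofReal_abs, Real.enorm_eq_ofReal_abs, ← ENNReal.ofReal_pow (by positivity),
        ← ENNReal.ofReal_pow (by positivity), ← ENNReal.ofReal_pow (by positivity),
        ← ENNReal.ofReal_pow (by positivity), ← ENNReal.ofReal_pow (by positivity),
        ← ENNReal.ofReal_add (by positivity) (by positivity),
        ← ENNReal.ofReal_add (by positivity) (by positivity),
        ← ENNReal.ofReal_add (by positivity) (by positivity),
        show (4 : ℝ≥0∞) = ENNReal.ofReal 4 by simp, ← ENNReal.ofReal_mul (by norm_num)]
      apply ENNReal.ofReal_le_ofReal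
      nlinarith [sq_nonneg (|x| - |y|), sq_nonneg (|x| - |z|), sq_nonneg (|x| - |w|),
        sq_nonneg (|y| - |z|), sq_nonneg (|y| - |w|), sq_nonneg (|z| - |w|)]
    refine (h5 _ _ _ _).trans ?_
    gcongr
    · exact h1 t ht
    · exact h2 t ht
    · exact h3 t ht
    · exact h4 t ht
  · have e := lintegral_const_mul'' (4 : ℝ≥0∞) (((m1.add m2).add m3).add m4)
    simp only [Pi.add_apply] at e
    rw [e, lintegral_add_right' _ m4, lintegral_add_right' _ m3, lintegral_add_right' _ m2]
    have hmono {v : ℝ≥0} (hv : v ≤ A ℓ) {Z : Ω → ℝ≥0∞}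
        (hZ : ∫⁻ ω, Z ω ∂P ≤ maximalConst * ENNReal.ofReal (v * T)) :
        ∫⁻ ω, Z ω ∂P ≤ maximalConst * ENNReal.ofReal (A ℓ * T) := by
      refine hZ.trans ?_
      gcongr
    calc 4 * (∫⁻ ω, Z1 ω ∂P + ∫⁻ ω, Z2 ω ∂P + ∫⁻ ω, Z3 ω ∂P + ∫⁻ ω, Z4 ω ∂P)
        ≤ 4 * (maximalConst * ENNReal.ofReal (A ℓ * T) + maximalConst * ENNReal.ofReal (A ℓ * T)
          + maximalConst * ENNReal.ofReal (A ℓ * T) + maximalConst * ENNReal.ofReal (A ℓ * T)) := by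
          gcongr 4 * (?_ + ?_ + ?_ + ?_)
          · exact hmono v1 i1
          · exact hmono v2 i2
          · exact hmono v1 i3
          · exact hmono v2 i4
      _ = 16 * (maximalConst * ENNReal.ofReal (A ℓ * T)) := by ring

end Noise

/-- The coefficient `(u, Y_{ℓ,m})` of a generalized function. -/
noncomputable def genCoeff (u : GenFunction) (ℓ : ℕ) (m : ℤ) : ℂ :=
  (u (harmonicTest ℓ m 1) : ℂ) - u (harmonicTest ℓ m (-Complex.I)) * Complex.I

lemma coeff_zero (ℓ : ℕ) (m : ℤ) : coeff 0 ℓ m = 0 := by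
  rw [coeff_eq_pairing, pairing_harmonicTest, pairing_harmonicTest]
  simp

lemma continuousOn_pairing {w : ℝ → L2} {s : Set ℝ} (hw : ContinuousOn w s) {φ : S2 → ℝ}
    (hφ : Continuous φ) : ContinuousOn (fun t => pairing (w t) φ) s := by
  simp_rw [pairing_eq_inner _ _ hφ]
  exact hw.inner continuousOn_const

/-- Almost surely, all coefficients of the solution solve the mode equations. -/
lemma ae_isModeSolution {Q : L2 →L[ℝ] L2} {W : ℝ → Ω → L2} {v₁ v₂ : L2} {u₁ : ℝ → Ω → L2}
    {u₂ : ℝ → Ω → GenFunction} (hT : 0 ≤ T) (hW : IsQWiener P T Q W)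
    (hu : IsSolution P T W v₁ v₂ u₁ u₂) :
    ∀ᵐ ω ∂P, ∀ (ℓ : ℕ) (m : ℤ), IsModeSolution ℓ T (fun t => coeff (W t ω) ℓ m)
      (coeff v₁ ℓ m) (coeff v₂ ℓ m) (fun t => coeff (u₁ t ω) ℓ m)
      (fun t => genCoeff (u₂ t ω) ℓ m) := by
  rw [ae_all_iff]
  intro ℓ
  rw [ae_all_iff]
  intro m
  filter_upwards [hW.zero, hW.continuousOn, hu.integrable_velocity (harmonicTest ℓ m 1),
    hu.integrable_velocity (harmonicTest ℓ m (-Complex.I)), hu.position (harmonicTest ℓ m 1),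
    hu.position (harmonicTest ℓ m (-Complex.I)), hu.velocity (harmonicTest ℓ m 1),
    hu.velocity (harmonicTest ℓ m (-Complex.I))] with ω hW0 hWc i1 i2 p1 p2 w1 w2
  have hsub {t : ℝ} (ht : t ∈ Icc 0 T) : uIcc 0 t ⊆ uIcc 0 T := by
    rw [uIcc_of_le ht.1, uIcc_of_le hT]
    exact Icc_subset_Icc le_rfl ht.2
  have hI : IntervalIntegrable (fun s => genCoeff (u₂ s ω) ℓ m) volume 0 T :=
    (intervalIntegrable_ofReal i1).sub ((intervalIntegrable_ofReal i2).mul_const _)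
  have hfst : ∀ t ∈ Icc 0 T, coeff (u₁ t ω) ℓ m
      = coeff v₁ ℓ m + ∫ s in (0 : ℝ)..t, genCoeff (u₂ s ω) ℓ m := by
    intro t ht
    unfold genCoeff
    rw [coeff_eq_pairing, coeff_eq_pairing, p1 t ht, p2 t ht, intervalIntegral.integral_sub
      (intervalIntegrable_ofReal (i1.mono_set (hsub ht)))
      ((intervalIntegrable_ofReal (i2.mono_set (hsub ht))).mul_const _),
      intervalIntegral.integral_mul_const, intervalIntegral.integral_ofReal,
      intervalIntegral.integral_ofReal]
    push_cast
    ring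
  have hpc {a : ℂ} (i : IntervalIntegrable (fun s => u₂ s ω (harmonicTest ℓ m a)) volume 0 T)
      (p : ∀ t ∈ Icc 0 T, pairing (u₁ t ω) (harmonicTest ℓ m a)
        = pairing v₁ (harmonicTest ℓ m a) + ∫ s in (0 : ℝ)..t, u₂ s ω (harmonicTest ℓ m a)) :
      ContinuousOn (fun t => pairing (u₁ t ω) (harmonicTest ℓ m a)) (Icc 0 T) := by
    have := intervalIntegral.continuousOn_primitive_interval (μ := volume) (a := 0) (b := T)
      (f := fun s => u₂ s ω (harmonicTest ℓ m a)) (by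
        rw [uIcc_of_le hT, integrableOn_Icc_iff_integrableOn_Ioc]
        exact (intervalIntegrable_iff_integrableOn_Ioc_of_le hT).mp i)
    rw [uIcc_of_le hT] at this
    exact (continuousOn_const.add this).congr p
  have hpi {a : ℂ} (h : ContinuousOn (fun t => pairing (u₁ t ω) (harmonicTest ℓ m a)) (Icc 0 T))
      {t : ℝ} (ht : t ∈ Icc 0 T) :
      IntervalIntegrable (fun t => pairing (u₁ t ω) (harmonicTest ℓ m a)) volume 0 t := by
    apply ContinuousOn.intervalIntegrable
    refine h.mono ?_
    rw [← uIcc_of_le hT]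
    exact hsub ht
  have c1 := hpc i1 p1
  have c2 := hpc i2 p2
  refine ⟨?_, ?_, ?_, hI, hfst, ?_⟩
  · rw [hW0, coeff_zero]
  · simp_rw [coeff_eq_pairing]
    exact (Complex.continuous_ofReal.comp_continuousOn
      (continuousOn_pairing hWc (continuous_harmonicTest ℓ m 1))).sub
      ((Complex.continuous_ofReal.comp_continuousOn
      (continuousOn_pairing hWc (continuous_harmonicTest ℓ m _))).mul continuousOn_const)
  · simp_rw [coeff_eq_pairing]
    exact (intervalIntegrable_ofReal (hpi c1 (right_mem_Icc.mpr hT))).sub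
      ((intervalIntegrable_ofReal (hpi c2 (right_mem_Icc.mpr hT))).mul_const _)
  · intro t ht
    have hL (a : ℂ) : ∫ s in (0 : ℝ)..t, pairing (u₁ s ω) (sphLaplacian (harmonicTest ℓ m a))
        = -(ℓ * (ℓ + 1)) * ∫ s in (0 : ℝ)..t, pairing (u₁ s ω) (harmonicTest ℓ m a) := by
      rw [← intervalIntegral.integral_const_mul]
      simp_rw [pairing_sphLaplacian]
    have hX : ∫ s in (0 : ℝ)..t, coeff (u₁ s ω) ℓ m
        = ((∫ s in (0 : ℝ)..t, pairing (u₁ s ω) (harmonicTest ℓ m 1) : ℝ) : ℂ)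
        - ((∫ s in (0 : ℝ)..t, pairing (u₁ s ω) (harmonicTest ℓ m (-Complex.I)) : ℝ) : ℂ)
          * Complex.I := by
      simp_rw [coeff_eq_pairing]
      rw [intervalIntegral.integral_sub (intervalIntegrable_ofReal (hpi c1 ht))
        ((intervalIntegrable_ofReal (hpi c2 ht)).mul_const _),
        intervalIntegral.integral_mul_const, intervalIntegral.integral_ofReal,
        intervalIntegral.integral_ofReal]
    rw [intervalIntegral.integral_const_mul, hX, genCoeff, w1 t ht, w2 t ht, hL, hL,
      coeff_eq_pairing, coeff_eq_pairing]
    push_cast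
    ring

end

section

variable {Ω : Type*} [MeasurableSpace Ω] {P : Measure Ω}

/-! ### Minkowski's inequality for square functions -/

/-- Countable subadditivity of the `Lʳ` norm for nonnegative functions. -/
lemma eLpNorm_tsum_le {f : ℕ → Ω → ℝ≥0∞} (hf : ∀ n, AEMeasurable (f n) P) {r : ℝ≥0∞} (hr : 1 ≤ r)
    (hr' : r ≠ ∞) : eLpNorm (fun ω => ∑' n, f n ω) r P ≤ ∑' n, eLpNorm (f n) r P := by
  have hr0 : r ≠ 0 := (zero_lt_one.trans_le hr).ne'
  have hrr : 0 < r.toReal := ENNReal.toReal_pos hr0 hr'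
  rw [eLpNorm_eq_lintegral_rpow_enorm_toReal hr0 hr', one_div, ENNReal.rpow_inv_le_iff hrr]
  have hlim (ω : Ω) : Tendsto (fun N => (∑ n ∈ Finset.range N, f n ω) ^ r.toReal) atTop
      (nhds (‖∑' n, f n ω‖ₑ ^ r.toReal)) := by
    rw [enorm_eq_self]
    exact (ENNReal.continuous_rpow_const.tendsto _).comp (ENNReal.tendsto_nat_tsum _)
  calc ∫⁻ ω, ‖∑' n, f n ω‖ₑ ^ r.toReal ∂P
      = ∫⁻ ω, liminf (fun N => (∑ n ∈ Finset.range N, f n ω) ^ r.toReal) atTop ∂P := by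
        congr 1
        funext ω
        exact (hlim ω).liminf_eq.symm
    _ ≤ liminf (fun N => ∫⁻ ω, (∑ n ∈ Finset.range N, f n ω) ^ r.toReal ∂P) atTop :=
        lintegral_liminf_le' fun N =>
          (Finset.aemeasurable_fun_sum _ fun n _ => hf n).pow_const _
    _ ≤ (∑' n, eLpNorm (f n) r P) ^ r.toReal := by
        refine liminf_le_of_le (by isBoundedDefault) fun b hb => ?_
        obtain ⟨N, hN⟩ := hb.exists
        refine hN.trans ?_
        have h1 : eLpNorm (∑ n ∈ Finset.range N, f n) r P ≤ ∑' n, eLpNorm (f n) r P :=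
          (eLpNorm_sum_le (fun n _ => (hf n).aestronglyMeasurable) hr).trans
            (ENNReal.sum_le_tsum _)
        rw [eLpNorm_eq_lintegral_rpow_enorm_toReal hr0 hr', one_div,
          ENNReal.rpow_inv_le_iff hrr] at h1
        simpa using h1

lemma eLpNorm_rpow_half (g : Ω → ℝ≥0∞) {r : ℝ≥0∞} (hr : r ≠ 0) (hr' : r ≠ ∞) :
    eLpNorm (fun ω => g ω ^ (1 / 2 : ℝ)) (2 * r) P = eLpNorm g r P ^ (1 / 2 : ℝ) := by
  rw [eLpNorm_eq_lintegral_rpow_enorm_toReal (by simp [hr]) (ENNReal.mul_ne_top (by simp) hr'),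
    eLpNorm_eq_lintegral_rpow_enorm_toReal hr hr', ← ENNReal.rpow_mul]
  congr 1
  · congr 1
    funext ω
    rw [enorm_eq_self, enorm_eq_self, ← ENNReal.rpow_mul]
    congr 1
    rw [ENNReal.toReal_mul]
    simp
  · rw [ENNReal.toReal_mul]
    simp

lemma eLpNorm_const_mul {c : ℝ≥0∞} (hc : c ≠ ∞) (g : Ω → ℝ≥0∞) {r : ℝ≥0∞} (hr : r ≠ 0)
    (hr' : r ≠ ∞) : eLpNorm (fun ω => c * g ω) r P = c * eLpNorm g r P := by
  have hrr : 0 < r.toReal := ENNReal.toReal_pos hr hr'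
  rw [eLpNorm_eq_lintegral_rpow_enorm_toReal hr hr', eLpNorm_eq_lintegral_rpow_enorm_toReal hr hr']
  simp only [enorm_eq_self, ENNReal.mul_rpow_of_nonneg _ _ hrr.le]
  rw [lintegral_const_mul' _ _ (ENNReal.rpow_ne_top_of_nonneg hrr.le hc),
    ENNReal.mul_rpow_of_nonneg _ _ (by positivity), ← ENNReal.rpow_mul, mul_one_div_cancel hrr.ne',
    ENNReal.rpow_one]

lemma eLpNorm_enorm_sq (g : Ω → ℝ) {r : ℝ≥0∞} (hr : r ≠ 0) (hr' : r ≠ ∞) :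
    eLpNorm (fun ω => ‖g ω‖ₑ ^ 2) r P = eLpNorm g (2 * r) P ^ 2 := by
  have h := eLpNorm_rpow_half (P := P) (fun ω => ‖g ω‖ₑ ^ 2) hr hr'
  have e (x : ℝ≥0∞) : (x ^ 2) ^ (1 / 2 : ℝ) = x := by
    rw [← ENNReal.rpow_natCast, ← ENNReal.rpow_mul]
    norm_num
  have e2 (x : ℝ≥0∞) : (x ^ (1 / 2 : ℝ)) ^ 2 = x := by
    rw [← ENNReal.rpow_natCast, ← ENNReal.rpow_mul]
    norm_num
  simp only [e] at h
  rw [← e2 (eLpNorm _ r P), ← h]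
  rw [eLpNorm_enorm]

/-- Minkowski's inequality for weighted square functions. -/
lemma eLpNorm_sqrt_tsum_le {c : ℕ → ℝ≥0∞} (hc : ∀ n, c n ≠ ∞) {I : ℕ → Finset ℤ}
    {X : ℕ → ℤ → Ω → ℝ}
    (hX : ∀ n, ∀ m ∈ I n, AEMeasurable (X n m) P) {q : ℝ≥0∞} (hq : 2 ≤ q) (hq' : q ≠ ∞) :
    eLpNorm (fun ω => (∑' n, ∑ m ∈ I n, c n * ‖X n m ω‖ₑ ^ 2) ^ (1 / 2 : ℝ)) q P
      ≤ (∑' n, ∑ m ∈ I n, c n * eLpNorm (X n m) q P ^ 2) ^ (1 / 2 : ℝ) := by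
  obtain ⟨r, rfl⟩ : ∃ r, q = 2 * r := ⟨q / 2, by
    rw [ENNReal.mul_div_cancel (by simp) (by simp)]⟩
  have hr : 1 ≤ r := by
    rw [← ENNReal.mul_le_mul_iff_right (a := 2) (by simp) (by simp), mul_one]
    exact hq
  have hr0 : r ≠ 0 := (zero_lt_one.trans_le hr).ne'
  have hr' : r ≠ ∞ := by
    rintro rfl
    simp at hq'
  have hm (n : ℕ) (m : ℤ) (h : m ∈ I n) : AEMeasurable (fun ω => c n * ‖X n m ω‖ₑ ^ 2) P :=
    ((hX n m h).enorm.pow_const _).const_mul _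
  rw [eLpNorm_rpow_half _ hr0 hr']
  gcongr
  refine (eLpNorm_tsum_le (fun n => Finset.aemeasurable_fun_sum _ fun m h => hm n m h)
    hr hr').trans ?_
  gcongr with n
  have h1 : eLpNorm (∑ m ∈ I n, fun ω => c n * ‖X n m ω‖ₑ ^ 2) r P
      ≤ ∑ m ∈ I n, eLpNorm (fun ω => c n * ‖X n m ω‖ₑ ^ 2) r P :=
    eLpNorm_sum_le (fun m h => (hm n m h).aestronglyMeasurable) hr
  have e : (∑ m ∈ I n, fun ω => c n * ‖X n m ω‖ₑ ^ 2)
      = fun ω => ∑ m ∈ I n, c n * ‖X n m ω‖ₑ ^ 2 := by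
    funext ω
    simp
  rw [e] at h1
  refine h1.trans ?_
  gcongr with m _
  have h2 := eLpNorm_const_mul (P := P) (hc n) (fun ω => ‖X n m ω‖ₑ ^ 2) hr0 hr'
  rw [eLpNorm_enorm_sq (X n m) hr0 hr'] at h2
  exact h2.le

/-! ### Tails of series -/

lemma tsum_ite_lt (κ : ℕ) (f : ℕ → ℝ≥0∞) :
    (∑' ℓ, if κ < ℓ then f ℓ else 0) = ∑' j, f (j + (κ + 1)) := by
  rw [← Summable.sum_add_tsum_nat_add' (f := fun ℓ => if κ < ℓ then f ℓ else 0) (k := κ + 1)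
    ENNReal.summable]
  rw [Finset.sum_eq_zero fun ℓ hℓ => if_neg (by have := Finset.mem_range.mp hℓ; omega), zero_add]
  congr 1
  funext j
  rw [if_pos (by omega)]

/-- A lower bound for the increments of `x ↦ -x^{-s}`, with which the tails of `∑ ℓ^{-1-s}`
telescope. -/
lemma rpow_sub_rpow_ge {s x : ℝ} (hs : 0 < s) (hx : 1 ≤ x) :
    s * (x + 1) ^ (-1 - s) ≤ x ^ (-s) - (x + 1) ^ (-s) := by
  have hx0 : 0 < x := by linarith
  have hx1 : 0 < x + 1 := by linarith
  have h1 : 1 + s / (x + 1) ≤ ((x + 1) / x) ^ s := by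
    rw [Real.rpow_def_of_pos (by positivity)]
    -- `log (1 + 1/x) ≥ 1/(x+1)`
    have h2 := Real.one_sub_inv_le_log_of_pos (show 0 < (x + 1) / x by positivity)
    have h3 : 1 - ((x + 1) / x)⁻¹ = 1 / (x + 1) := by
      field_simp
      ring
    rw [h3] at h2
    have h4 := Real.add_one_le_exp (Real.log ((x + 1) / x) * s)
    have h5 : 1 / (x + 1) * s ≤ Real.log ((x + 1) / x) * s := by gcongr
    have h6 : s / (x + 1) = 1 / (x + 1) * s := by ring
    linarith
  have h2 : x ^ (-s) = (x + 1) ^ (-s) * ((x + 1) / x) ^ s := by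
    rw [Real.div_rpow hx1.le hx0.le, Real.rpow_neg hx1.le, Real.rpow_neg hx0.le]
    have := (Real.rpow_pos_of_pos hx1 s).ne'
    field_simp
  have h3 : (x + 1) ^ (-1 - s) = (x + 1) ^ (-s) / (x + 1) := by
    rw [show -1 - s = -s - 1 by ring, Real.rpow_sub hx1, Real.rpow_one]
  have h4 := mul_le_mul_of_nonneg_left h1 (Real.rpow_nonneg hx1.le (-s))
  rw [h2, h3]
  have h5 : s * ((x + 1) ^ (-s) / (x + 1)) = (x + 1) ^ (-s) * (s / (x + 1)) := by ring
  linarith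

/-- `∑_{ℓ > κ} ℓ^{-1-s} ≤ κ^{-s} / s`. -/
lemma tsum_tail_rpow_le {s : ℝ} (hs : 0 < s) {κ : ℕ} (hκ : 1 ≤ κ) :
    ∑' j : ℕ, ENNReal.ofReal (((j + (κ + 1) : ℕ) : ℝ) ^ (-1 - s))
      ≤ ENNReal.ofReal ((κ : ℝ) ^ (-s) / s) := by
  have hκ' : (1 : ℝ) ≤ κ := by exact_mod_cast hκ
  have hfin (n : ℕ) : ∑ j ∈ Finset.range n, ((j + (κ + 1) : ℕ) : ℝ) ^ (-1 - s)
      ≤ ((κ : ℝ) ^ (-s) - ((n + κ : ℕ) : ℝ) ^ (-s)) / s := by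
    induction n with
    | zero => simp
    | succ n ih =>
      rw [Finset.sum_range_succ]
      have h1 := rpow_sub_rpow_ge hs (x := ((n + κ : ℕ) : ℝ)) (by
        have : (1 : ℕ) ≤ n + κ := by omega
        exact_mod_cast this)
      have h2 : ((n + κ : ℕ) : ℝ) + 1 = ((n + (κ + 1) : ℕ) : ℝ) := by push_cast; ring
      rw [h2] at h1
      have h3 : ((n + 1 + κ : ℕ) : ℝ) = ((n + (κ + 1) : ℕ) : ℝ) := by push_cast; ring
      rw [h3]
      rw [le_div_iff₀ hs] at ih ⊢
      linarith
  refine ENNReal.tsum_le_of_sum_range_le fun n => ?_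
  rw [← ENNReal.ofReal_sum_of_nonneg fun _ _ => by positivity]
  apply ENNReal.ofReal_le_ofReal
  refine (hfin n).trans ?_
  gcongr
  have : (0 : ℝ) ≤ ((n + κ : ℕ) : ℝ) ^ (-s) := by positivity
  linarith

lemma tsum_tail_rpow_ne_top {s : ℝ} (hs : 0 < s) (κ : ℕ) :
    ∑' j : ℕ, ENNReal.ofReal (((j + (κ + 1) : ℕ) : ℝ) ^ (-1 - s)) ≠ ∞ := by
  have h1 : Summable fun n : ℕ => (n : ℝ) ^ (-1 - s) := Real.summable_nat_rpow.mpr (by linarith)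
  exact (h1.comp_injective (add_left_injective (κ + 1))).tsum_ofReal_ne_top

lemma sobolevTerm_nonneg (s : ℝ) (f : L2) (ℓ : ℕ) : 0 ≤ sobolevTerm s f ℓ := by
  unfold sobolevTerm
  positivity

lemma sobolevNorm_sq (s : ℝ) (f : L2) : sobolevNorm s f ^ 2 = ∑' ℓ, sobolevTerm s f ℓ :=
  Real.sq_sqrt (tsum_nonneg fun ℓ => sobolevTerm_nonneg s f ℓ)

/-- The tail of the expansion of a Sobolev function. -/
lemma tsum_tail_sobolev_le {s : ℝ} {f : L2} (hf : MemSobolev s f) {κ : ℕ} {w : ℕ → ℝ} {B : ℝ}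
    (hB : 0 ≤ B) (hw : ∀ ℓ, κ < ℓ → w ℓ ≤ B * (1 + (ℓ : ℝ) * (ℓ + 1)) ^ s) :
    ∑' j : ℕ, ENNReal.ofReal (w (j + (κ + 1)))
        * ∑ m ∈ orders (j + (κ + 1)), ‖coeff f (j + (κ + 1)) m‖ₑ ^ 2
      ≤ ENNReal.ofReal (B * sobolevNorm s f ^ 2) := by
  rw [sobolevNorm_sq, ← tsum_mul_left, ENNReal.ofReal_tsum_of_nonneg
    (fun ℓ => mul_nonneg hB (sobolevTerm_nonneg s f ℓ)) (hf.mul_left B)]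
  refine le_trans (ENNReal.tsum_le_tsum fun j => ?_)
    (ENNReal.tsum_comp_le_tsum_of_injective (add_left_injective (κ + 1)) _)
  have e : ∑ m ∈ orders (j + (κ + 1)), ‖coeff f (j + (κ + 1)) m‖ₑ ^ 2
      = ENNReal.ofReal (∑ m ∈ orders (j + (κ + 1)), ‖coeff f (j + (κ + 1)) m‖ ^ 2) := by
    rw [ENNReal.ofReal_sum_of_nonneg fun _ _ => sq_nonneg _]
    refine Finset.sum_congr rfl fun m _ => ?_
    rw [ENNReal.ofReal_pow (norm_nonneg _), ofReal_norm]
  rw [e, ← ENNReal.ofReal_mul' (Finset.sum_nonneg fun _ _ => sq_nonneg _)]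
  apply ENNReal.ofReal_le_ofReal
  rw [sobolevTerm, ← mul_assoc]
  exact mul_le_mul_of_nonneg_right (hw _ (by omega)) (Finset.sum_nonneg fun _ _ => sq_nonneg _)

/-! ### Weights of the position (`e = 0`) and of the velocity (`e = 1`) -/

/-- The factor with which the squared size of the stochastic forcing enters the squared modes of
the position (`e = 0`) and of the velocity (`e = 1`). -/
noncomputable def modeWeight (e ℓ : ℕ) : ℝ := (freq ℓ ^ e * (freq ℓ)⁻¹) ^ 2

lemma modeWeight_nonneg (e ℓ : ℕ) : 0 ≤ modeWeight e ℓ := sq_nonneg _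

lemma modeWeight_zero {ℓ : ℕ} : modeWeight 0 ℓ = ((ℓ : ℝ) * (ℓ + 1))⁻¹ := by
  rw [modeWeight, pow_zero, one_mul, inv_pow, freq_sq]

lemma modeWeight_one {ℓ : ℕ} (h : ℓ ≠ 0) : modeWeight 1 ℓ = 1 := by
  rw [modeWeight, pow_one, mul_inv_cancel₀ (freq_pos h).ne', one_pow]

lemma card_orders (ℓ : ℕ) : (orders ℓ).card = 2 * ℓ + 1 := by
  rw [orders, Int.card_Icc]
  omega

/-- Summed over the orders, the weights of degree `ℓ` are of the size `ℓ^{2e-1}`. -/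
lemma card_mul_modeWeight_le {e ℓ : ℕ} (he : e ≤ 1) (h : ℓ ≠ 0) :
    ((orders ℓ).card : ℝ) * modeWeight e ℓ ≤ 3 * (ℓ : ℝ) ^ (2 * (e : ℝ) - 1) := by
  have h1 : (1 : ℝ) ≤ ℓ := by exact_mod_cast Nat.one_le_iff_ne_zero.mpr h
  rw [card_orders]
  push_cast
  interval_cases e
  · rw [modeWeight_zero, Nat.cast_zero, mul_zero, zero_sub, Real.rpow_neg_one, mul_inv,
      mul_left_comm, mul_comm, mul_comm (3 : ℝ)]
    rw [mul_comm]
    have h0 : (0 : ℝ) < ℓ := by linarith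
    gcongr
    rw [← div_eq_mul_inv, div_le_iff₀ (by positivity)]
    linarith
  · rw [modeWeight_one h]
    norm_num
    linarith

lemma sq_le_one_add {ℓ κ : ℕ} (h : κ < ℓ) : (κ : ℝ) ^ 2 ≤ 1 + (ℓ : ℝ) * (ℓ + 1) := by
  have : (κ : ℝ) ≤ ℓ := by exact_mod_cast h.le
  nlinarith [(Nat.cast_nonneg κ : (0 : ℝ) ≤ κ)]

lemma rpow_le_of_sq_le {κ : ℕ} (hκ : 1 ≤ κ) {x r : ℝ} (hx : (κ : ℝ) ^ 2 ≤ x) (hr : 0 ≤ r) :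
    x ^ (-r) ≤ ((κ : ℝ) ^ (-r)) ^ 2 := by
  have h0 : (0 : ℝ) < κ := by exact_mod_cast hκ
  rw [← Real.rpow_natCast, ← Real.rpow_mul h0.le, mul_comm, Real.rpow_mul h0.le,
    Real.rpow_natCast]
  exact Real.rpow_le_rpow_of_nonpos (by positivity) hx (by linarith)

/-- Decay gained from the Sobolev regularity of the initial position. -/
lemma freq_pow_sq_le {e ℓ κ : ℕ} {β : ℝ} (hβ : (e : ℝ) ≤ β) (hκ : 1 ≤ κ) (h : κ < ℓ) :
    (freq ℓ ^ e) ^ 2 ≤ ((κ : ℝ) ^ (-(β - e))) ^ 2 * (1 + (ℓ : ℝ) * (ℓ + 1)) ^ β := by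
  have hx : (0 : ℝ) < 1 + (ℓ : ℝ) * (ℓ + 1) := by positivity
  rw [← pow_mul, mul_comm, pow_mul, freq_sq]
  calc ((ℓ : ℝ) * (ℓ + 1)) ^ e ≤ (1 + (ℓ : ℝ) * (ℓ + 1)) ^ e := by
        gcongr
        linarith
    _ = (1 + (ℓ : ℝ) * (ℓ + 1)) ^ (-(β - e)) * (1 + (ℓ : ℝ) * (ℓ + 1)) ^ β := by
        rw [← Real.rpow_add hx, ← Real.rpow_natCast]
        congr 1
        ring
    _ ≤ _ := by
        gcongr
        exact rpow_le_of_sq_le hκ (sq_le_one_add h) (by linarith)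

/-- Decay gained from the Sobolev regularity of the initial velocity; the factor `2` accounts for
`1 + ℓ(ℓ+1) ≤ 4 ℓ(ℓ+1)`. -/
lemma modeWeight_le {e ℓ κ : ℕ} (he : e ≤ 1) {γ : ℝ} (hγ : (e : ℝ) ≤ γ + 1) (hκ : 1 ≤ κ)
    (h : κ < ℓ) : modeWeight e ℓ
      ≤ (2 * (κ : ℝ) ^ (-(γ + 1 - e))) ^ 2 * (1 + (ℓ : ℝ) * (ℓ + 1)) ^ γ := by
  have hx : (0 : ℝ) < 1 + (ℓ : ℝ) * (ℓ + 1) := by positivity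
  have h1 : (1 : ℝ) ≤ ℓ := by exact_mod_cast (by omega : 1 ≤ ℓ)
  have h2 : modeWeight e ℓ ≤ 2 ^ 2 * (1 + (ℓ : ℝ) * (ℓ + 1)) ^ ((e : ℝ) - 1) := by
    interval_cases e
    · rw [modeWeight_zero, Nat.cast_zero, zero_sub, Real.rpow_neg_one, inv_eq_one_div,
        ← div_eq_mul_inv, div_le_div_iff₀ (by positivity) hx]
      nlinarith
    · rw [modeWeight_one (by omega)]
      norm_num
  refine h2.trans ?_
  rw [mul_pow, mul_assoc]
  gcongr
  calc (1 + (ℓ : ℝ) * (ℓ + 1)) ^ ((e : ℝ) - 1)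
      = (1 + (ℓ : ℝ) * (ℓ + 1)) ^ (-(γ + 1 - e)) * (1 + (ℓ : ℝ) * (ℓ + 1)) ^ γ := by
        rw [← Real.rpow_add hx]
        congr 1
        ring
    _ ≤ _ := by
        gcongr
        exact rpow_le_of_sq_le hκ (sq_le_one_add h) (by linarith)

end

section

variable {Ω : Type*} [MeasurableSpace Ω] {P : Measure Ω} {T : ℝ}

/-! ### Truncation errors -/

/-- The contribution of the noise to the squared truncation error at degree `κ`, where `N ℓ m` is
the size of the forcing of the mode `(ℓ, m)`. -/
noncomputable def noiseTail (e : ℕ) (N : ℕ → ℤ → ℝ) (κ : ℕ) : ℝ≥0∞ :=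
  ∑' j : ℕ, ∑ m ∈ orders (j + (κ + 1)),
    ENNReal.ofReal (modeWeight e (j + (κ + 1))) * ‖N (j + (κ + 1)) m‖ₑ ^ 2

/-- The size allowed for the modes of the position (`e = 0`) and of the velocity (`e = 1`) when the
modes of the initial values are those of `v₁` and `v₂` and those of the forcing have size `N`. -/
def ModeBound (e : ℕ) (v₁ v₂ : L2) (N : ℕ → ℤ → ℝ) (y : ℕ → ℤ → ℂ) : Prop :=
  ∀ ℓ ≠ 0, ∀ m ∈ orders ℓ, ‖y ℓ m‖
    ≤ freq ℓ ^ e * (‖coeff v₁ ℓ m‖ + (freq ℓ)⁻¹ * (‖coeff v₂ ℓ m‖ + N ℓ m))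

lemma freq_nonneg (ℓ : ℕ) : 0 ≤ freq ℓ := Real.sqrt_nonneg _

lemma ModeBound.enorm_sq_le {e : ℕ} {v₁ v₂ : L2} {N : ℕ → ℤ → ℝ} {y : ℕ → ℤ → ℂ}
    (h : ModeBound e v₁ v₂ N y) {ℓ : ℕ} (hℓ : ℓ ≠ 0) {m : ℤ} (hm : m ∈ orders ℓ) :
    ‖y ℓ m‖ₑ ^ 2 ≤ 3 * (ENNReal.ofReal ((freq ℓ ^ e) ^ 2) * ‖coeff v₁ ℓ m‖ₑ ^ 2
      + ENNReal.ofReal (modeWeight e ℓ) * ‖coeff v₂ ℓ m‖ₑ ^ 2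
      + ENNReal.ofReal (modeWeight e ℓ) * ‖N ℓ m‖ₑ ^ 2) := by
  have hf := freq_nonneg ℓ
  have h1 : ‖y ℓ m‖ ≤ freq ℓ ^ e * ‖coeff v₁ ℓ m‖ + freq ℓ ^ e * (freq ℓ)⁻¹ * ‖coeff v₂ ℓ m‖
      + freq ℓ ^ e * (freq ℓ)⁻¹ * ‖N ℓ m‖ := by
    refine (h ℓ hℓ m hm).trans ?_
    have : freq ℓ ^ e * (freq ℓ)⁻¹ * N ℓ m ≤ freq ℓ ^ e * (freq ℓ)⁻¹ * ‖N ℓ m‖ := by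
      gcongr
      exact Real.le_norm_self _
    linarith
  have h2 : ‖y ℓ m‖ ^ 2 ≤ 3 * ((freq ℓ ^ e) ^ 2 * ‖coeff v₁ ℓ m‖ ^ 2
      + modeWeight e ℓ * ‖coeff v₂ ℓ m‖ ^ 2 + modeWeight e ℓ * ‖N ℓ m‖ ^ 2) := by
    refine (pow_le_pow_left₀ (norm_nonneg _) h1 2).trans ?_
    rw [modeWeight, ← mul_pow, ← mul_pow, ← mul_pow]
    generalize freq ℓ ^ e * ‖coeff v₁ ℓ m‖ = a
    generalize freq ℓ ^ e * (freq ℓ)⁻¹ * ‖coeff v₂ ℓ m‖ = b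
    generalize freq ℓ ^ e * (freq ℓ)⁻¹ * ‖N ℓ m‖ = c
    nlinarith [sq_nonneg (a - b), sq_nonneg (a - c), sq_nonneg (b - c)]
  have hw := modeWeight_nonneg e ℓ
  have e3 : (3 : ℝ≥0∞) = ENNReal.ofReal 3 := by simp
  simp only [← ofReal_norm]
  rw [← ENNReal.ofReal_pow (norm_nonneg _), ← ENNReal.ofReal_pow (norm_nonneg _),
    ← ENNReal.ofReal_pow (norm_nonneg _), ← ENNReal.ofReal_pow (norm_nonneg _),
    ← ENNReal.ofReal_mul (by positivity), ← ENNReal.ofReal_mul hw, ← ENNReal.ofReal_mul hw,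
    ← ENNReal.ofReal_add (by positivity) (by positivity),
    ← ENNReal.ofReal_add (by positivity) (by positivity), e3, ← ENNReal.ofReal_mul (by norm_num)]
  exact ENNReal.ofReal_le_ofReal h2

lemma sqrt_three_mul_le (a b S : ℝ≥0∞) :
    (3 * (a ^ 2 + b ^ 2 + S)) ^ (1 / 2 : ℝ) ≤ 2 * (a + b + S ^ (1 / 2 : ℝ)) := by
  have e (x : ℝ≥0∞) : (x ^ 2) ^ (1 / 2 : ℝ) = x := by
    rw [← ENNReal.rpow_natCast, ← ENNReal.rpow_mul]
    norm_num
  have e2 : (S ^ (1 / 2 : ℝ)) ^ 2 = S := by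
    rw [← ENNReal.rpow_natCast, ← ENNReal.rpow_mul]
    norm_num
  rw [← e (2 * _)]
  gcongr
  nth_rewrite 1 [← e2]
  rw [mul_pow]
  have h3 : (3 : ℝ≥0∞) ≤ 2 ^ 2 := by norm_num
  refine mul_le_mul' h3 ?_
  generalize S ^ (1 / 2 : ℝ) = c
  have : (a + b + c) ^ 2 = a ^ 2 + b ^ 2 + c ^ 2 + 2 * (a * b + a * c + b * c) := by ring
  rw [this]
  exact le_self_add

section Deterministic

variable {e : ℕ} {β γ : ℝ} {v₁ v₂ : L2} {N : ℕ → ℤ → ℝ}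

/-- The deterministic part of the bound for the truncation error at degree `κ`. -/
noncomputable def initialError (e : ℕ) (β γ : ℝ) (v₁ v₂ : L2) (κ : ℕ) : ℝ :=
  (κ : ℝ) ^ (-(β - e)) * sobolevNorm β v₁ + 2 * ((κ : ℝ) ^ (-(γ + 1 - e)) * sobolevNorm γ v₂)

lemma sobolevNorm_nonneg (s : ℝ) (f : L2) : 0 ≤ sobolevNorm s f := Real.sqrt_nonneg _

/-- The truncation error is controlled by the tails of the initial values and of the noise. -/
lemma tsum_tail_modes_le (he : e ≤ 1) (hβ : (e : ℝ) ≤ β) (hγ : (e : ℝ) ≤ γ + 1)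
    (h₁ : MemSobolev β v₁) (h₂ : MemSobolev γ v₂) {y : ℕ → ℤ → ℂ} (hy : ModeBound e v₁ v₂ N y)
    {κ : ℕ} (hκ : 1 ≤ κ) :
    (∑' j : ℕ, ∑ m ∈ orders (j + (κ + 1)), ‖y (j + (κ + 1)) m‖ₑ ^ 2) ^ (1 / 2 : ℝ)
      ≤ 2 * (ENNReal.ofReal (initialError e β γ v₁ v₂ κ) + noiseTail e N κ ^ (1 / 2 : ℝ)) := by
  have t1 := tsum_tail_sobolev_le h₁ (κ := κ) (w := fun ℓ => (freq ℓ ^ e) ^ 2)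
    (B := ((κ : ℝ) ^ (-(β - e))) ^ 2) (sq_nonneg _) fun ℓ h => freq_pow_sq_le hβ hκ h
  have t2 := tsum_tail_sobolev_le h₂ (κ := κ) (w := modeWeight e)
    (B := (2 * (κ : ℝ) ^ (-(γ + 1 - e))) ^ 2) (sq_nonneg _) fun ℓ h => modeWeight_le he hγ hκ h
  have n1 := sobolevNorm_nonneg β v₁
  have n2 := sobolevNorm_nonneg γ v₂
  rw [← mul_pow, ENNReal.ofReal_pow (by positivity)] at t1 t2
  rw [initialError, ENNReal.ofReal_add (by positivity) (by positivity), ← mul_assoc 2]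
  refine le_trans ?_ (sqrt_three_mul_le _ _ _)
  gcongr
  calc ∑' j : ℕ, ∑ m ∈ orders (j + (κ + 1)), ‖y (j + (κ + 1)) m‖ₑ ^ 2
      ≤ ∑' j : ℕ, 3 * (ENNReal.ofReal ((freq (j + (κ + 1)) ^ e) ^ 2)
          * ∑ m ∈ orders (j + (κ + 1)), ‖coeff v₁ (j + (κ + 1)) m‖ₑ ^ 2
        + ENNReal.ofReal (modeWeight e (j + (κ + 1)))
          * ∑ m ∈ orders (j + (κ + 1)), ‖coeff v₂ (j + (κ + 1)) m‖ₑ ^ 2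
        + ∑ m ∈ orders (j + (κ + 1)),
          ENNReal.ofReal (modeWeight e (j + (κ + 1))) * ‖N (j + (κ + 1)) m‖ₑ ^ 2) := by
        gcongr with j
        rw [Finset.mul_sum, Finset.mul_sum, ← Finset.sum_add_distrib, ← Finset.sum_add_distrib,
          Finset.mul_sum]
        exact Finset.sum_le_sum fun m hm => hy.enorm_sq_le (by omega) hm
    _ = 3 * (_ + _ + noiseTail e N κ) := by
        rw [ENNReal.tsum_mul_left, ENNReal.tsum_add, ENNReal.tsum_add, noiseTail]
    _ ≤ _ := by gcongr

lemma errorL2_le (he : e ≤ 1) (hβ : (e : ℝ) ≤ β) (hγ : (e : ℝ) ≤ γ + 1)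
    (h₁ : MemSobolev β v₁) (h₂ : MemSobolev γ v₂) {U : L2} (hU : ModeBound e v₁ v₂ N (coeff U))
    {κ : ℕ} (hκ : 1 ≤ κ) {g : S2 → ℂ}
    (hg : ∀ y, g y = ∑ ℓ ∈ Finset.range (κ + 1), ∑ m ∈ orders ℓ, coeff U ℓ m * harmonicY ℓ m y) :
    errorL2 U g
      ≤ 2 * (ENNReal.ofReal (initialError e β γ v₁ v₂ κ) + noiseTail e N κ ^ (1 / 2 : ℝ)) := by
  have h := errorL2_sq U κ g hg
  rw [tsum_ite_lt κ fun ℓ => ∑ m ∈ orders ℓ, ‖coeff U ℓ m‖ₑ ^ 2] at h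
  have h2 := tsum_tail_modes_le he hβ hγ h₁ h₂ hU hκ
  rw [← h, ← ENNReal.rpow_natCast, ← ENNReal.rpow_mul] at h2
  norm_num at h2 ⊢
  exact h2

/-- Any rate below the rates of the three contributions is eventually attained. -/
lemma eventually_bound_le_rpow {δ d : ℝ} (hβ : δ < β) (hγ : δ < γ + 1) (hd : δ - e < d) (v₁ v₂ : L2)
    {R : ℝ≥0∞} (hR : R ≠ ∞) :
    ∀ᶠ κ : ℕ in atTop, 2 * (ENNReal.ofReal (initialError e β γ v₁ v₂ κ)
      + (ENNReal.ofReal ((κ : ℝ) ^ (-(2 * d))) * R) ^ (1 / 2 : ℝ))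
        ≤ ENNReal.ofReal ((κ : ℝ) ^ (-(δ - e))) := by
  lift R to ℝ≥0 using hR
  have hlim {r : ℝ} (hr : δ - e < r) :
      Tendsto (fun κ : ℕ => (κ : ℝ) ^ (-(r - (δ - e)))) atTop (nhds 0) :=
    (tendsto_rpow_neg_atTop (by linarith)).comp tendsto_natCast_atTop_atTop
  have h := ((((hlim (r := β - e) (by linarith)).mul_const (sobolevNorm β v₁)).add
    (((hlim (r := γ + 1 - e) (by linarith)).mul_const (sobolevNorm γ v₂)).const_mul 2)).add
    ((hlim hd).mul_const (Real.sqrt R))).const_mul 2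
  simp only [zero_mul, mul_zero, add_zero] at h
  filter_upwards [h.eventually_le_const (zero_lt_one (α := ℝ)), eventually_ge_atTop 1] with κ h1 hκ
  have hκ0 : (0 : ℝ) < κ := by exact_mod_cast hκ
  have n1 := sobolevNorm_nonneg β v₁
  have n2 := sobolevNorm_nonneg γ v₂
  have e1 : (ENNReal.ofReal ((κ : ℝ) ^ (-(2 * d))) * R) ^ (1 / 2 : ℝ)
      = ENNReal.ofReal ((κ : ℝ) ^ (-d) * Real.sqrt R) := by
    rw [← ENNReal.ofReal_coe_nnreal, ← ENNReal.ofReal_mul (by positivity),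
      ENNReal.ofReal_rpow_of_nonneg (by positivity) (by norm_num),
      Real.mul_rpow (by positivity) (by positivity), ← Real.rpow_mul hκ0.le, Real.sqrt_eq_rpow]
    congr 3
    ring
  have h0 : 0 ≤ initialError e β γ v₁ v₂ κ := by
    unfold initialError
    positivity
  rw [e1, ← ENNReal.ofReal_add h0 (by positivity), show (2 : ℝ≥0∞) = ENNReal.ofReal 2 by simp,
    ← ENNReal.ofReal_mul (by norm_num)]
  apply ENNReal.ofReal_le_ofReal
  have hsplit (r : ℝ) : (κ : ℝ) ^ (-r) = (κ : ℝ) ^ (-(δ - e)) * (κ : ℝ) ^ (-(r - (δ - e))) := by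
    rw [← Real.rpow_add hκ0]
    congr 1
    ring
  rw [initialError, hsplit (β - e), hsplit (γ + 1 - e), hsplit d]
  have h2 := mul_le_mul_of_nonneg_left h1 (Real.rpow_nonneg hκ0.le (-(δ - e)))
  rw [mul_one] at h2
  refine le_trans (le_of_eq ?_) h2
  ring

end Deterministic

/-! ### Moments and paths of the noise -/

lemma aemeasurable_noiseTail {Q : L2 →L[ℝ] L2} {W : ℝ → Ω → L2} {A : ℕ → ℝ≥0}
    (hW : IsQWiener P T Q W) (hQ : HasAngularPowerSpectrum Q A) (e κ : ℕ)
    {t : ℝ} (ht : t ∈ Icc 0 T) :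
    AEMeasurable (fun ω => noiseTail e (fun ℓ m => noiseSize W ℓ m t ω) κ) P :=
  AEMeasurable.tsum fun _ => Finset.aemeasurable_fun_sum _ fun _ hm =>
    ((aemeasurable_noiseSize hW hQ hm ht).enorm.pow_const _).const_mul _

section Noise

variable [IsProbabilityMeasure P] {Q : L2 →L[ℝ] L2} {W : ℝ → Ω → L2} {A : ℕ → ℝ≥0} {C α : ℝ}
  {ℓ₀ e : ℕ}

/-- The constant in the bound for the moments of the noise. -/
noncomputable def noiseConst (C T α : ℝ) (e : ℕ) (q : ℝ≥0∞) : ℝ≥0∞ :=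
  (16 * gaussianMoment q ^ 2 * ENNReal.ofReal (3 * C * T / (α - 2 * e))) ^ (1 / 2 : ℝ)

lemma noiseConst_ne_top {q : ℝ≥0∞} (hq : q ≠ ∞) : noiseConst C T α e q ≠ ∞ :=
  ENNReal.rpow_ne_top_of_nonneg (by norm_num)
    (ENNReal.mul_ne_top (ENNReal.mul_ne_top (by simp) (ENNReal.pow_ne_top (gaussianMoment_ne_top hq)))
      ENNReal.ofReal_ne_top)

lemma card_mul_modeWeight_mul_le (hT : 0 ≤ T) (he : e ≤ 1)
    (hA : ∀ ℓ > ℓ₀, (A ℓ : ℝ) ≤ C * (ℓ : ℝ) ^ (-α)) {ℓ : ℕ} (hℓ : ℓ₀ < ℓ) :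
    ((orders ℓ).card : ℝ) * modeWeight e ℓ * (A ℓ * T)
      ≤ 3 * C * T * (ℓ : ℝ) ^ (-1 - (α - 2 * e)) := by
  have h0 : (0 : ℝ) < ℓ := by exact_mod_cast (by omega : 0 < ℓ)
  calc ((orders ℓ).card : ℝ) * modeWeight e ℓ * (A ℓ * T)
      ≤ 3 * (ℓ : ℝ) ^ (2 * (e : ℝ) - 1) * (C * (ℓ : ℝ) ^ (-α) * T) := by
        have h1 := card_mul_modeWeight_le he (ℓ := ℓ) (by omega)
        have h2 := hA ℓ hℓ
        have h3 := modeWeight_nonneg e ℓ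
        exact mul_le_mul h1 (mul_le_mul_of_nonneg_right h2 hT) (by positivity) (by positivity)
    _ = 3 * C * T * ((ℓ : ℝ) ^ (2 * (e : ℝ) - 1) * (ℓ : ℝ) ^ (-α)) := by ring
    _ = _ := by
        rw [← Real.rpow_add h0]
        congr 2
        ring

/-- The moments of the contribution of the noise decay like `κ^{-(α/2-e)}`. -/
lemma eLpNorm_noiseTail_le (hC : 0 ≤ C) (hT : 0 ≤ T) (he : e ≤ 1) (hα : 2 * (e : ℝ) < α)
    (hA : ∀ ℓ > ℓ₀, (A ℓ : ℝ) ≤ C * (ℓ : ℝ) ^ (-α)) (hQ : HasAngularPowerSpectrum Q A)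
    (hW : IsQWiener P T Q W) {q : ℝ≥0∞} (hq : 2 ≤ q) (hq' : q ≠ ∞) {κ : ℕ} (hκ : ℓ₀ < κ)
    {t : ℝ} (ht : t ∈ Icc 0 T) :
    eLpNorm (fun ω => noiseTail e (fun ℓ m => noiseSize W ℓ m t ω) κ ^ (1 / 2 : ℝ)) q P
      ≤ noiseConst C T α e q * ENNReal.ofReal ((κ : ℝ) ^ (-(α / 2 - e))) := by
  have hκ0 : (0 : ℝ) ≤ κ := Nat.cast_nonneg κ
  have hs : 0 < α - 2 * e := by linarith
  refine (eLpNorm_sqrt_tsum_le (P := P) (I := fun j => orders (j + (κ + 1)))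
    (c := fun j => ENNReal.ofReal (modeWeight e (j + (κ + 1))))
    (X := fun j m ω => noiseSize W (j + (κ + 1)) m t ω) (fun _ => ENNReal.ofReal_ne_top)
    (fun j m hm => aemeasurable_noiseSize hW hQ hm ht) hq hq').trans ?_
  have hrate : ENNReal.ofReal ((κ : ℝ) ^ (-(α / 2 - e)))
      = ENNReal.ofReal ((κ : ℝ) ^ (-(α - 2 * e))) ^ (1 / 2 : ℝ) := by
    rw [ENNReal.ofReal_rpow_of_nonneg (by positivity) (by norm_num), ← Real.rpow_mul hκ0]
    congr 2
    ring
  rw [noiseConst, hrate, ← ENNReal.mul_rpow_of_nonneg _ _ (by norm_num)]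
  gcongr
  calc ∑' j : ℕ, ∑ m ∈ orders (j + (κ + 1)), ENNReal.ofReal (modeWeight e (j + (κ + 1)))
        * eLpNorm (fun ω => noiseSize W (j + (κ + 1)) m t ω) q P ^ 2
      ≤ ∑' j : ℕ, 16 * gaussianMoment q ^ 2 * ENNReal.ofReal (3 * C * T)
          * ENNReal.ofReal (((j + (κ + 1) : ℕ) : ℝ) ^ (-1 - (α - 2 * e))) := by
        refine ENNReal.tsum_le_tsum fun j => ?_
        have h1 : ∀ m ∈ orders (j + (κ + 1)), ENNReal.ofReal (modeWeight e (j + (κ + 1)))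
            * eLpNorm (fun ω => noiseSize W (j + (κ + 1)) m t ω) q P ^ 2
            ≤ ENNReal.ofReal (modeWeight e (j + (κ + 1))) * (4 * (ENNReal.ofReal
              (Real.sqrt (A (j + (κ + 1)) * T)) * gaussianMoment q)) ^ 2 := by
          intro m hm
          gcongr
          exact eLpNorm_noiseSize_le hW hQ hm ht (one_le_two.trans hq)
        refine (Finset.sum_le_sum h1).trans ?_
        rw [Finset.sum_const, nsmul_eq_mul, mul_pow, mul_pow, ← ENNReal.ofReal_pow (by positivity),
          Real.sq_sqrt (by positivity)]
        have hw := modeWeight_nonneg e (j + (κ + 1))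
        have h2 : ((orders (j + (κ + 1))).card : ℝ≥0∞)
            * ENNReal.ofReal (modeWeight e (j + (κ + 1))) * ENNReal.ofReal (A (j + (κ + 1)) * T)
            ≤ ENNReal.ofReal (3 * C * T)
              * ENNReal.ofReal (((j + (κ + 1) : ℕ) : ℝ) ^ (-1 - (α - 2 * e))) := by
          rw [← ENNReal.ofReal_natCast, ← ENNReal.ofReal_mul (by positivity),
            ← ENNReal.ofReal_mul (by positivity), ← ENNReal.ofReal_mul (by positivity)]
          exact ENNReal.ofReal_le_ofReal
            (card_mul_modeWeight_mul_le hT he hA (show ℓ₀ < j + (κ + 1) by omega))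
        calc _ = 16 * gaussianMoment q ^ 2 * (((orders (j + (κ + 1))).card : ℝ≥0∞)
              * ENNReal.ofReal (modeWeight e (j + (κ + 1)))
              * ENNReal.ofReal (A (j + (κ + 1)) * T)) := by ring
          _ ≤ _ := by
            rw [mul_assoc (16 * _)]
            exact mul_le_mul_right h2 _
    _ ≤ 16 * gaussianMoment q ^ 2 * ENNReal.ofReal (3 * C * T)
          * ENNReal.ofReal ((κ : ℝ) ^ (-(α - 2 * e)) / (α - 2 * e)) := by
        rw [ENNReal.tsum_mul_left]
        gcongr
        exact tsum_tail_rpow_le hs (by omega)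
    _ = _ := by
        rw [mul_assoc, mul_assoc (16 * _), ← ENNReal.ofReal_mul (by positivity),
          ← ENNReal.ofReal_mul (by positivity)]
        congr 2
        ring

/-- Almost surely, the modes of the noise have an envelope that does not depend on time and decays
at any rate below that of the angular power spectrum: the expectation of the weighted sum of the
squared maximal functions is finite. -/
lemma ae_exists_noise_envelope (hC : 0 ≤ C) (hT : 0 ≤ T) (he : e ≤ 1) {d : ℝ}
    (hα : 2 * d + 2 * e < α)
    (hA : ∀ ℓ > ℓ₀, (A ℓ : ℝ) ≤ C * (ℓ : ℝ) ^ (-α)) (hQ : HasAngularPowerSpectrum Q A)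
    (hW : IsQWiener P T Q W) :
    ∀ᵐ ω ∂P, ∃ Z : ℕ → ℤ → ℝ≥0∞,
      (∀ ℓ, ∀ m ∈ orders ℓ, ∀ t ∈ Icc 0 T, ‖noiseSize W ℓ m t ω‖ₑ ^ 2 ≤ Z ℓ m) ∧
      ∑' j : ℕ, ∑ m ∈ orders (j + (ℓ₀ + 1)), ENNReal.ofReal (((j + (ℓ₀ + 1) : ℕ) : ℝ) ^ (2 * d)
        * modeWeight e (j + (ℓ₀ + 1))) * Z (j + (ℓ₀ + 1)) m ≠ ∞ := by
  have h (ℓ : ℕ) (m : ℤ) : ∃ Z : Ω → ℝ≥0∞, m ∈ orders ℓ → AEMeasurable Z P ∧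
      (∀ᵐ ω ∂P, ∀ t ∈ Icc 0 T, ‖noiseSize W ℓ m t ω‖ₑ ^ 2 ≤ Z ω) ∧
      ∫⁻ ω, Z ω ∂P ≤ 16 * (maximalConst * ENNReal.ofReal (A ℓ * T)) := by
    by_cases hm : m ∈ orders ℓ
    · obtain ⟨Z, hZ⟩ := exists_noiseSize_bound hT hW hQ hm
      exact ⟨Z, fun _ => hZ⟩
    · exact ⟨0, fun h => absurd h hm⟩
  choose Z hZ using h
  have hs : 0 < α - 2 * e - 2 * d := by linarith
  have hmeas (j : ℕ) (m : ℤ) (hm : m ∈ orders (j + (ℓ₀ + 1))) :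
      AEMeasurable (fun ω => ENNReal.ofReal (((j + (ℓ₀ + 1) : ℕ) : ℝ) ^ (2 * d)
        * modeWeight e (j + (ℓ₀ + 1))) * Z (j + (ℓ₀ + 1)) m ω) P :=
    (hZ _ _ hm).1.const_mul _
  have hmeas' (j : ℕ) : AEMeasurable (fun ω => ∑ m ∈ orders (j + (ℓ₀ + 1)),
      ENNReal.ofReal (((j + (ℓ₀ + 1) : ℕ) : ℝ) ^ (2 * d)
        * modeWeight e (j + (ℓ₀ + 1))) * Z (j + (ℓ₀ + 1)) m ω) P :=
    Finset.aemeasurable_fun_sum _ fun m hm => hmeas j m hm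
  have hfin : ∫⁻ ω, ∑' j : ℕ, ∑ m ∈ orders (j + (ℓ₀ + 1)),
      ENNReal.ofReal (((j + (ℓ₀ + 1) : ℕ) : ℝ) ^ (2 * d)
        * modeWeight e (j + (ℓ₀ + 1))) * Z (j + (ℓ₀ + 1)) m ω ∂P ≠ ∞ := by
    rw [lintegral_tsum hmeas']
    refine ne_top_of_le_ne_top (ENNReal.mul_ne_top (ENNReal.mul_ne_top
      (by simp : (16 : ℝ≥0∞) ≠ ∞) (ENNReal.mul_ne_top maximalConst_ne_top
        (ENNReal.ofReal_ne_top (r := 3 * C * T)))) (tsum_tail_rpow_ne_top hs ℓ₀)) ?_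
    rw [← ENNReal.tsum_mul_left]
    refine ENNReal.tsum_le_tsum fun j => ?_
    rw [lintegral_finsetSum' _ (hmeas j)]
    have hx : (0 : ℝ) < ((j + (ℓ₀ + 1) : ℕ) : ℝ) := by positivity
    have hw := modeWeight_nonneg e (j + (ℓ₀ + 1))
    have h1 : ∀ m ∈ orders (j + (ℓ₀ + 1)),
        ∫⁻ ω, ENNReal.ofReal (((j + (ℓ₀ + 1) : ℕ) : ℝ) ^ (2 * d)
          * modeWeight e (j + (ℓ₀ + 1))) * Z (j + (ℓ₀ + 1)) m ω ∂P
        ≤ ENNReal.ofReal (((j + (ℓ₀ + 1) : ℕ) : ℝ) ^ (2 * d) * modeWeight e (j + (ℓ₀ + 1)))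
          * (16 * (maximalConst * ENNReal.ofReal (A (j + (ℓ₀ + 1)) * T))) := by
      intro m hm
      rw [lintegral_const_mul'' _ (hZ _ _ hm).1]
      gcongr
      exact (hZ _ _ hm).2.2
    refine (Finset.sum_le_sum h1).trans ?_
    rw [Finset.sum_const, nsmul_eq_mul]
    have h2 := ENNReal.ofReal_le_ofReal (mul_le_mul_of_nonneg_left
      (card_mul_modeWeight_mul_le (e := e) hT he hA (show ℓ₀ < j + (ℓ₀ + 1) by omega))
      (Real.rpow_nonneg hx.le (2 * d)))
    have h3 : ((j + (ℓ₀ + 1) : ℕ) : ℝ) ^ (2 * d) * (3 * C * T * ((j + (ℓ₀ + 1) : ℕ) : ℝ)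
        ^ (-1 - (α - 2 * e))) = 3 * C * T * ((j + (ℓ₀ + 1) : ℕ) : ℝ)
          ^ (-1 - (α - 2 * e - 2 * d)) := by
      rw [mul_left_comm, ← Real.rpow_add hx]
      congr 2
      ring
    rw [h3, ENNReal.ofReal_mul (by positivity : 0 ≤ 3 * C * T), ENNReal.ofReal_mul (by positivity),
      ENNReal.ofReal_mul (by positivity), ENNReal.ofReal_mul (by positivity),
      ENNReal.ofReal_natCast] at h2
    calc _ = 16 * maximalConst * (ENNReal.ofReal (((j + (ℓ₀ + 1) : ℕ) : ℝ) ^ (2 * d))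
          * (((orders (j + (ℓ₀ + 1))).card : ℝ≥0∞)
            * ENNReal.ofReal (modeWeight e (j + (ℓ₀ + 1)))
            * ENNReal.ofReal (A (j + (ℓ₀ + 1)) * T))) := by
          rw [ENNReal.ofReal_mul (by positivity)]
          ring
      _ ≤ 16 * maximalConst * (ENNReal.ofReal (3 * C * T)
          * ENNReal.ofReal (((j + (ℓ₀ + 1) : ℕ) : ℝ) ^ (-1 - (α - 2 * e - 2 * d)))) := by gcongr
      _ = _ := by ring
  have hall : ∀ᵐ ω ∂P, ∀ ℓ, ∀ m ∈ orders ℓ, ∀ t ∈ Icc 0 T,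
      ‖noiseSize W ℓ m t ω‖ₑ ^ 2 ≤ Z ℓ m ω := by
    rw [ae_all_iff]
    intro ℓ
    rw [ae_all_iff]
    intro m
    by_cases hm : m ∈ orders ℓ
    · filter_upwards [(hZ ℓ m hm).2.1] with ω hω _ using hω
    · exact ae_of_all _ fun ω h => absurd h hm
  filter_upwards [hall, ae_lt_top' (AEMeasurable.tsum hmeas') hfin] with ω h1 h2
  exact ⟨fun ℓ m => Z ℓ m ω, h1, h2.ne⟩

end Noise

/-- An envelope controls the tails of the noise. -/
lemma noiseTail_le_of_envelope {e ℓ₀ κ : ℕ} {d : ℝ} (hd : 0 ≤ d) (hκ : ℓ₀ < κ) {N : ℕ → ℤ → ℝ}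
    {Z : ℕ → ℤ → ℝ≥0∞} (hZ : ∀ ℓ, ∀ m ∈ orders ℓ, ‖N ℓ m‖ₑ ^ 2 ≤ Z ℓ m) :
    noiseTail e N κ ≤ ENNReal.ofReal ((κ : ℝ) ^ (-(2 * d)))
      * ∑' j : ℕ, ∑ m ∈ orders (j + (ℓ₀ + 1)), ENNReal.ofReal (((j + (ℓ₀ + 1) : ℕ) : ℝ) ^ (2 * d)
        * modeWeight e (j + (ℓ₀ + 1))) * Z (j + (ℓ₀ + 1)) m := by
  have hκ0 : (0 : ℝ) < κ := by exact_mod_cast (by omega : 0 < κ)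
  have h1 := ENNReal.tsum_comp_le_tsum_of_injective (add_left_injective (κ - ℓ₀))
    (fun j => ∑ m ∈ orders (j + (ℓ₀ + 1)), ENNReal.ofReal (((j + (ℓ₀ + 1) : ℕ) : ℝ) ^ (2 * d)
        * modeWeight e (j + (ℓ₀ + 1))) * Z (j + (ℓ₀ + 1)) m)
  refine le_trans ?_ (mul_le_mul_right h1 _)
  rw [noiseTail, ← ENNReal.tsum_mul_left]
  refine ENNReal.tsum_le_tsum fun j => ?_
  simp only [show j + (κ - ℓ₀) + (ℓ₀ + 1) = j + (κ + 1) by omega]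
  rw [Finset.mul_sum]
  refine Finset.sum_le_sum fun m hm => ?_
  rw [← mul_assoc, ← ENNReal.ofReal_mul (by positivity)]
  have hw := modeWeight_nonneg e (j + (κ + 1))
  gcongr
  · rw [← mul_assoc]
    refine le_mul_of_one_le_left hw ?_
    rw [Real.rpow_neg hκ0.le, ← div_eq_inv_mul, one_le_div (by positivity)]
    gcongr
    omega
  · exact hZ _ m hm

end

section

variable {Ω : Type*} [MeasurableSpace Ω] {P : Measure Ω} {T : ℝ}

/-! ### Rates of convergence -/

/-- The size of the forcing of all modes at time `t`. -/
noncomputable abbrev noiseModes (W : ℝ → Ω → L2) (t : ℝ) (ω : Ω) (ℓ : ℕ) (m : ℤ) : ℝ :=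
  noiseSize W ℓ m t ω

section Solution

variable {Q : L2 →L[ℝ] L2} {W : ℝ → Ω → L2} {v₁ v₂ : L2} {u₁ : ℝ → Ω → L2}
    {u₂ : ℝ → Ω → GenFunction}

/-- Almost surely, the modes of the position and of the velocity are bounded by those of the
initial values and of the noise. -/
lemma ae_modeBound (hT : 0 ≤ T) (hW : IsQWiener P T Q W) (hu : IsSolution P T W v₁ v₂ u₁ u₂) :
    ∀ᵐ ω ∂P, ∀ t ∈ Icc 0 T, ModeBound 0 v₁ v₂ (noiseModes W t ω) (coeff (u₁ t ω)) ∧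
      ModeBound 1 v₁ v₂ (noiseModes W t ω) (genCoeff (u₂ t ω)) := by
  filter_upwards [ae_isModeSolution hT hW hu, hW.continuousOn] with ω h hc t ht
  have hb (ℓ : ℕ) (m : ℤ) (a : ℂ) := continuousOn_pairing hc (continuous_harmonicTest ℓ m a)
  refine ⟨fun ℓ hℓ m _ => ?_, fun ℓ hℓ m _ => ?_⟩
  · rw [pow_zero, one_mul]
    exact (h ℓ m).norm_fst_le hℓ (fun r => coeff_eq_pairing _ _ _) (hb ℓ m _) (hb ℓ m _) ht
  · rw [pow_one]
    exact (h ℓ m).norm_snd_le hℓ (fun r => coeff_eq_pairing _ _ _) (hb ℓ m _) (hb ℓ m _) ht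

/-- Almost surely, the scheme reproduces the coefficients of the solution at the grid points. -/
lemma ae_schemeCoeff_eq (hT : 0 ≤ T) (hW : IsQWiener P T Q W)
    (hu : IsSolution P T W v₁ v₂ u₁ u₂) :
    ∀ᵐ ω ∂P, ∀ t ∈ Icc 0 T, ∀ (n : ℕ) (τ : ℕ → ℝ), IsPartition τ n t → ∀ (ℓ : ℕ) (m : ℤ),
      schemeCoeff ℓ (fun s => coeff (W s ω) ℓ m) τ (coeff v₁ ℓ m) (coeff v₂ ℓ m) n
        = (coeff (u₁ t ω) ℓ m, genCoeff (u₂ t ω) ℓ m) := by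
  filter_upwards [ae_isModeSolution hT hW hu] with ω h t ht n τ hτ ℓ m
  rw [(h ℓ m).schemeCoeff_eq ht hτ le_rfl, hτ.2.2]

end Solution

/-- The constant in the bounds for the moments of the error. -/
noncomputable def rateConst (C T α p : ℝ) : ℝ :=
  4 + 2 * ((noiseConst C T α 0 (ENNReal.ofReal (max p 2))).toReal
    + (noiseConst C T α 1 (ENNReal.ofReal (max p 2))).toReal)

lemma eLpNorm_two_mul_const_add_le [IsProbabilityMeasure P] (D : ℝ≥0∞) {S : Ω → ℝ≥0∞}
    (hS : AEMeasurable S P) {q : ℝ≥0∞} (hq : 1 ≤ q) (hq' : q ≠ ∞) :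
    eLpNorm (fun ω => 2 * (D + S ω)) q P ≤ 2 * (D + eLpNorm S q P) := by
  have hq0 : q ≠ 0 := (zero_lt_one.trans_le hq).ne'
  have h1 := eLpNorm_const_mul (P := P) (c := 2) (by simp) (fun ω => D + S ω) hq0 hq'
  have h2 : eLpNorm (fun ω => D + S ω) q P ≤ eLpNorm (fun _ => D) q P + eLpNorm S q P :=
    eLpNorm_add_le aestronglyMeasurable_const hS.aestronglyMeasurable hq
  have h3 : eLpNorm (fun _ : Ω => D) q P = D := by
    rw [eLpNorm_const _ hq0 (NeZero.ne P)]
    simp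
  rw [h3] at h2
  rw [h1]
  gcongr

section Rates

variable [IsProbabilityMeasure P] {Q : L2 →L[ℝ] L2} {W : ℝ → Ω → L2} {A : ℕ → ℝ≥0} {C α : ℝ}
  {ℓ₀ e : ℕ} {β γ : ℝ} {v₁ v₂ : L2} {U : ℝ → Ω → L2} {g : Ω → (ℕ → ℝ) → ℕ → ℕ → S2 → ℂ}

/-- The rate in `Lᵖ(Ω)`, for a process `U` whose modes obey the bounds of the position or of the
velocity and approximations `g` that truncate its expansion. -/
lemma eLpNorm_errorL2_le (hC : 0 ≤ C) (hT : 0 ≤ T) (he : e ≤ 1) (hα : 2 * (e : ℝ) < α)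
    (hA : ∀ ℓ > ℓ₀, (A ℓ : ℝ) ≤ C * (ℓ : ℝ) ^ (-α)) (hQ : HasAngularPowerSpectrum Q A)
    (hW : IsQWiener P T Q W) (hβ : (e : ℝ) ≤ β) (hγ : (e : ℝ) ≤ γ + 1)
    (h₁ : MemSobolev β v₁) (h₂ : MemSobolev γ v₂)
    (hU : ∀ᵐ ω ∂P, ∀ t ∈ Icc 0 T, ModeBound e v₁ v₂ (noiseModes W t ω) (coeff (U t ω)))
    (hg : ∀ᵐ ω ∂P, ∀ t ∈ Icc 0 T, ∀ (n : ℕ) (τ : ℕ → ℝ), IsPartition τ n t → ∀ (κ : ℕ) (y : S2),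
      g ω τ n κ y = ∑ ℓ ∈ Finset.range (κ + 1), ∑ m ∈ orders ℓ,
        coeff (U t ω) ℓ m * harmonicY ℓ m y)
    {p : ℝ} {κ : ℕ} (hκ : ℓ₀ < κ) {t : ℝ} (ht : t ∈ Icc 0 T) {n : ℕ} {τ : ℕ → ℝ}
    (hτ : IsPartition τ n t) :
    eLpNorm (fun ω => errorL2 (U t ω) (g ω τ n κ)) (ENNReal.ofReal p) P
      ≤ ENNReal.ofReal (rateConst C T α p * ((κ : ℝ) ^ (-(α / 2 - e))
        + (κ : ℝ) ^ (-(β - e)) * sobolevNorm β v₁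
        + (κ : ℝ) ^ (-(γ + 1 - e)) * sobolevNorm γ v₂)) := by
  -- Minkowski's inequality for square functions needs an exponent of at least `2`
  set q := ENNReal.ofReal (max p 2) with hq
  have hq2 : 2 ≤ q := by
    rw [hq, show (2 : ℝ≥0∞) = ENNReal.ofReal 2 by simp]
    exact ENNReal.ofReal_le_ofReal (le_max_right _ _)
  have hqt : q ≠ ∞ := ENNReal.ofReal_ne_top
  have hpq : ENNReal.ofReal p ≤ q := ENNReal.ofReal_le_ofReal (le_max_left _ _)
  set D := ENNReal.ofReal (initialError e β γ v₁ v₂ κ) with hD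
  set S : Ω → ℝ≥0∞ := fun ω => noiseTail e (noiseModes W t ω) κ ^ (1 / 2 : ℝ) with hS
  have hSm : AEMeasurable S P := (aemeasurable_noiseTail hW hQ e κ ht).pow_const _
  have n1 := sobolevNorm_nonneg β v₁
  have n2 := sobolevNorm_nonneg γ v₂
  have hκ0 : (0 : ℝ) ≤ κ := Nat.cast_nonneg κ
  have hi : 0 ≤ initialError e β γ v₁ v₂ κ := by
    unfold initialError
    positivity
  have hG : eLpNorm (fun ω => 2 * (D + S ω)) q P
      ≤ 2 * (D + noiseConst C T α e q * ENNReal.ofReal ((κ : ℝ) ^ (-(α / 2 - e)))) := by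
    refine (eLpNorm_two_mul_const_add_le D hSm (one_le_two.trans hq2) hqt).trans ?_
    gcongr
    exact eLpNorm_noiseTail_le hC hT he hα hA hQ hW hq2 hqt hκ ht
  have hGm : AEStronglyMeasurable (fun ω => 2 * (D + S ω)) P :=
    ((aemeasurable_const.add hSm).const_mul _).aestronglyMeasurable
  calc eLpNorm (fun ω => errorL2 (U t ω) (g ω τ n κ)) (ENNReal.ofReal p) P
      ≤ eLpNorm (fun ω => 2 * (D + S ω)) (ENNReal.ofReal p) P := by
        refine eLpNorm_mono_enorm_ae ?_
        filter_upwards [hU, hg] with ω h1 h2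
        rw [enorm_eq_self, enorm_eq_self]
        exact errorL2_le he hβ hγ h₁ h₂ (h1 t ht) (by omega) (h2 t ht n τ hτ κ)
    _ ≤ eLpNorm (fun ω => 2 * (D + S ω)) q P := eLpNorm_le_eLpNorm_of_exponent_le hpq hGm
    _ ≤ _ := hG
    _ ≤ _ := by
        have hN : noiseConst C T α e q = ENNReal.ofReal (noiseConst C T α e q).toReal :=
          (ENNReal.ofReal_toReal (noiseConst_ne_top hqt)).symm
        rw [hN, hD, ← ENNReal.ofReal_mul ENNReal.toReal_nonneg,
          ← ENNReal.ofReal_add hi (by positivity), show (2 : ℝ≥0∞) = ENNReal.ofReal 2 by simp,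
          ← ENNReal.ofReal_mul (by norm_num)]
        apply ENNReal.ofReal_le_ofReal
        have hK : 4 + 2 * (noiseConst C T α e q).toReal ≤ rateConst C T α p := by
          have k0 : 0 ≤ (noiseConst C T α 0 q).toReal := ENNReal.toReal_nonneg
          have k1 : 0 ≤ (noiseConst C T α 1 q).toReal := ENNReal.toReal_nonneg
          rw [rateConst, ← hq]
          interval_cases e <;> linarith
        refine le_trans ?_ (mul_le_mul_of_nonneg_right hK (by positivity))
        have hk : 0 ≤ (noiseConst C T α e q).toReal := ENNReal.toReal_nonneg
        generalize (noiseConst C T α e q).toReal = k at hk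
        rw [initialError]
        have x1 : 0 ≤ (κ : ℝ) ^ (-(α / 2 - e)) := by positivity
        have x2 : 0 ≤ (κ : ℝ) ^ (-(β - e)) * sobolevNorm β v₁ := by positivity
        have x3 : 0 ≤ (κ : ℝ) ^ (-(γ + 1 - e)) * sobolevNorm γ v₂ := by positivity
        nlinarith [mul_nonneg hk x2, mul_nonneg hk x3]

/-- The almost sure rate, uniformly in time, in the setting of `eLpNorm_errorL2_le`. -/
lemma ae_eventually_errorL2_le (hC : 0 ≤ C) (hT : 0 ≤ T) (he : e ≤ 1) (hα : 2 * (e : ℝ) < α)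
    (hA : ∀ ℓ > ℓ₀, (A ℓ : ℝ) ≤ C * (ℓ : ℝ) ^ (-α)) (hQ : HasAngularPowerSpectrum Q A)
    (hW : IsQWiener P T Q W) (hβ : (e : ℝ) ≤ β) (hγ : (e : ℝ) ≤ γ + 1)
    (h₁ : MemSobolev β v₁) (h₂ : MemSobolev γ v₂)
    (hU : ∀ᵐ ω ∂P, ∀ t ∈ Icc 0 T, ModeBound e v₁ v₂ (noiseModes W t ω) (coeff (U t ω)))
    (hg : ∀ᵐ ω ∂P, ∀ t ∈ Icc 0 T, ∀ (n : ℕ) (τ : ℕ → ℝ), IsPartition τ n t → ∀ (κ : ℕ) (y : S2),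
      g ω τ n κ y = ∑ ℓ ∈ Finset.range (κ + 1), ∑ m ∈ orders ℓ,
        coeff (U t ω) ℓ m * harmonicY ℓ m y)
    {δ : ℝ} (hδ : δ < min (α / 2) (min β (γ + 1))) :
    ∀ᵐ ω ∂P, ∀ᶠ κ : ℕ in atTop, ∀ t ∈ Icc 0 T, ∀ (n : ℕ) (τ : ℕ → ℝ), IsPartition τ n t →
      errorL2 (U t ω) (g ω τ n κ) ≤ ENNReal.ofReal ((κ : ℝ) ^ (-(δ - e))) := by
  rw [lt_min_iff, lt_min_iff] at hδ
  -- a nonnegative exponent strictly between `δ - e` and `α / 2 - e`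
  obtain ⟨d, hd1, hd2⟩ := exists_between
    (max_lt (by linarith : δ - e < α / 2 - e) (by linarith : 0 < α / 2 - (e : ℝ)))
  rw [max_lt_iff] at hd1
  filter_upwards [hU, hg, ae_exists_noise_envelope (d := d) hC hT he (by linarith) hA hQ hW]
    with ω h1 h2 ⟨Z, hZ, hR⟩
  filter_upwards [eventually_bound_le_rpow (e := e) hδ.2.1 hδ.2.2 hd1.1 v₁ v₂ hR,
    eventually_gt_atTop ℓ₀] with κ hκ hκ0 t ht n τ hτ
  refine (errorL2_le he hβ hγ h₁ h₂ (h1 t ht) (by omega) (h2 t ht n τ hτ κ)).trans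
    (le_trans ?_ hκ)
  gcongr
  exact noiseTail_le_of_envelope hd1.2.le hκ0 fun ℓ m hm => hZ ℓ m hm t ht

end Rates

end

section

variable {Ω : Type*} [MeasurableSpace Ω] {P : Measure Ω} {T : ℝ}

/-! ### The velocity as a square integrable process -/

lemma harmonicTest_neg_order (ℓ : ℕ) (m : ℤ) (a : ℂ) :
    harmonicTest ℓ (-m) a = (-1 : ℝ) ^ m.natAbs • harmonicTest ℓ m ((starRingEnd ℂ) a) := by
  ext y
  have e : a * ((-1) ^ m.natAbs * (starRingEnd ℂ) (harmonicY ℓ m y))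
      = (((-1 : ℝ) ^ m.natAbs : ℝ) : ℂ)
        * (starRingEnd ℂ) ((starRingEnd ℂ) a * harmonicY ℓ m y) := by
    rw [map_mul, Complex.conj_conj]
    push_cast
    ring
  rw [ContMDiffMap.coe_smul, Pi.smul_apply, harmonicTest_apply, harmonicTest_apply, harmonicY_neg,
    e, Complex.re_ofReal_mul, Complex.conj_re, smul_eq_mul]

lemma harmonicTest_neg (ℓ : ℕ) (m : ℤ) (a : ℂ) : harmonicTest ℓ m (-a) = -harmonicTest ℓ m a := by
  ext y
  rw [ContMDiffMap.coe_neg, Pi.neg_apply, harmonicTest_apply, harmonicTest_apply, neg_mul,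
    Complex.neg_re]

/-- The coefficients of a real generalized function have the symmetry of those of real functions. -/
lemma genCoeff_neg (u : GenFunction) (ℓ : ℕ) (m : ℤ) :
    genCoeff u ℓ (-m) = (-1) ^ m.natAbs * (starRingEnd ℂ) (genCoeff u ℓ m) := by
  have h : harmonicTest ℓ m ((starRingEnd ℂ) (-Complex.I)) = -harmonicTest ℓ m (-Complex.I) := by
    rw [← harmonicTest_neg, map_neg, Complex.conj_I]
  rw [genCoeff, genCoeff, harmonicTest_neg_order, harmonicTest_neg_order, h, map_smul, map_smul,
    map_neg, map_one, map_sub, map_mul, Complex.conj_I, Complex.conj_ofReal, Complex.conj_ofReal,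
    smul_eq_mul, smul_eq_mul]
  push_cast
  ring

/-- Continuous functions with the same primitive agree. -/
lemma eqOn_of_primitive_eq {f g : ℝ → ℂ} (hT : 0 < T) (hf : ContinuousOn f (Icc 0 T))
    (hg : ContinuousOn g (Icc 0 T))
    (h : ∀ t ∈ Icc 0 T, ∫ s in (0 : ℝ)..t, f s = ∫ s in (0 : ℝ)..t, g s) :
    EqOn f g (Icc 0 T) := by
  have h1 : EqOn f g (Ioo 0 T) := by
    intro t ht
    have hd := hasDerivAt_primitive_of_continuousOn hg ht
    refine (hasDerivAt_primitive_of_continuousOn hf ht).unique (hd.congr_of_eventuallyEq ?_)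
    filter_upwards [Ioo_mem_nhds ht.1 ht.2] with s hs using h s (Ioo_subset_Icc_self hs)
  refine h1.of_subset_closure hf hg Ioo_subset_Icc_self ?_
  rw [closure_Ioo hT.ne]

section Velocity

variable {Q : L2 →L[ℝ] L2} {W : ℝ → Ω → L2} {A : ℕ → ℝ≥0} {C α : ℝ} {ℓ₀ : ℕ} {β γ : ℝ}
  {v₁ v₂ : L2} {u₁ : ℝ → Ω → L2} {u₂ : ℝ → Ω → GenFunction}

/-- Almost surely, the maximal functions of the modes of the velocity are square summable. -/
lemma ae_tsum_iSup_genCoeff_ne_top [IsProbabilityMeasure P] (hC : 0 ≤ C) (hT : 0 ≤ T) (hα : 2 < α)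
    (hA : ∀ ℓ > ℓ₀, (A ℓ : ℝ) ≤ C * (ℓ : ℝ) ^ (-α)) (hQ : HasAngularPowerSpectrum Q A)
    (hW : IsQWiener P T Q W) (hβ : 1 ≤ β) (hγ : 0 ≤ γ)
    (h₁ : MemSobolev β v₁) (h₂ : MemSobolev γ v₂) (hu : IsSolution P T W v₁ v₂ u₁ u₂) :
    ∀ᵐ ω ∂P, ∑' ℓ, ∑ m ∈ orders ℓ, ⨆ t ∈ Icc 0 T, ‖genCoeff (u₂ t ω) ℓ m‖ₑ ^ 2 ≠ ∞ := by
  filter_upwards [ae_isModeSolution hT hW hu, ae_modeBound hT hW hu,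
    ae_exists_noise_envelope (e := 1) (d := 0) hC hT le_rfl (by simpa using hα) hA hQ hW]
    with ω hsol hbound ⟨Z, hZ, hR⟩
  rw [← Summable.sum_add_tsum_nat_add' (k := ℓ₀ + 1 + 1) ENNReal.summable]
  refine ENNReal.add_ne_top.mpr ⟨ENNReal.sum_ne_top.mpr fun ℓ _ => ENNReal.sum_ne_top.mpr
    fun m _ => ?_, ?_⟩
  · obtain ⟨c, hc⟩ := isCompact_Icc.exists_bound_of_continuousOn (hsol ℓ m).continuousOn_snd
    refine ne_top_of_le_ne_top (ENNReal.ofReal_ne_top (r := c ^ 2)) (iSup₂_le fun t ht => ?_)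
    rw [← ofReal_norm, ← ENNReal.ofReal_pow (norm_nonneg _)]
    exact ENNReal.ofReal_le_ofReal (pow_le_pow_left₀ (norm_nonneg _) (hc t ht) 2)
  · have t1 := tsum_tail_sobolev_le h₁ (κ := ℓ₀ + 1) (w := fun ℓ => (freq ℓ ^ 1) ^ 2) (sq_nonneg _)
      fun ℓ h => freq_pow_sq_le (by simpa using hβ) (Nat.le_add_left 1 ℓ₀) h
    have t2 := tsum_tail_sobolev_le h₂ (κ := ℓ₀ + 1) (w := modeWeight 1) (sq_nonneg _)
      fun ℓ h => modeWeight_le le_rfl (by simpa using hγ) (Nat.le_add_left 1 ℓ₀) h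
    have t3 := ENNReal.tsum_comp_le_tsum_of_injective (add_left_injective 1)
      (fun j => ∑ m ∈ orders (j + (ℓ₀ + 1)),
        ENNReal.ofReal (((j + (ℓ₀ + 1) : ℕ) : ℝ) ^ (2 * (0 : ℝ)) * modeWeight 1 (j + (ℓ₀ + 1)))
          * Z (j + (ℓ₀ + 1)) m)
    simp only [mul_zero, Real.rpow_zero, one_mul] at t3 hR
    have t3' := ne_top_of_le_ne_top hR t3
    have t1' := ne_top_of_le_ne_top ENNReal.ofReal_ne_top t1
    have t2' := ne_top_of_le_ne_top ENNReal.ofReal_ne_top t2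
    refine ne_top_of_le_ne_top (ENNReal.mul_ne_top (by simp : (3 : ℝ≥0∞) ≠ ∞)
      (ENNReal.add_ne_top.mpr ⟨ENNReal.add_ne_top.mpr ⟨t1', t2'⟩, t3'⟩)) ?_
    rw [← ENNReal.tsum_add, ← ENNReal.tsum_add, ← ENNReal.tsum_mul_left]
    refine ENNReal.tsum_le_tsum fun j => ?_
    rw [Finset.mul_sum, Finset.mul_sum, show j + 1 + (ℓ₀ + 1) = j + (ℓ₀ + 1 + 1) by omega,
      ← Finset.sum_add_distrib, ← Finset.sum_add_distrib, Finset.mul_sum]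
    refine Finset.sum_le_sum fun m hm => iSup₂_le fun t ht => ?_
    refine ((hbound t ht).2.enorm_sq_le (by omega) hm).trans ?_
    gcongr
    exact hZ _ m hm t ht

/-- A family of `L²` functions whose coefficients are those of the velocity represents it. Both
sides have the same primitive, namely the position, and are continuous in time. -/
lemma eq_pairing_of_coeff_eq {w : ℝ → L2} {x₁ : ℝ → L2} {x₂ : ℝ → GenFunction} {V : ℝ → L2}
    (hT : 0 ≤ T) (hw0 : w 0 = 0) (hw : ContinuousOn w (Icc 0 T))
    (hmode : ∀ ℓ m, IsModeSolution ℓ T (fun t => coeff (w t) ℓ m) (coeff v₁ ℓ m) (coeff v₂ ℓ m)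
      (fun t => coeff (x₁ t) ℓ m) (fun t => genCoeff (x₂ t) ℓ m))
    (hfin : ∑' ℓ, ∑ m ∈ orders ℓ, ⨆ t ∈ Icc 0 T, ‖genCoeff (x₂ t) ℓ m‖ₑ ^ 2 ≠ ∞)
    (hV : ∀ t ∈ Icc 0 T, ∀ ℓ, ∀ m ∈ orders ℓ, coeff (V t) ℓ m = genCoeff (x₂ t) ℓ m)
    {φ : SphTestFunction}
    (hi : IntervalIntegrable (fun s => pairing (x₁ s) (sphLaplacian φ)) volume 0 T)
    (hp : ∀ t ∈ Icc 0 T, pairing (x₁ t) φ = pairing v₁ φ + ∫ s in (0 : ℝ)..t, x₂ s φ)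
    (hv : ∀ t ∈ Icc 0 T, x₂ t φ = pairing v₂ φ
      + (∫ s in (0 : ℝ)..t, pairing (x₁ s) (sphLaplacian φ)) + pairing (w t) φ)
    {t : ℝ} (ht : t ∈ Icc 0 T) : x₂ t φ = pairing (V t) φ := by
  have hφ : Continuous φ := φ.contMDiff.continuous
  set c : HarmonicIndex → ℂ := fun i => (starRingEnd ℂ) (coeff (testLp φ hφ) i.1 i.2) with hc
  set y : HarmonicIndex → ℝ → ℂ := fun i s => genCoeff (x₂ s) i.1 i.2 with hy
  have hysum {s : ℝ} (hs : s ∈ Icc 0 T) : HasSum (fun i => y i s * c i) (pairing (V s) φ : ℂ) := by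
    have h := hasSum_pairing (V s) φ hφ
    refine h.congr_fun fun i => ?_
    rw [hy, hc, hV s hs i.1 i.2 i.2.2]
  -- the terms of the series are dominated uniformly in time
  set b : HarmonicIndex → ℝ := fun i =>
    (⨆ t ∈ Icc 0 T, ‖genCoeff (x₂ t) i.1 i.2‖ₑ ^ 2).toReal + ‖c i‖ ^ 2 with hb
  have hfin' : ∑' i : HarmonicIndex, ⨆ t ∈ Icc 0 T, ‖genCoeff (x₂ t) i.1 i.2‖ₑ ^ 2 ≠ ∞ := by
    rwa [tsum_harmonicIndex fun ℓ m => ⨆ t ∈ Icc 0 T, ‖genCoeff (x₂ t) ℓ m‖ₑ ^ 2]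
  have hbs : Summable b := by
    refine (ENNReal.summable_toReal hfin').add ?_
    have h1 : ∑' i : HarmonicIndex, ‖coeff (testLp φ hφ) i.1 i.2‖ₑ ^ 2 ≠ ∞ := by
      rw [tsum_harmonicIndex fun ℓ m => ‖coeff (testLp φ hφ) ℓ m‖ₑ ^ 2, tsum_enorm_coeff_sq]
      simp
    refine (ENNReal.summable_toReal h1).congr fun i => ?_
    rw [hc, RCLike.norm_conj, ENNReal.toReal_pow, toReal_enorm]
  have hbound (i : HarmonicIndex) {s : ℝ} (hs : s ∈ Icc 0 T) : ‖y i s * c i‖ ≤ b i := by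
    have h1 : ‖y i s‖ ^ 2 ≤ (⨆ t ∈ Icc 0 T, ‖genCoeff (x₂ t) i.1 i.2‖ₑ ^ 2).toReal := by
      have h2 : ‖y i s‖ₑ ^ 2 ≤ ⨆ t ∈ Icc 0 T, ‖genCoeff (x₂ t) i.1 i.2‖ₑ ^ 2 :=
        le_iSup₂ (f := fun t (_ : t ∈ Icc 0 T) => ‖genCoeff (x₂ t) i.1 i.2‖ₑ ^ 2) s hs
      have h3 := ENNReal.toReal_mono (ENNReal.ne_top_of_tsum_ne_top hfin' i) h2
      rwa [ENNReal.toReal_pow, toReal_enorm] at h3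
    rw [norm_mul]
    simp only [hb]
    nlinarith [sq_nonneg (‖y i s‖ - ‖c i‖), sq_nonneg ‖y i s‖, sq_nonneg ‖c i‖]
  have hycont (i : HarmonicIndex) : ContinuousOn (fun s => y i s * c i) (Icc 0 T) :=
    (hmode i.1 i.2).continuousOn_snd.mul continuousOn_const
  have hVcont : ContinuousOn (fun s => ((pairing (V s) φ : ℝ) : ℂ)) (Icc 0 T) :=
    (continuousOn_tsum hycont hbs fun i s hs => hbound i hs).congr fun s hs =>
      (hysum hs).tsum_eq.symm
  have hxcont : ContinuousOn (fun s => ((x₂ s φ : ℝ) : ℂ)) (Icc 0 T) := by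
    have h1 := continuousOn_primitive_Icc (intervalIntegrable_ofReal hi)
    refine ((continuousOn_const (c := ((pairing v₂ φ : ℝ) : ℂ))).add h1 |>.add
      (Complex.continuous_ofReal.comp_continuousOn (continuousOn_pairing hw hφ))).congr ?_
    intro s hs
    simp only [Pi.add_apply, Function.comp_apply, hv s hs, intervalIntegral.integral_ofReal]
    push_cast
    rfl
  have hprim : ∀ r ∈ Icc 0 T, ∫ s in (0 : ℝ)..r, ((x₂ s φ : ℝ) : ℂ)
      = ∫ s in (0 : ℝ)..r, ((pairing (V s) φ : ℝ) : ℂ) := by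
    intro r hr
    have hsub : uIoc 0 r ⊆ Icc 0 T := by
      rw [uIoc_of_le hr.1]
      exact fun s hs => ⟨hs.1.le, hs.2.trans hr.2⟩
    have h1 : HasSum (fun i => ∫ s in (0 : ℝ)..r, y i s * c i)
        (∫ s in (0 : ℝ)..r, ((pairing (V s) φ : ℝ) : ℂ)) := by
      refine intervalIntegral.hasSum_integral_of_dominated_convergence (fun i _ => b i)
        (fun i => ((hycont i).mono hsub).aestronglyMeasurable measurableSet_uIoc)
        (fun i => ae_of_all _ fun s hs => hbound i (hsub hs))
        (ae_of_all _ fun s _ => hbs) intervalIntegrable_const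
        (ae_of_all _ fun s hs => hysum (hsub hs))
    have h2 := (hasSum_pairing (x₁ r) φ hφ).sub (hasSum_pairing v₁ φ hφ)
    have h3 : ∫ s in (0 : ℝ)..r, ((pairing (V s) φ : ℝ) : ℂ)
        = (pairing (x₁ r) φ : ℂ) - (pairing v₁ φ : ℂ) := by
      refine h1.unique (h2.congr_fun fun i => ?_)
      rw [(hmode i.1 i.2).fst_eq r hr, intervalIntegral.integral_mul_const]
      ring
    rw [h3, hp r hr, intervalIntegral.integral_ofReal]
    push_cast
    ring
  -- for `T = 0` the primitives carry no information, but the initial values agree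
  rcases hT.eq_or_lt with rfl | hT'
  · obtain rfl : t = 0 := le_antisymm ht.2 ht.1
    have h1 := hysum ht
    have h2 : HasSum (fun i => y i 0 * c i) (pairing v₂ φ : ℂ) :=
      (hasSum_pairing v₂ φ hφ).congr_fun fun i => by
        simp only [hy, hc]
        rw [(hmode i.1 i.2).snd_zero le_rfl]
    have h3 : pairing (V 0) φ = pairing v₂ φ := by exact_mod_cast h1.unique h2
    rw [h3, hv 0 ht, hw0, pairing_eq_inner 0 _ hφ]
    simp
  · exact_mod_cast eqOn_of_primitive_eq hT' hxcont hVcont hprim ht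

/-- The velocity is represented by an `L²(S²)`-valued process with the same coefficients. -/
lemma exists_velocity_process [IsProbabilityMeasure P] (hC : 0 ≤ C) (hT : 0 ≤ T) (hα : 2 < α)
    (hA : ∀ ℓ > ℓ₀, (A ℓ : ℝ) ≤ C * (ℓ : ℝ) ^ (-α)) (hQ : HasAngularPowerSpectrum Q A)
    (hW : IsQWiener P T Q W) (hβ : 1 ≤ β) (hγ : 0 ≤ γ)
    (h₁ : MemSobolev β v₁) (h₂ : MemSobolev γ v₂) (hu : IsSolution P T W v₁ v₂ u₁ u₂) :
    ∃ U₂ : ℝ → Ω → L2,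
      (∀ᵐ ω ∂P, ∀ t ∈ Icc 0 T, ∀ ℓ, ∀ m ∈ orders ℓ,
        coeff (U₂ t ω) ℓ m = genCoeff (u₂ t ω) ℓ m) ∧
      ∀ φ : SphTestFunction, ∀ᵐ ω ∂P, ∀ t ∈ Icc 0 T, u₂ t ω φ = pairing (U₂ t ω) φ := by
  have hex (t : ℝ) (ω : Ω) : ∃ V : L2, ∑' ℓ, ∑ m ∈ orders ℓ, ‖genCoeff (u₂ t ω) ℓ m‖ₑ ^ 2 ≠ ∞ →
      ∀ ℓ, ∀ m ∈ orders ℓ, coeff V ℓ m = genCoeff (u₂ t ω) ℓ m := by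
    by_cases h : ∑' ℓ, ∑ m ∈ orders ℓ, ‖genCoeff (u₂ t ω) ℓ m‖ₑ ^ 2 ≠ ∞
    · obtain ⟨V, hV⟩ := exists_coeff_eq (genCoeff (u₂ t ω)) h fun ℓ m _ => genCoeff_neg _ ℓ m
      exact ⟨V, fun _ => hV⟩
    · exact ⟨0, fun h' => absurd h' h⟩
  choose U₂ hU₂ using hex
  have hfin := ae_tsum_iSup_genCoeff_ne_top hC hT hα hA hQ hW hβ hγ h₁ h₂ hu
  have hcoeff : ∀ᵐ ω ∂P, ∀ t ∈ Icc 0 T, ∀ ℓ, ∀ m ∈ orders ℓ,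
      coeff (U₂ t ω) ℓ m = genCoeff (u₂ t ω) ℓ m := by
    filter_upwards [hfin] with ω h t ht
    refine hU₂ t ω (ne_top_of_le_ne_top h (ENNReal.tsum_le_tsum fun ℓ =>
      Finset.sum_le_sum fun m _ => ?_))
    exact le_iSup₂ (f := fun t (_ : t ∈ Icc 0 T) => ‖genCoeff (u₂ t ω) ℓ m‖ₑ ^ 2) t ht
  refine ⟨U₂, hcoeff, fun φ => ?_⟩
  filter_upwards [hcoeff, hfin, ae_isModeSolution hT hW hu, hW.zero, hW.continuousOn,
    hu.integrable_laplacian φ, hu.position φ, hu.velocity φ] with ω k1 k2 k3 k4 k5 k6 k7 k8 t ht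
  exact eq_pairing_of_coeff_eq (v₁ := v₁) (v₂ := v₂) hT k4 k5 k3 k2 k1 k6 k7 k8 ht

end Velocity

end

end SphereWave

/-! ### Convergence of the spectral scheme -/

open SphereWave in
theorem proposition4p1 (C : ℝ) (hC : 0 < C) (T : ℝ) (hT : 0 ≤ T) (α : ℝ) (hα : 2 < α) :
    ∃ K : ℝ → ℝ, ∀ (Ω : Type*) [MeasurableSpace Ω] (P : Measure Ω) [IsProbabilityMeasure P]
      (A : ℕ → ℝ≥0) (ℓ₀ : ℕ) (Q : L2 →L[ℝ] L2) (W : ℝ → Ω → L2)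
      (v₁ v₂ : L2) (β γ : ℝ) (u₁ : ℝ → Ω → L2) (u₂ : ℝ → Ω → GenFunction),
      (∀ ℓ > ℓ₀, (A ℓ : ℝ) ≤ C * (ℓ : ℝ) ^ (-α)) →
      HasAngularPowerSpectrum Q A →
      IsQWiener P T Q W →
      MemSobolev β v₁ → MemSobolev γ v₂ →
      IsSolution P T W v₁ v₂ u₁ u₂ →
      -- the position
      (0 ≤ β → -1 ≤ γ →
        (∀ p : ℝ, 1 ≤ p → ∀ κ > ℓ₀, ∀ t ∈ Icc 0 T, ∀ (n : ℕ) (τ : ℕ → ℝ), IsPartition τ n t →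
          eLpNorm (fun ω => errorL2 (u₁ t ω) (approxPosition (fun s => W s ω) v₁ v₂ τ n κ))
              (ENNReal.ofReal p) P
            ≤ ENNReal.ofReal (K p * ((κ : ℝ) ^ (-(α / 2))
                + (κ : ℝ) ^ (-β) * sobolevNorm β v₁
                + (κ : ℝ) ^ (-(γ + 1)) * sobolevNorm γ v₂))) ∧
        (∀ δ < min (α / 2) (min β (γ + 1)), ∀ᵐ ω ∂P, ∀ᶠ κ : ℕ in atTop,
          ∀ t ∈ Icc 0 T, ∀ (n : ℕ) (τ : ℕ → ℝ), IsPartition τ n t →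
            errorL2 (u₁ t ω) (approxPosition (fun s => W s ω) v₁ v₂ τ n κ)
              ≤ ENNReal.ofReal ((κ : ℝ) ^ (-δ)))) ∧
      -- the velocity, which is then represented by an `L²(S²)`-valued process `U₂`
      (1 ≤ β → 0 ≤ γ →
        ∃ U₂ : ℝ → Ω → L2,
          (∀ φ : SphTestFunction, ∀ᵐ ω ∂P, ∀ t ∈ Icc 0 T, u₂ t ω φ = pairing (U₂ t ω) φ) ∧
          (∀ p : ℝ, 1 ≤ p → ∀ κ > ℓ₀, ∀ t ∈ Icc 0 T, ∀ (n : ℕ) (τ : ℕ → ℝ), IsPartition τ n t →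
            eLpNorm (fun ω => errorL2 (U₂ t ω) (approxVelocity (fun s => W s ω) v₁ v₂ τ n κ))
                (ENNReal.ofReal p) P
              ≤ ENNReal.ofReal (K p * ((κ : ℝ) ^ (-(α / 2 - 1))
                  + (κ : ℝ) ^ (-(β - 1)) * sobolevNorm β v₁
                  + (κ : ℝ) ^ (-γ) * sobolevNorm γ v₂))) ∧
          (∀ δ < min (α / 2) (min β (γ + 1)), ∀ᵐ ω ∂P, ∀ᶠ κ : ℕ in atTop,
            ∀ t ∈ Icc 0 T, ∀ (n : ℕ) (τ : ℕ → ℝ), IsPartition τ n t →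
              errorL2 (U₂ t ω) (approxVelocity (fun s => W s ω) v₁ v₂ τ n κ)
                ≤ ENNReal.ofReal ((κ : ℝ) ^ (-(δ - 1))))) := by
  refine ⟨rateConst C T α, ?_⟩
  intro Ω _ P _ A ℓ₀ Q W v₁ v₂ β γ u₁ u₂ hA hQ hW h₁ h₂ hu
  have hmode := ae_modeBound hT hW hu
  have hscheme := ae_schemeCoeff_eq hT hW hu
  refine ⟨fun hβ hγ => ?_, fun hβ hγ => ?_⟩
  · have hβ' : ((0 : ℕ) : ℝ) ≤ β := by simpa using hβ
    have hγ' : ((0 : ℕ) : ℝ) ≤ γ + 1 := by simpa using (by linarith : 0 ≤ γ + 1)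
    have hα' : 2 * ((0 : ℕ) : ℝ) < α := by simpa using (by linarith : 0 < α)
    have hU : ∀ᵐ ω ∂P, ∀ t ∈ Icc 0 T, ModeBound 0 v₁ v₂ (noiseModes W t ω) (coeff (u₁ t ω)) := by
      filter_upwards [hmode] with ω h t ht using (h t ht).1
    have hg : ∀ᵐ ω ∂P, ∀ t ∈ Icc 0 T, ∀ (n : ℕ) (τ : ℕ → ℝ), IsPartition τ n t →
        ∀ (κ : ℕ) (y : S2), approxPosition (fun s => W s ω) v₁ v₂ τ n κ y
          = ∑ ℓ ∈ Finset.range (κ + 1), ∑ m ∈ orders ℓ,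
            coeff (u₁ t ω) ℓ m * harmonicY ℓ m y := by
      filter_upwards [hscheme] with ω h t ht n τ hτ κ y
      simp only [approxPosition, h t ht n τ hτ]
    refine ⟨fun p _ κ hκ t ht n τ hτ => ?_, fun δ hδ => ?_⟩
    · have h := eLpNorm_errorL2_le hC.le hT zero_le_one hα' hA hQ hW hβ' hγ' h₁ h₂ hU hg
        (p := p) hκ ht hτ
      simpa only [Nat.cast_zero, sub_zero] using h
    · have h := ae_eventually_errorL2_le hC.le hT zero_le_one hα' hA hQ hW hβ' hγ' h₁ h₂ hU hg hδ
      simpa only [Nat.cast_zero, sub_zero] using h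
  · have hβ' : ((1 : ℕ) : ℝ) ≤ β := by simpa using hβ
    have hγ' : ((1 : ℕ) : ℝ) ≤ γ + 1 := by simpa using hγ
    have hα' : 2 * ((1 : ℕ) : ℝ) < α := by simpa using hα
    obtain ⟨U₂, hcoeff, hrep⟩ := exists_velocity_process hC.le hT hα hA hQ hW hβ hγ h₁ h₂ hu
    have hU : ∀ᵐ ω ∂P, ∀ t ∈ Icc 0 T, ModeBound 1 v₁ v₂ (noiseModes W t ω) (coeff (U₂ t ω)) := by
      filter_upwards [hmode, hcoeff] with ω h hc t ht ℓ hℓ m hm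
      rw [hc t ht ℓ m hm]
      exact (h t ht).2 ℓ hℓ m hm
    have hg : ∀ᵐ ω ∂P, ∀ t ∈ Icc 0 T, ∀ (n : ℕ) (τ : ℕ → ℝ), IsPartition τ n t →
        ∀ (κ : ℕ) (y : S2), approxVelocity (fun s => W s ω) v₁ v₂ τ n κ y
          = ∑ ℓ ∈ Finset.range (κ + 1), ∑ m ∈ orders ℓ,
            coeff (U₂ t ω) ℓ m * harmonicY ℓ m y := by
      filter_upwards [hscheme, hcoeff] with ω h hc t ht n τ hτ κ y
      simp only [approxVelocity, h t ht n τ hτ]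
      refine Finset.sum_congr rfl fun ℓ _ => Finset.sum_congr rfl fun m hm => ?_
      rw [hc t ht ℓ m hm]
    refine ⟨U₂, hrep, fun p _ κ hκ t ht n τ hτ => ?_, fun δ hδ => ?_⟩
    · have h := eLpNorm_errorL2_le hC.le hT le_rfl hα' hA hQ hW hβ' hγ' h₁ h₂ hU hg
        (p := p) hκ ht hτ
      simpa only [Nat.cast_one, add_sub_cancel_right] using h
    · have h := ae_eventually_errorL2_le hC.le hT le_rfl hα' hA hQ hW hβ' hγ' h₁ h₂ hU hg hδ
      simpa only [Nat.cast_one] using h
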